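/- Fix a countably infinite data domain $\mathbb D$ with equality as its only predicate, given with an effective coding by natural numbers. A trace is an infinite word $t\in\mathbb D^\omega$. **Logic.** Formulae of recHMLd are given by $$\varphi::=\mathsf{tt}\mid\mathsf{ff}\mid\langle b\rangle\varphi\mid[b]\varphi\mid\exists x.\varphi\mid\forall x.\varphi\mid\varphi\lor\varphi\mid\varphi\land\varphi\mid\min X.\varphi\mid\max X.\varphi\mid X,$$ where $b::=\mathsf{true}\mid e=e\mid\neg b\mid b\land b$, and $e$ is a data variable $x$ or the symbol $\star$, which denotes the current data value. Formulae are interpreted as sets of traces, in the linear-time way: $\langle b\rangle\varphi$ (resp. $[b]\varphi$) holds of $d\,u$ if $b$ holds for $\star=d$ and (resp. implies that) $u$ satisfies $\varphi$; quantifiers range over $\mathbb D$; $\min X$ and $\max X$ are the least and greatest fixed points of the corresponding operator on functions from data environments to sets of traces. Formulae are closed, every occurrence of a recursion variable lies under a modality within its defining fixed-point formula, and each recursion variable is bound by a unique fixed-point formula; $[\![\varphi]\!]$ is the set of traces satisfying $\varphi$. The fragment sHMLd consists of the formulae built from $\mathsf{ff}$, $[b]\varphi$, $\forall x.\varphi$,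 $\lor$, $\land$, $\max X.\varphi$ and $X$ only. **Monitorability.** A monitor consists of two predicates, acceptance and rejection, on finite words over $\mathbb D$, never both true of the same word and each preserved under extension of the word; it accepts a trace if it accepts one of its finite prefixes. A set $T$ of traces is *monitorable for satisfactions* if some monitor accepts exactly the traces in $T$ (that is, it is sound and complete for satisfactions), and *effectively monitorable for satisfactions* if there is a Turing machine such that a trace belongs to $T$ if and only if the machine accepts some finite prefix of the trace. A formula $\varphi$ has one of these properties if $[\![\varphi]\!]$ has it. **Turing machines and encodings.** Let $M$ be a deterministic Turing machine with states $p_0,\dots,p_k$, initial state $p_0$, transition function $\{p_0,\dots,p_k\}\times\{0,1\}\to\{0,1\}\times\{\leftarrow,\rightarrow\}\times\{p_0,\dots,p_k\}$, and a tape that is infinite to the right, with cells outside the used part holding $0$ (a left move on the leftmost cell leaves the head in place). $M$ halts when it enters the final state $p_f$. A configuration $(q,u,h)$ consists of a state $q$, a word $u=u_0\cdots u_{n-1}\in\{0,1\}^n$ and a head position $0\le h<n$; on input $w\ne\varepsilon$ the run starts in $(p_0,w,0)$, and $u$ is extended by one cell holding $0$ when the head leaves it. For pairwise distinct data values $d^{\#},d^{p_0},\dots,d^{p_k},d^0,d^1,d^{\dot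 0},d^{\dot 1},i_0,i_1,\dots$, let $\mathrm{enc}(q,u,h)=d^q\,i_0\,w_0\,i_1\,w_1\cdots i_{n-1}\,w_{n-1}$, where $w_h=d^{\dot u_h}$ and $w_j=d^{u_j}$ for $j\neq h$. A run $c_0,c_1,\dots$ is encoded by $$d^\#d^{p_0}\cdots d^{p_k}d^0d^1d^{\dot 0}d^{\dot 1}\,d^\#\,\mathrm{enc}(c_0)\,d^\#\,\mathrm{enc}(c_1)\,d^\#\cdots .$$ A non-terminating run is encoded by this infinite word. A terminating run, and any finite prefix of a run, ending in $c_n$, is encoded by the finite word that ends in $d^\#\mathrm{enc}(c_n)d^\#$. A trace *encodes* a run, or a prefix of a run, if for some choice of the pairwise distinct data values it is equal to its encoding when this is infinite, or has it as a prefix when it is finite. **Theorem.** 1. From each deterministic Turing machine $M$ as above one can compute (a) a formula $\psi_M^e$ of sHMLd such that $[\![\psi_M^e]\!]$ is the set of traces that encode the run of $M$ on input $0$; (b) a formula $\psi_M^{\neg H}$ of recHMLd such that $[\![\psi_M^{\neg H}]\!]$ is the set of traces that encode a non-empty prefix of a run of $M$ (on some non-empty input) but do not encode a terminating run of $M$.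 2. It is undecidable whether a given formula of sHMLd is monitorable for satisfactions, and whether it is effectively monitorable for satisfactions. It is likewise undecidable whether a given formula of recHMLd is monitorable for satisfactions, and whether it is effectively monitorable for satisfactions. -/

import Mathlib

namespace RecHML

/-! ### Syntax -/

/-- Data expressions: a data variable, or the placeholder `⋆` for the current action. -/
inductive DExp : Type
  | star : DExp
  | var : ℕ → DExp

/-- Boolean constraint expressions. -/
inductive BExp : Type
  | tru : BExp
  | eq : DExp → DExp → BExp
  | neg : BExp → BExp
  | and : BExp → BExp → BExp

/-- Formulae; data variables and recursion variables are named by natural numbers.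
`lfp` and `gfp` are the binders written `min X. φ` and `max X. φ`. -/
inductive Formula : Type
  | tt : Formula
  | ff : Formula
  | pos : BExp → Formula → Formula
  | nec : BExp → Formula → Formula
  | ex : ℕ → Formula → Formula
  | all : ℕ → Formula → Formula
  | or : Formula → Formula → Formula
  | and : Formula → Formula → Formula
  | lfp : ℕ → Formula → Formula
  | gfp : ℕ → Formula → Formula
  | var : ℕ → Formula

/-! ### Gödel numbering of the syntax

These bijections with `ℕ` make the syntax a datatype on which computable functions are defined. -/

/-- Data expressions correspond to `Option ℕ`. -/
def DExp.equivOption : DExp ≃ Option ℕ where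
  toFun e := match e with
    | DExp.star => none
    | DExp.var x => some x
  invFun o := match o with
    | none => DExp.star
    | some x => DExp.var x
  left_inv e := by cases e <;> rfl
  right_inv o := by cases o <;> rfl

instance DExp.instDenumerable : Denumerable DExp := Denumerable.ofEquiv _ DExp.equivOption

/-- Gödel number of a constraint. -/
def BExp.toNat : BExp → ℕ
  | BExp.tru => 0
  | BExp.eq e f => 3 * Nat.pair (Encodable.encode e) (Encodable.encode f) + 1
  | BExp.neg b => 3 * b.toNat + 2
  | BExp.and b c => 3 * Nat.pair b.toNat c.toNat + 3

/-- The constraint with a given Gödel number. -/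
def BExp.ofNat : ℕ → BExp
  | 0 => BExp.tru
  | n + 1 =>
    let m := n / 3
    have hm : m < n + 1 := by omega
    have h1 : m.unpair.1 < n + 1 := lt_of_le_of_lt m.unpair_left_le hm
    have h2 : m.unpair.2 < n + 1 := lt_of_le_of_lt m.unpair_right_le hm
    match n % 3 with
    | 0 => BExp.eq (Denumerable.ofNat DExp m.unpair.1) (Denumerable.ofNat DExp m.unpair.2)
    | 1 => BExp.neg (BExp.ofNat m)
    | _ => BExp.and (BExp.ofNat m.unpair.1) (BExp.ofNat m.unpair.2)
termination_by n => n
decreasing_by all_goals assumption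

theorem BExp.ofNat_toNat (b : BExp) : BExp.ofNat b.toNat = b := by
  induction b with
  | tru => simp [BExp.toNat, BExp.ofNat]
  | eq e f => simp [BExp.toNat, BExp.ofNat, -Denumerable.ofEquiv_ofNat]
  | neg b ih =>
    have h1 : (3 * b.toNat + 1) / 3 = b.toNat := by omega
    have h2 : (3 * b.toNat + 1) % 3 = 1 := by omega
    simp [BExp.toNat, BExp.ofNat, h1, h2, ih]
  | and b c ihb ihc =>
    have h1 : (3 * Nat.pair b.toNat c.toNat + 2) / 3 = Nat.pair b.toNat c.toNat := by omega
    have h2 : (3 * Nat.pair b.toNat c.toNat + 2) % 3 = 2 := by omega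
    simp [BExp.toNat, BExp.ofNat, h1, h2, ihb, ihc]

theorem BExp.toNat_ofNat (n : ℕ) : (BExp.ofNat n).toNat = n := by
  induction n using Nat.strong_induction_on with
  | _ n ih =>
    cases n with
    | zero => simp [BExp.toNat, BExp.ofNat]
    | succ n =>
      have hm : n / 3 < n + 1 := by omega
      have ih0 := ih _ hm
      have ih1 := ih _ (lt_of_le_of_lt (n / 3).unpair_left_le hm)
      have ih2 := ih _ (lt_of_le_of_lt (n / 3).unpair_right_le hm)
      have h3 : n % 3 < 3 := Nat.mod_lt _ (by norm_num)
      rw [BExp.ofNat]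
      generalize hr : n % 3 = r at h3
      interval_cases r <;>
        simp [BExp.toNat, ih0, ih1, ih2, -Denumerable.ofEquiv_ofNat] <;> omega

instance BExp.instDenumerable : Denumerable BExp :=
  Denumerable.mk' ⟨BExp.toNat, BExp.ofNat, BExp.ofNat_toNat, BExp.toNat_ofNat⟩

/-- Gödel number of a formula. -/
def Formula.toNat : Formula → ℕ
  | Formula.tt => 0
  | Formula.ff => 1
  | Formula.pos b φ => 9 * Nat.pair (Encodable.encode b) φ.toNat + 2
  | Formula.nec b φ => 9 * Nat.pair (Encodable.encode b) φ.toNat + 3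
  | Formula.ex x φ => 9 * Nat.pair x φ.toNat + 4
  | Formula.all x φ => 9 * Nat.pair x φ.toNat + 5
  | Formula.or φ ψ => 9 * Nat.pair φ.toNat ψ.toNat + 6
  | Formula.and φ ψ => 9 * Nat.pair φ.toNat ψ.toNat + 7
  | Formula.lfp X φ => 9 * Nat.pair X φ.toNat + 8
  | Formula.gfp X φ => 9 * Nat.pair X φ.toNat + 9
  | Formula.var X => 9 * X + 10

/-- The formula with a given Gödel number. -/
def Formula.ofNat : ℕ → Formula
  | 0 => Formula.tt
  | 1 => Formula.ff
  | n + 2 =>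
    let m := n / 9
    have hm : m < n + 2 := by omega
    have h1 : m.unpair.1 < n + 2 := lt_of_le_of_lt m.unpair_left_le hm
    have h2 : m.unpair.2 < n + 2 := lt_of_le_of_lt m.unpair_right_le hm
    match n % 9 with
    | 0 => Formula.pos (Denumerable.ofNat BExp m.unpair.1) (Formula.ofNat m.unpair.2)
    | 1 => Formula.nec (Denumerable.ofNat BExp m.unpair.1) (Formula.ofNat m.unpair.2)
    | 2 => Formula.ex m.unpair.1 (Formula.ofNat m.unpair.2)
    | 3 => Formula.all m.unpair.1 (Formula.ofNat m.unpair.2)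
    | 4 => Formula.or (Formula.ofNat m.unpair.1) (Formula.ofNat m.unpair.2)
    | 5 => Formula.and (Formula.ofNat m.unpair.1) (Formula.ofNat m.unpair.2)
    | 6 => Formula.lfp m.unpair.1 (Formula.ofNat m.unpair.2)
    | 7 => Formula.gfp m.unpair.1 (Formula.ofNat m.unpair.2)
    | _ => Formula.var m
termination_by n => n
decreasing_by all_goals assumption

theorem Formula.ofNat_aux (m r : ℕ) (hr : r < 9) :
    (9 * m + r) / 9 = m ∧ (9 * m + r) % 9 = r := by omega

theorem Formula.ofNat_toNat (φ : Formula) : Formula.ofNat φ.toNat = φ := by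
  induction φ with
  | tt => simp [Formula.toNat, Formula.ofNat]
  | ff => simp [Formula.toNat, Formula.ofNat]
  | pos b φ ih =>
    obtain ⟨h1, h2⟩ := Formula.ofNat_aux (Nat.pair (Encodable.encode b) φ.toNat) 0 (by norm_num)
    rw [Nat.add_zero] at h1 h2
    simp [Formula.toNat, Formula.ofNat, h1, ih]
  | nec b φ ih =>
    obtain ⟨h1, h2⟩ := Formula.ofNat_aux (Nat.pair (Encodable.encode b) φ.toNat) 1 (by norm_num)
    simp [Formula.toNat, Formula.ofNat, h1, h2, ih]
  | ex x φ ih =>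
    obtain ⟨h1, h2⟩ := Formula.ofNat_aux (Nat.pair x φ.toNat) 2 (by norm_num)
    simp [Formula.toNat, Formula.ofNat, h1, h2, ih]
  | all x φ ih =>
    obtain ⟨h1, h2⟩ := Formula.ofNat_aux (Nat.pair x φ.toNat) 3 (by norm_num)
    simp [Formula.toNat, Formula.ofNat, h1, h2, ih]
  | or φ ψ ih1 ih2 =>
    obtain ⟨h1, h2⟩ := Formula.ofNat_aux (Nat.pair φ.toNat ψ.toNat) 4 (by norm_num)
    simp [Formula.toNat, Formula.ofNat, h1, h2, ih1, ih2]
  | and φ ψ ih1 ih2 =>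
    obtain ⟨h1, h2⟩ := Formula.ofNat_aux (Nat.pair φ.toNat ψ.toNat) 5 (by norm_num)
    simp [Formula.toNat, Formula.ofNat, h1, h2, ih1, ih2]
  | lfp X φ ih =>
    obtain ⟨h1, h2⟩ := Formula.ofNat_aux (Nat.pair X φ.toNat) 6 (by norm_num)
    simp [Formula.toNat, Formula.ofNat, h1, h2, ih]
  | gfp X φ ih =>
    obtain ⟨h1, h2⟩ := Formula.ofNat_aux (Nat.pair X φ.toNat) 7 (by norm_num)
    simp [Formula.toNat, Formula.ofNat, h1, h2, ih]
  | var X =>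
    obtain ⟨h1, h2⟩ := Formula.ofNat_aux X 8 (by norm_num)
    simp [Formula.toNat, Formula.ofNat, h1, h2]

theorem Formula.toNat_ofNat (n : ℕ) : (Formula.ofNat n).toNat = n := by
  induction n using Nat.strong_induction_on with
  | _ n ih =>
    match n, ih with
    | 0, _ => simp [Formula.toNat, Formula.ofNat]
    | 1, _ => simp [Formula.toNat, Formula.ofNat]
    | n + 2, ih =>
      have hm : n / 9 < n + 2 := by omega
      have ih1 := ih _ (lt_of_le_of_lt (n / 9).unpair_left_le hm)
      have ih2 := ih _ (lt_of_le_of_lt (n / 9).unpair_right_le hm)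
      have h9 : n % 9 < 9 := Nat.mod_lt _ (by norm_num)
      rw [Formula.ofNat]
      generalize hr : n % 9 = r at h9
      interval_cases r <;> simp [Formula.toNat, ih1, ih2] <;> omega

instance Formula.instDenumerable : Denumerable Formula :=
  Denumerable.mk' ⟨Formula.toNat, Formula.ofNat, Formula.ofNat_toNat, Formula.toNat_ofNat⟩

/-! ### Syntactic notions -/

/-- Data variables of a data expression. -/
def DExp.vars : DExp → Finset ℕ
  | DExp.star => ∅
  | DExp.var x => {x}

/-- Data variables of a constraint. -/
def BExp.vars : BExp → Finset ℕ
  | BExp.tru => ∅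
  | BExp.eq e f => e.vars ∪ f.vars
  | BExp.neg b => b.vars
  | BExp.and b c => b.vars ∪ c.vars

/-- Free data variables. -/
def Formula.freeData : Formula → Finset ℕ
  | Formula.tt => ∅
  | Formula.ff => ∅
  | Formula.pos b φ => b.vars ∪ φ.freeData
  | Formula.nec b φ => b.vars ∪ φ.freeData
  | Formula.ex x φ => φ.freeData.erase x
  | Formula.all x φ => φ.freeData.erase x
  | Formula.or φ ψ => φ.freeData ∪ ψ.freeData
  | Formula.and φ ψ => φ.freeData ∪ ψ.freeData
  | Formula.lfp _ φ => φ.freeData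
  | Formula.gfp _ φ => φ.freeData
  | Formula.var _ => ∅

/-- Free recursion variables. -/
def Formula.freeRec : Formula → Finset ℕ
  | Formula.tt => ∅
  | Formula.ff => ∅
  | Formula.pos _ φ => φ.freeRec
  | Formula.nec _ φ => φ.freeRec
  | Formula.ex _ φ => φ.freeRec
  | Formula.all _ φ => φ.freeRec
  | Formula.or φ ψ => φ.freeRec ∪ ψ.freeRec
  | Formula.and φ ψ => φ.freeRec ∪ ψ.freeRec
  | Formula.lfp X φ => φ.freeRec.erase X
  | Formula.gfp X φ => φ.freeRec.erase X
  | Formula.var X => {X}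

/-- The recursion variables with a free occurrence outside the scope of every modal operator. -/
def Formula.unguarded : Formula → Finset ℕ
  | Formula.tt => ∅
  | Formula.ff => ∅
  | Formula.pos _ _ => ∅
  | Formula.nec _ _ => ∅
  | Formula.ex _ φ => φ.unguarded
  | Formula.all _ φ => φ.unguarded
  | Formula.or φ ψ => φ.unguarded ∪ ψ.unguarded
  | Formula.and φ ψ => φ.unguarded ∪ ψ.unguarded
  | Formula.lfp X φ => φ.unguarded.erase X
  | Formula.gfp X φ => φ.unguarded.erase X
  | Formula.var X => {X}

/-- `ψ.IsSubformula φ`: `ψ` is a subformula of `φ`. -/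
def Formula.IsSubformula (χ : Formula) : Formula → Prop
  | Formula.tt => χ = Formula.tt
  | Formula.ff => χ = Formula.ff
  | Formula.pos b φ => χ = Formula.pos b φ ∨ χ.IsSubformula φ
  | Formula.nec b φ => χ = Formula.nec b φ ∨ χ.IsSubformula φ
  | Formula.ex x φ => χ = Formula.ex x φ ∨ χ.IsSubformula φ
  | Formula.all x φ => χ = Formula.all x φ ∨ χ.IsSubformula φ
  | Formula.or φ ψ => χ = Formula.or φ ψ ∨ χ.IsSubformula φ ∨ χ.IsSubformula ψ
  | Formula.and φ ψ => χ = Formula.and φ ψ ∨ χ.IsSubformula φ ∨ χ.IsSubformula ψ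
  | Formula.lfp X φ => χ = Formula.lfp X φ ∨ χ.IsSubformula φ
  | Formula.gfp X φ => χ = Formula.gfp X φ ∨ χ.IsSubformula φ
  | Formula.var X => χ = Formula.var X

/-- `χ` is a fixed-point formula `min X. ψ` or `max X. ψ`. -/
def Formula.Binds (χ : Formula) (X : ℕ) (ψ : Formula) : Prop :=
  χ = Formula.lfp X ψ ∨ χ = Formula.gfp X ψ

/-- Every occurrence of a fixed-point variable is within the scope of a modal operator in its
defining fixed-point formula. -/
def Formula.Guarded (φ : Formula) : Prop :=
  ∀ (χ : Formula) (X : ℕ) (ψ : Formula),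
    χ.IsSubformula φ → χ.Binds X ψ → X ∉ ψ.unguarded

/-- Each recursion variable is bound by a unique fixed-point formula. -/
def Formula.UniqueBinding (φ : Formula) : Prop :=
  ∀ (χ₁ χ₂ : Formula) (X : ℕ) (ψ₁ ψ₂ : Formula), χ₁.IsSubformula φ → χ₂.IsSubformula φ →
    χ₁.Binds X ψ₁ → χ₂.Binds X ψ₂ → χ₁ = χ₂

/-- The closed formulae of recHMLd: no free data or recursion variable, guarded recursion, and each
recursion variable bound by a unique fixed-point formula. -/
structure Formula.IsRecHML (φ : Formula) : Prop where
  freeData_eq : φ.freeData = ∅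
  freeRec_eq : φ.freeRec = ∅
  guarded : φ.Guarded
  uniqueBinding : φ.UniqueBinding

/-- The grammar of the fragment sHMLd. -/
def Formula.InSGrammar : Formula → Prop
  | Formula.ff => True
  | Formula.nec _ φ => φ.InSGrammar
  | Formula.all _ φ => φ.InSGrammar
  | Formula.or φ ψ => φ.InSGrammar ∧ ψ.InSGrammar
  | Formula.and φ ψ => φ.InSGrammar ∧ ψ.InSGrammar
  | Formula.gfp _ φ => φ.InSGrammar
  | Formula.var _ => True
  | _ => False

/-- The closed formulae of sHMLd. -/
def Formula.IsSHML (φ : Formula) : Prop := φ.IsRecHML ∧ φ.InSGrammar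

/-! ### Linear-time semantics over a data domain `D` -/

/-- Infinite traces. -/
abbrev Trace (D : Type*) := ℕ → D

/-- The trace after its first action. -/
def Trace.tail {D : Type*} (t : Trace D) : Trace D := fun n => t (n + 1)

/-- The prefix of length `n`. -/
def Trace.take {D : Type*} (t : Trace D) (n : ℕ) : List D := (List.range n).map t

/-- Data environments. They are total here; a formula only looks at its free data variables. -/
abbrev DEnv (D : Type*) := ℕ → D

/-- Data interpretations, ordered pointwise by inclusion. -/
abbrev DInt (D : Type*) := DEnv D → Set (Trace D)

/-- Trace environments. -/
abbrev TEnv (D : Type*) := ℕ → DInt D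

/-- Value of a data expression when the current action is `d`. -/
def DExp.eval {D : Type*} (δ : DEnv D) (d : D) : DExp → D
  | DExp.star => d
  | DExp.var x => δ x

/-- The constraint holds of the current action `d`. -/
def BExp.Holds {D : Type*} (δ : DEnv D) (d : D) : BExp → Prop
  | BExp.tru => True
  | BExp.eq e f => e.eval δ d = f.eval δ d
  | BExp.neg b => ¬ b.Holds δ d
  | BExp.and b c => b.Holds δ d ∧ c.Holds δ d

/-- The denotation of a formula in a trace environment and a data environment. -/
def Formula.sem {D : Type*} : Formula → TEnv D → DEnv D → Set (Trace D)
  | Formula.tt => fun _ _ => Set.univ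
  | Formula.ff => fun _ _ => ∅
  | Formula.pos b φ => fun ρ δ => {t | b.Holds δ (t 0) ∧ t.tail ∈ φ.sem ρ δ}
  | Formula.nec b φ => fun ρ δ => {t | b.Holds δ (t 0) → t.tail ∈ φ.sem ρ δ}
  | Formula.ex x φ => fun ρ δ => ⋃ d : D, φ.sem ρ (Function.update δ x d)
  | Formula.all x φ => fun ρ δ => ⋂ d : D, φ.sem ρ (Function.update δ x d)
  | Formula.or φ ψ => fun ρ δ => φ.sem ρ δ ∪ ψ.sem ρ δ
  | Formula.and φ ψ => fun ρ δ => φ.sem ρ δ ∩ ψ.sem ρ δ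
  | Formula.lfp X φ => fun ρ δ =>
      (sInf {F : DInt D | (fun δ' => φ.sem (Function.update ρ X F) δ') ≤ F}) δ
  | Formula.gfp X φ => fun ρ δ =>
      (sSup {F : DInt D | F ≤ fun δ' => φ.sem (Function.update ρ X F) δ'}) δ
  | Formula.var X => fun ρ δ => ρ X δ

/-- The set of traces that satisfy a closed formula (whose denotation is the same in all
environments). -/
def Formula.lang (D : Type*) (φ : Formula) : Set (Trace D) :=
  {t | ∀ (ρ : TEnv D) (δ : DEnv D), t ∈ φ.sem ρ δ}

/-! ### Monitors -/

/-- A monitor, through its acceptance and rejection predicates on finite traces. -/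
structure Monitor (D : Type*) where
  acc : List D → Prop
  rej : List D → Prop
  consistent : ∀ w, ¬ (acc w ∧ rej w)
  acc_irrevocable : ∀ w y, w <+: y → acc w → acc y
  rej_irrevocable : ∀ w y, w <+: y → rej w → rej y

/-- Acceptance of an infinite trace. -/
def Monitor.Accepts {D : Type*} (m : Monitor D) (t : Trace D) : Prop := ∃ n, m.acc (t.take n)

/-- Soundness for satisfactions. -/
def Monitor.SoundSat {D : Type*} (m : Monitor D) (T : Set (Trace D)) : Prop :=
  ∀ t, m.Accepts t → t ∈ T

/-- Completeness for satisfactions. -/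
def Monitor.CompleteSat {D : Type*} (m : Monitor D) (T : Set (Trace D)) : Prop :=
  ∀ t, t ∈ T → m.Accepts t

/-- A property is monitorable for satisfactions. -/
def MonitorableSat {D : Type*} (T : Set (Trace D)) : Prop :=
  ∃ m : Monitor D, m.SoundSat T ∧ m.CompleteSat T

/-- A property is effectively monitorable for satisfactions: some machine (a recursively enumerable
acceptance predicate on finite traces) accepts a prefix of exactly those traces that belong to the
property. -/
def EffMonitorableSat {D : Type*} [Primcodable D] (T : Set (Trace D)) : Prop :=
  ∃ A : List D → Prop, REPred A ∧ ∀ t : Trace D, t ∈ T ↔ ∃ n, A (t.take n)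

/-- The problem "given `a` with `S a`, does `P a` hold?" is decidable. -/
def DecidableProblem {α : Type*} [Primcodable α] (S P : α → Prop) : Prop :=
  ∃ f : α → Bool, Computable f ∧ ∀ a, S a → (f a = true ↔ P a)

/-! ### Deterministic Turing machines -/

/-- A deterministic Turing machine over the tape alphabet `{0, 1}` (`false` is `0`, `true` is `1`).
The states are `0, …, table.length - 1`, and `0` is initial. Entry `p` of the table is the pair of
the values of the transition function at `(p, 0)` and at `(p, 1)`; such a value is a triple of the
bit that is written, the move (`true` is right, `false` is left) and the new state. The machine
halts when it enters the state `final`. -/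
structure DTM where
  final : ℕ
  table : List ((Bool × Bool × ℕ) × (Bool × Bool × ℕ))

/-- A machine is a pair of finite data. -/
def DTM.equivProd : DTM ≃ ℕ × List ((Bool × Bool × ℕ) × (Bool × Bool × ℕ)) where
  toFun M := (M.final, M.table)
  invFun x := ⟨x.1, x.2⟩
  left_inv _ := rfl
  right_inv _ := rfl

instance DTM.instPrimcodable : Primcodable DTM := Primcodable.ofEquiv _ DTM.equivProd

/-- The final state and all target states are states of the machine. -/
def DTM.Valid (M : DTM) : Prop :=
  M.final < M.table.length ∧
    ∀ e ∈ M.table, e.1.2.2 < M.table.length ∧ e.2.2.2 < M.table.length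

/-- The transition function. -/
def DTM.trans (M : DTM) (p : ℕ) (c : Bool) : Bool × Bool × ℕ :=
  let e := M.table.getD p default
  if c then e.2 else e.1

/-- Configurations: current state, content of the tape, position of the head. -/
structure Cfg where
  state : ℕ
  tape : List Bool
  head : ℕ

/-- One step. The tape is infinite to the right: a cell holding `0` is added when the head leaves the
used part. A move to the left from the leftmost cell leaves the head there. -/
def DTM.step (M : DTM) (c : Cfg) : Cfg :=
  let a := M.trans c.state (c.tape.getD c.head false)
  let tape' := c.tape.set c.head a.1
  let head' := if a.2.1 then c.head + 1 else c.head - 1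
  ⟨a.2.2, if head' < tape'.length then tape' else tape' ++ [false], head'⟩

/-- The `n`-th configuration of the run on input `w`. -/
def DTM.cfg (M : DTM) (w : List Bool) (n : ℕ) : Cfg := M.step^[n] ⟨0, w, 0⟩

/-- The run on input `w` has not halted strictly before its `n`-th configuration. -/
def DTM.Alive (M : DTM) (w : List Bool) (n : ℕ) : Prop := ∀ i < n, (M.cfg w i).state ≠ M.final

/-- The run on input `w` halts with its `n`-th configuration. -/
def DTM.HaltsAt (M : DTM) (w : List Bool) (n : ℕ) : Prop :=
  M.Alive w n ∧ (M.cfg w n).state = M.final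

/-! ### Runs as data words -/

/-- The symbols used in encodings: the separator `#`, the states, the bits, the bits marked by the
head, and the identifiers of the cells of the tape. -/
inductive Symb : Type
  | hash : Symb
  | state : ℕ → Symb
  | bit : Bool → Symb
  | head : Bool → Symb
  | cell : ℕ → Symb

/-- The encoding of a configuration: the state, then for each cell its identifier and its content. -/
def Cfg.enc (c : Cfg) : List Symb :=
  Symb.state c.state :: (List.range c.tape.length).flatMap fun j =>
    [Symb.cell j,
      if j = c.head then Symb.head (c.tape.getD j false) else Symb.bit (c.tape.getD j false)]

/-- The initial block, which lists the separator, the states, and the bits without and with head. -/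
def DTM.prelude (M : DTM) : List Symb :=
  Symb.hash :: (List.range M.table.length).map Symb.state ++
    [Symb.bit false, Symb.bit true, Symb.head false, Symb.head true]

/-- The word `prelude # enc c₀ # enc c₁ # ⋯ # enc cₙ #`, where `c₀, c₁, …` is the run on `w`. -/
def DTM.runWord (M : DTM) (w : List Bool) (n : ℕ) : List Symb :=
  M.prelude ++ (List.range (n + 1)).flatMap (fun i => Symb.hash :: (M.cfg w i).enc) ++ [Symb.hash]

/-- The symbols that are relevant to a machine: all but those for states it does not have. -/
def DTM.symbols (M : DTM) : Set Symb := {s | ∀ p, s = Symb.state p → p < M.table.length}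

/-- The trace starts with the encoding, under the valuation `v` of symbols by data values, of the
run on `w` up to its `n`-th configuration. -/
def DTM.EncodesUpTo {D : Type*} (M : DTM) (v : Symb → D) (w : List Bool) (n : ℕ) (t : Trace D) :
    Prop :=
  t.take (M.runWord w n).length = (M.runWord w n).map v

/-- The trace encodes the run on input `w`, for some choice of pairwise distinct data values for the
symbols. If the run does not halt, then the trace is the encoding of the whole infinite run. If it
halts, then the trace starts with the encoding of the run up to and including the halting
configuration, and what comes after that is arbitrary. -/
def DTM.EncodesRunOn {D : Type*} (M : DTM) (w : List Bool) (t : Trace D) : Prop :=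
  ∃ v : Symb → D, Set.InjOn v M.symbols ∧ ∀ n, M.Alive w n → M.EncodesUpTo v w n t

/-- The trace encodes (that is, starts with the encoding of) a non-empty prefix of the run on some
non-empty input. -/
def DTM.EncodesRunPrefix {D : Type*} (M : DTM) (t : Trace D) : Prop :=
  ∃ (w : List Bool) (n : ℕ) (v : Symb → D), w ≠ [] ∧ Set.InjOn v M.symbols ∧ M.Alive w n ∧
    M.EncodesUpTo v w n t

/-- The trace encodes (that is, starts with the encoding of) a terminating run on some non-empty
input. -/
def DTM.EncodesTerminatingRun {D : Type*} (M : DTM) (t : Trace D) : Prop :=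
  ∃ (w : List Bool) (n : ℕ) (v : Symb → D), w ≠ [] ∧ Set.InjOn v M.symbols ∧ M.HaltsAt w n ∧
    M.EncodesUpTo v w n t

end RecHML

namespace RecHML

/-! ### Semantics of fixed points and duality -/

/-! Encodings of runs are recognised by a universal register automaton written as a formula. A
universal quantifier followed by `[b]` ranges over the values that the guard `b` admits, so a block
of quantifiers with a guard either computes registers or guesses them, and `[E] ff` rejects when the
error constraint `E` holds. After the prelude an encoding is a sequence of pairs (separator and
state, or cell identifier and content), and `loopBody` reads one pair per round. The greatest fixed
point of the loop says that no path meets an error (`mem_gfp_loop`); the least one also excludes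
infinite paths (`noError_of_mem_lfp_loop`).

Finitely many registers suffice to compare configurations of unbounded length because each block
repeats the identifiers of the previous one in the same order. A path may lock one cell: it
remembers the preceding identifier, the identifier and the content. The locked identifier must not
recur in its block, and in the next block it must again follow the same predecessor, with the
content updated by the step. All paths are checked, hence all cells. The head, its neighbours, the
transition and the last cell are tracked along every path. On an encoding, every path satisfies
`Inv` and meets no error (`not_err_of_encodes`). Conversely, `exists_rpath` supplies a path for each
possible lock, and from the absence of errors a valuation is built pair by pair
(`exists_val_of_not_err`).

For a given input a finite check fixes the first block, and the conjunction with the greatest fixed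
point lies in sHMLd (`mem_runForm`). For an arbitrary input the first block must be forced to end,
which takes a least fixed point. It stops either after the first block, which defines prefixes of
runs, or at the final state, which defines terminating runs; the dual of the second formula
completes `nonTermForm` (`mem_nonTermForm`).

If a run halts, its encodings are determined by a prefix, which can be recognised up to injective
renaming (`effMonitorableSat_of_haltsAt`); if it does not, no prefix is conclusive
(`not_monitorableSat_of_not_halts`). Both notions of monitorability of `runForm` thus amount to
termination, and all four problems inherit the undecidability of halting for one fixed machine on
the inputs `u ++ v ++ ⋯ ++ v` (`exists_undecidable_halting`). That follows from the halting problem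
for partial recursive codes, through a chain of machine models down to two symbols and a one-way
tape. -/

theorem mem_lfp_iff {D : Type*} {X : ℕ} {φ : Formula} {ρ : TEnv D} {δ : DEnv D} {t : Trace D} :
    t ∈ (Formula.lfp X φ).sem ρ δ ↔
      ∀ F : DInt D, (∀ δ', φ.sem (Function.update ρ X F) δ' ⊆ F δ') → t ∈ F δ := by
  simp only [Formula.sem, sInf_apply, Set.iInf_eq_iInter, Set.mem_iInter, Subtype.forall,
    Set.mem_ofPred_eq]
  rfl

theorem mem_gfp_iff {D : Type*} {X : ℕ} {φ : Formula} {ρ : TEnv D} {δ : DEnv D} {t : Trace D} :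
    t ∈ (Formula.gfp X φ).sem ρ δ ↔
      ∃ F : DInt D, (∀ δ', F δ' ⊆ φ.sem (Function.update ρ X F) δ') ∧ t ∈ F δ := by
  simp only [Formula.sem, sSup_apply, Set.iSup_eq_iUnion, Set.mem_iUnion, Subtype.exists,
    Set.mem_ofPred_eq, exists_prop]
  rfl

/-- The dual formula. -/
def Formula.dual : Formula → Formula
  | Formula.tt => Formula.ff
  | Formula.ff => Formula.tt
  | Formula.pos b φ => Formula.nec b φ.dual
  | Formula.nec b φ => Formula.pos b φ.dual
  | Formula.ex x φ => Formula.all x φ.dual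
  | Formula.all x φ => Formula.ex x φ.dual
  | Formula.or φ ψ => Formula.and φ.dual ψ.dual
  | Formula.and φ ψ => Formula.or φ.dual ψ.dual
  | Formula.lfp X φ => Formula.gfp X φ.dual
  | Formula.gfp X φ => Formula.lfp X φ.dual
  | Formula.var X => Formula.var X

/-- Pointwise complement of a trace environment. -/
def TEnv.compl {D : Type*} (ρ : TEnv D) : TEnv D := fun X δ => (ρ X δ)ᶜ

theorem TEnv.compl_update {D : Type*} (ρ : TEnv D) (X : ℕ) (F : DInt D) :
    TEnv.compl (Function.update ρ X F) = Function.update ρ.compl X (fun δ => (F δ)ᶜ) := by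
  funext Y δ
  by_cases h : Y = X
  · subst h; simp [TEnv.compl]
  · simp [TEnv.compl, h]

/-- The trace environment is complemented along with the formula, so recursion variables are their
own duals. The fixed-point cases hold because complement turns pre-fixed points of an operator into
post-fixed points of the dual operator. -/
theorem Formula.mem_dual_sem {D : Type*} (φ : Formula) (ρ : TEnv D) (δ : DEnv D) (t : Trace D) :
    t ∈ φ.dual.sem ρ.compl δ ↔ t ∉ φ.sem ρ δ := by
  induction φ generalizing ρ δ t with
  | tt => simp [Formula.dual, Formula.sem]
  | ff => simp [Formula.dual, Formula.sem]
  | pos b φ ih => simp [Formula.dual, Formula.sem, ih]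
  | nec b φ ih => simp [Formula.dual, Formula.sem, ih]
  | ex x φ ih => simp [Formula.dual, Formula.sem, ih]
  | all x φ ih => simp [Formula.dual, Formula.sem, ih]
  | or φ ψ ih1 ih2 => simp [Formula.dual, Formula.sem, ih1, ih2]
  | and φ ψ ih1 ih2 => simp [Formula.dual, Formula.sem, ih1, ih2]; tauto
  | lfp X φ ih =>
    rw [Formula.dual, mem_gfp_iff, mem_lfp_iff]
    push Not
    constructor
    · rintro ⟨F, hF, ht⟩
      refine ⟨fun δ => (F δ)ᶜ, fun δ' s hs hs' => ?_, fun h => h ht⟩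
      have := hF δ' hs'
      have e : F = fun δ => ((fun δ => (F δ)ᶜ) δ)ᶜ := by simp
      rw [e, ← TEnv.compl_update, ih] at this
      exact this hs
    · rintro ⟨F, hF, ht⟩
      refine ⟨fun δ => (F δ)ᶜ, fun δ' s hs => ?_, ht⟩
      rw [← TEnv.compl_update, ih]
      exact fun h => hs (hF δ' h)
  | gfp X φ ih =>
    rw [Formula.dual, mem_gfp_iff, mem_lfp_iff]
    push Not
    constructor
    · intro h F hF ht
      refine h (fun δ => (F δ)ᶜ) (fun δ' s hs hs' => ?_) ht
      rw [← TEnv.compl_update, ih] at hs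
      exact hs (hF δ' hs')
    · intro h F hF
      by_contra ht
      refine h (fun δ => (F δ)ᶜ) (fun δ' s hs => ?_) ht
      by_contra hs'
      refine hs (hF δ' ?_)
      have e : F = fun δ => ((fun δ => (F δ)ᶜ) δ)ᶜ := by simp
      rw [e, ← TEnv.compl_update, ih]
      exact hs'
  | var X => simp [Formula.dual, Formula.sem, TEnv.compl]

/-! ### Formulae with a polarity

With `d = false` the following builders use the universal connectives, with `d = true` their
duals. -/

/-- A quantifier. -/
def quant (d : Bool) (x : ℕ) (φ : Formula) : Formula :=
  bif d then Formula.ex x φ else Formula.all x φ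

/-- A block of quantifiers. -/
def quants (d : Bool) (vs : List ℕ) (φ : Formula) : Formula := vs.foldr (quant d) φ

/-- A modality. -/
def modal (d : Bool) (b : BExp) (φ : Formula) : Formula :=
  bif d then Formula.pos b φ else Formula.nec b φ

/-- A conjunction or disjunction. -/
def junct (d : Bool) (φ ψ : Formula) : Formula :=
  bif d then Formula.or φ ψ else Formula.and φ ψ

/-- A truth constant. -/
def falsum (d : Bool) : Formula := bif d then Formula.tt else Formula.ff

/-- A greatest fixed point if `g` is true, and a least one otherwise. -/
def fixp (g : Bool) (X : ℕ) (φ : Formula) : Formula :=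
  bif g then Formula.gfp X φ else Formula.lfp X φ

/-- Store the current action in a variable. -/
def reads (d : Bool) (vs : List ℕ) (φ : Formula) : Formula :=
  vs.foldr (fun x φ => quant d x (modal d (BExp.eq DExp.star (DExp.var x)) φ)) φ

/-- The trace after its first `n` actions. -/
def Trace.drop {D : Type*} (t : Trace D) (n : ℕ) : Trace D := fun k => t (n + k)

theorem Trace.tail_drop {D : Type*} (t : Trace D) (n : ℕ) :
    Trace.drop (Trace.tail t) n = Trace.drop t (n + 1) := by
  funext k; simp only [Trace.drop, Trace.tail]; congr 1; omega

theorem mem_quants {D : Type*} {vs : List ℕ} {φ : Formula} {ρ : TEnv D} {δ : DEnv D}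
    {t : Trace D} : t ∈ (quants false vs φ).sem ρ δ ↔
      ∀ δ' : DEnv D, (∀ y, y ∉ vs → δ' y = δ y) → t ∈ φ.sem ρ δ' := by
  induction vs generalizing δ with
  | nil =>
    simp only [quants, List.foldr_nil, List.not_mem_nil, not_false_eq_true, true_imp_iff]
    exact ⟨fun h δ' e => by rwa [show δ' = δ from funext e], fun h => h δ fun _ => rfl⟩
  | cons x vs ih =>
    change t ∈ (Formula.all x (quants false vs φ)).sem ρ δ ↔ _
    simp only [Formula.sem, Set.mem_iInter, ih, List.mem_cons, not_or]
    constructor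
    · intro h δ' e
      refine h (δ' x) δ' fun y hy => ?_
      by_cases hx : y = x
      · subst hx; simp
      · simp [hx, e y ⟨hx, hy⟩]
    · intro h c δ' e
      refine h δ' fun y hy => ?_
      rw [e y hy.2, Function.update_of_ne hy.1]

/-- Distinctness of the variables ensures that no stored value is overwritten by a later one. -/
theorem mem_reads {D : Type*} {vs : List ℕ} {φ : Formula} {ρ : TEnv D} {δ : DEnv D}
    {t : Trace D} (hvs : vs.Nodup) : t ∈ (reads false vs φ).sem ρ δ ↔
      ∀ δ' : DEnv D, (∀ y, y ∉ vs → δ' y = δ y) → (∀ i (h : i < vs.length), δ' vs[i] = t i) →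
        t.drop vs.length ∈ φ.sem ρ δ' := by
  induction vs generalizing δ t with
  | nil =>
    simp only [reads, List.foldr_nil, List.not_mem_nil, not_false_eq_true, true_imp_iff,
      List.length_nil, Nat.not_lt_zero, IsEmpty.forall_iff, implies_true]
    have e : t.drop 0 = t := by funext k; simp [Trace.drop]
    rw [e]
    exact ⟨fun h δ' e => by rwa [show δ' = δ from funext e], fun h => h δ fun _ => rfl⟩
  | cons x vs ih =>
    change t ∈ (Formula.all x (Formula.nec _ (reads false vs φ))).sem ρ δ ↔ _
    obtain ⟨hx, hvs⟩ := List.nodup_cons.1 hvs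
    simp only [Formula.sem, Set.mem_iInter, ih hvs, List.mem_cons, not_or, Set.mem_ofPred_eq,
      BExp.Holds, DExp.eval, Function.update_self, Trace.tail_drop]
    constructor
    · intro h δ' e e'
      refine h (t 0) rfl δ' (fun y hy => ?_) fun i hi => ?_
      · by_cases hyx : y = x
        · subst hyx; rw [Function.update_self]; exact e' 0 (by simp)
        · rw [Function.update_of_ne hyx, e y ⟨hyx, hy⟩]
      · exact e' (i + 1) (by simpa using hi)
    · rintro h c hc δ' e e'
      refine h δ' (fun y hy => ?_) fun i hi => ?_
      · rw [e y hy.2, Function.update_of_ne hy.1]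
      · cases i with
        | zero => simpa [e x hx] using hc.symm
        | succ i => exact e' i (by simpa using hi)

/-! ### Universal register automata -/

/-- The guard that copies the registers `17, …, 32` to `0, …, 15`, and stores the action in
`16`. -/
def loadGuard : BExp :=
  (List.range 16).foldr (fun i b => BExp.and (BExp.eq (DExp.var i) (DExp.var (17 + i))) b)
    (BExp.eq DExp.star (DExp.var 16))

/-- The environment described by `loadGuard`. -/
def load {D : Type*} (δ : DEnv D) (c : D) : DEnv D :=
  fun y => if y < 16 then δ (17 + y) else if y = 16 then c else δ y

/-- The body of the loop of a register automaton that reads two actions at a time, with error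
condition `E` and transition relation `T`. -/
def loopBody (d : Bool) (X : ℕ) (E T : BExp) : Formula :=
  quants d (List.range 17) (modal d loadGuard (junct d (modal d E (falsum d))
    (quants d (List.range' 17 16) (modal d T (Formula.var X)))))

/-- `δ'` is a successor of `δ` on the actions `c`, `d`. -/
def Succ {D : Type*} (T : BExp) (δ : DEnv D) (c d : D) (δ' : DEnv D) : Prop :=
  (∀ y, y < 17 ∨ 33 ≤ y → δ' y = load δ c y) ∧ T.Holds δ' d

theorem loadGuard_holds {D : Type*} {δ : DEnv D} {c : D} :
    loadGuard.Holds δ c ↔ c = δ 16 ∧ ∀ i < 16, δ i = δ (17 + i) := by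
  have key : ∀ (l : List ℕ) (b : BExp), (l.foldr (fun i b => BExp.and (BExp.eq (DExp.var i)
      (DExp.var (17 + i))) b) b).Holds δ c ↔ b.Holds δ c ∧ ∀ i ∈ l, δ i = δ (17 + i) := by
    intro l b
    induction l with
    | nil => simp
    | cons i l ih => simp [BExp.Holds, DExp.eval, ih]; tauto
  rw [loadGuard, key]
  simp [BExp.Holds, DExp.eval]

/-- Between rounds the registers live in the variables `17, …, 32`. `loadGuard` leaves exactly one
choice for `0, …, 16`, so the outer block is an assignment; the inner block then frees `17, …, 32`,
with `T` as the only restriction, so it is a nondeterministic move. Both `E` and `T` are evaluated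
at the second action of the pair, which is why the first one is stored in `16`. -/
theorem mem_loopBody {D : Type*} {X : ℕ} {E T : BExp} {ρ : TEnv D} {δ : DEnv D} {t : Trace D} :
    t ∈ (loopBody false X E T).sem ρ δ ↔ ¬ E.Holds (load δ (t 0)) (t 1) ∧
      ∀ δ', Succ T δ (t 0) (t 1) δ' → t.drop 2 ∈ ρ X δ' := by
  have e2 : t.tail.tail = t.drop 2 := by
    funext k; simp only [Trace.drop, Trace.tail]; congr 1; omega
  have hu : ∀ δ' : DEnv D, ((∀ y, y ∉ List.range 17 → δ' y = δ y) ∧ loadGuard.Holds δ' (t 0)) ↔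
      δ' = load δ (t 0) := by
    intro δ'
    rw [loadGuard_holds]
    simp only [List.mem_range, not_lt]
    constructor
    · rintro ⟨h1, h2, h3⟩
      funext y
      simp only [load]
      split_ifs with h4 h5
      · rw [h3 y h4, h1 _ (by omega)]
      · rw [h5, h2]
      · exact h1 y (by omega)
    · rintro rfl
      refine ⟨fun y hy => ?_, ?_, fun i hi => ?_⟩
      · simp [load, show ¬ y < 16 by omega, show ¬ y = 16 by omega]
      · simp [load]
      · simp [load, hi, show ¬ 17 + i < 16 by omega, show ¬ 17 + i = 16 by omega]
  rw [loopBody, mem_quants]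
  change (∀ δ', _ → (loadGuard.Holds δ' (t 0) → t.tail ∈ (Formula.sem (Formula.nec E Formula.ff) ρ δ'
    ∩ (quants false (List.range' 17 16) (Formula.nec T (Formula.var X))).sem ρ δ'))) ↔ _
  simp only [Set.mem_inter_iff, mem_quants]
  constructor
  · intro h
    have := (hu _).2 rfl
    obtain ⟨h1, h2⟩ := h _ this.1 this.2
    refine ⟨fun hE => h1 hE, fun δ' hs => ?_⟩
    rw [← e2]
    refine h2 δ' (fun y hy => hs.1 y ?_) hs.2
    simp only [List.mem_range'_1] at hy
    omega
  · rintro ⟨h1, h2⟩ δ' h3 h4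
    obtain rfl := (hu _).1 ⟨h3, h4⟩
    refine ⟨fun hE => (h1 hE).elim, fun δ' hs hT => ?_⟩
    change t.tail.tail ∈ ρ X δ'
    rw [e2]
    refine h2 δ' ⟨fun y hy => hs y ?_, hT⟩
    simp only [List.mem_range'_1]
    omega

/-- `δ` is reached from `δ₀` after `m` pairs of actions of `t`. -/
inductive Path {D : Type*} (T : BExp) (t : Trace D) (δ₀ : DEnv D) : ℕ → DEnv D → Prop
  | zero : Path T t δ₀ 0 δ₀
  | succ {m δ δ'} : Path T t δ₀ m δ → Succ T δ (t (2 * m)) (t (2 * m + 1)) δ' →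
      Path T t δ₀ (m + 1) δ'

theorem Path.cons {D : Type*} {T : BExp} {t : Trace D} {δ₀ δ₁ δ : DEnv D} {m : ℕ}
    (h : Succ T δ₀ (t 0) (t 1) δ₁) (hp : Path T (t.drop 2) δ₁ m δ) : Path T t δ₀ (m + 1) δ := by
  induction hp with
  | zero => exact Path.succ Path.zero (by simpa using h)
  | @succ m δ δ' _ hs ih =>
    refine Path.succ ih ?_
    simp only [Trace.drop] at hs
    rw [show 2 * (m + 1) = 2 + 2 * m by ring]
    exact hs

theorem Path.uncons {D : Type*} {T : BExp} {t : Trace D} {δ₀ δ : DEnv D} {m : ℕ}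
    (h : Path T t δ₀ (m + 1) δ) :
    ∃ δ₁, Succ T δ₀ (t 0) (t 1) δ₁ ∧ Path T (t.drop 2) δ₁ m δ := by
  induction m generalizing δ with
  | zero =>
    cases h with
    | succ h hs => cases h; exact ⟨_, by simpa using hs, Path.zero⟩
  | succ m ih =>
    cases h with
    | succ h hs =>
      obtain ⟨δ₁, h1, h2⟩ := ih h
      refine ⟨δ₁, h1, Path.succ h2 ?_⟩
      simp only [Trace.drop]
      rw [show 2 * (m + 1) = 2 + 2 * m by ring] at hs
      exact hs

/-- No path meets an error. -/
def NoError {D : Type*} (E T : BExp) (t : Trace D) (δ₀ : DEnv D) : Prop :=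
  ∀ m δ, Path T t δ₀ m δ → ¬ E.Holds (load δ (t (2 * m))) (t (2 * m + 1))

/-- This is the fixed-point equation of the loop operator. -/
theorem noError_iff {D : Type*} {E T : BExp} {t : Trace D} {δ₀ : DEnv D} :
    NoError E T t δ₀ ↔ ¬ E.Holds (load δ₀ (t 0)) (t 1) ∧
      ∀ δ', Succ T δ₀ (t 0) (t 1) δ' → NoError E T (t.drop 2) δ' := by
  constructor
  · intro h
    refine ⟨by simpa using h 0 δ₀ Path.zero, fun δ' hs m δ hp => ?_⟩
    have := h (m + 1) δ (Path.cons hs hp)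
    simp only [Trace.drop]
    rwa [show 2 * (m + 1) = 2 + 2 * m by ring] at this
  · rintro ⟨h1, h2⟩ m δ hp
    cases m with
    | zero => cases hp; simpa using h1
    | succ m =>
      obtain ⟨δ₁, hs, hp'⟩ := hp.uncons
      have := h2 δ₁ hs m δ hp'
      simp only [Trace.drop] at this
      rwa [show 2 * (m + 1) = 2 + 2 * m by ring]

/-- `NoError` is a post-fixed point, and any other post-fixed point can be followed along a path. -/
theorem mem_gfp_loop {D : Type*} {X : ℕ} {E T : BExp} {ρ : TEnv D} {δ : DEnv D} {t : Trace D} :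
    t ∈ (Formula.gfp X (loopBody false X E T)).sem ρ δ ↔ NoError E T t δ := by
  rw [mem_gfp_iff]
  simp only [Set.subset_def, mem_loopBody, Function.update_self]
  constructor
  · rintro ⟨F, hF, ht⟩ m
    induction m generalizing δ t with
    | zero =>
      intro δ' hp
      cases hp
      simpa using (hF _ _ ht).1
    | succ m ih =>
      intro δ' hp
      obtain ⟨δ₁, hs, hp'⟩ := hp.uncons
      have := ih ((hF _ _ ht).2 δ₁ hs) δ' hp'
      simp only [Trace.drop] at this
      rwa [show 2 * (m + 1) = 2 + 2 * m by ring]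
  · intro h
    exact ⟨fun δ => {t | NoError E T t δ}, fun δ' s hs => noError_iff.1 hs, h⟩

/-- A bound on the length of paths reduces membership in the least fixed point to a finite
induction. On encodings, the bound comes from the separator at which the checks stop. -/
theorem mem_lfp_loop_of_bound {D : Type*} {X : ℕ} {E T : BExp} {ρ : TEnv D} {δ : DEnv D}
    {t : Trace D} (N : ℕ) (hN : ∀ δ', ¬ Path T t δ N δ') (h : NoError E T t δ) :
    t ∈ (Formula.lfp X (loopBody false X E T)).sem ρ δ := by
  rw [mem_lfp_iff]
  simp only [Set.subset_def, mem_loopBody, Function.update_self]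
  intro F hF
  induction N generalizing δ t with
  | zero => exact absurd Path.zero (hN δ)
  | succ N ih =>
    have h' := noError_iff.1 h
    exact hF _ _ ⟨h'.1, fun δ' hs => ih (fun δ'' hp => hN δ'' (Path.cons hs hp)) (h'.2 δ' hs)⟩

/-- The conclusion defines a pre-fixed point: removing the first environment of an infinite path
leaves an infinite path of a successor. -/
theorem noError_of_mem_lfp_loop {D : Type*} {X : ℕ} {E T : BExp} {ρ : TEnv D} {δ : DEnv D}
    {t : Trace D} (h : t ∈ (Formula.lfp X (loopBody false X E T)).sem ρ δ) :
    NoError E T t δ ∧ ¬ ∃ f : ℕ → DEnv D, f 0 = δ ∧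
      ∀ m, Succ T (f m) (t (2 * m)) (t (2 * m + 1)) (f (m + 1)) := by
  rw [mem_lfp_iff] at h
  refine h (fun δ => {t | NoError E T t δ ∧ ¬ ∃ f : ℕ → DEnv D, f 0 = δ ∧
      ∀ m, Succ T (f m) (t (2 * m)) (t (2 * m + 1)) (f (m + 1))}) fun δ' s hs => ?_
  rw [mem_loopBody] at hs
  simp only [Function.update_self, Set.mem_ofPred_eq] at hs
  refine ⟨noError_iff.2 ⟨hs.1, fun δ'' h => (hs.2 δ'' h).1⟩, ?_⟩
  rintro ⟨f, rfl, hf⟩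
  refine (hs.2 (f 1) (by simpa using hf 0)).2 ⟨fun m => f (m + 1), rfl, fun m => ?_⟩
  have := hf (m + 1)
  simp only [Trace.drop]
  rwa [show 2 * (m + 1) = 2 + 2 * m by ring] at this


/-! ### The automaton that checks encodings of runs -/

/-- The variable that holds the value of a symbol. -/
def Symb.toVar : Symb → ℕ
  | Symb.hash => 33
  | Symb.bit b => if b then 35 else 34
  | Symb.head b => if b then 37 else 36
  | Symb.state p => 38 + p
  | Symb.cell _ => 33

/-- The symbols that are listed in the initial block. -/
def DTM.IsConst (M : DTM) : Symb → Prop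
  | Symb.state p => p < M.table.length
  | Symb.cell _ => False
  | _ => True

/-- The registers. `ph` is the phase (before, in, or after the first block), `pid` the previous
identifier, `st` the state, `hid`, `hpred` and `hsucc` the head cell and its neighbours in the
current block, `nst`, `nbit` and `ndir` the value of the transition function in the current block,
`lst` the last cell of the previous block, `wr` the bit written in the last step, `nh` the new head
cell. The lock `lk`, `lx`, `la`, `lb` remembers that the pair `la`, `lb` comes after the identifier
`lx`. -/
structure Reg (D : Type*) where
  ph : D
  pid : D
  st : D
  hid : D
  hpred : D
  hsucc : D
  nst : D
  nbit : D
  ndir : D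
  lst : D
  wr : D
  nh : D
  lk : D
  lx : D
  la : D
  lb : D

/-- The registers held by an environment from a given variable on. -/
def regAt {D : Type*} (δ : DEnv D) (o : ℕ) : Reg D :=
  ⟨δ o, δ (o + 1), δ (o + 2), δ (o + 3), δ (o + 4), δ (o + 5), δ (o + 6), δ (o + 7), δ (o + 8),
    δ (o + 9), δ (o + 10), δ (o + 11), δ (o + 12), δ (o + 13), δ (o + 14), δ (o + 15)⟩

/-- The checks stop with the separator that comes now, if no block or the final state precedes
it. -/
def StopP {D : Type*} (M : DTM) (anySt : Bool) (K : Symb → D) (R : Reg D) (a : D) : Prop :=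
  a = K Symb.hash ∧ R.ph ≠ K Symb.hash ∧ (anySt = true ∨ R.st = K (Symb.state M.final))

/-- The value is one of those listed in the initial block. -/
def ConstP {D : Type*} (M : DTM) (K : Symb → D) (a : D) : Prop := ∃ s, M.IsConst s ∧ a = K s

/-- The content of a cell with head. -/
def HeadP {D : Type*} (K : Symb → D) (b : D) : Prop :=
  b = K (Symb.head false) ∨ b = K (Symb.head true)

/-- The new bit in a cell with old content `R.lb` is `1`. -/
def OneP {D : Type*} (K : Symb → D) (R : Reg D) : Prop :=
  (HeadP K R.lb ∧ R.wr = K (Symb.bit true)) ∨ R.lb = K (Symb.bit true)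

/-- The error condition. -/
def ErrP {D : Type*} (M : DTM) (anySt : Bool) (K : Symb → D) (R : Reg D) (a b : D) : Prop :=
  (R.ph = K Symb.hash ∧ ¬ (a = K Symb.hash ∧ b = K (Symb.state 0))) ∨
  (R.ph ≠ K Symb.hash ∧ a = K Symb.hash ∧ ¬ StopP M anySt K R a ∧ b ≠ R.nst) ∨
  -- The locked identifier recurs in its own block.
  (R.lk = K (Symb.bit false) ∧ a = R.la) ∨
  (R.ph = K (Symb.bit false) ∧ a = K Symb.hash ∧ R.pid = K Symb.hash) ∨
  (R.ph = K (Symb.bit false) ∧ a ≠ K Symb.hash ∧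
    (ConstP M K a ∨ (R.pid = K Symb.hash ∧ ¬ HeadP K b) ∨
      (R.pid ≠ K Symb.hash ∧ ¬ (b = K (Symb.bit false) ∨ b = K (Symb.bit true))))) ∨
  -- All cells of the previous block are repeated and the head has its place, so the block must end
  -- here.
  (R.ph = K (Symb.bit true) ∧ R.pid = R.lst ∧ R.nh ≠ K Symb.hash ∧ a ≠ K Symb.hash) ∨
  -- The separator as value of `nh` says that the head has left the used part: a new cell with a
  -- marked `0` must follow.
  (R.ph = K (Symb.bit true) ∧ R.pid = R.lst ∧ R.nh = K Symb.hash ∧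
    (ConstP M K a ∨ b ≠ K (Symb.head false))) ∨
  -- The locked predecessor has come again in the next block: the same identifier must follow, with
  -- the updated content.
  (R.ph = K (Symb.bit true) ∧ R.lk = K (Symb.bit true) ∧ R.pid = R.lx ∧
    (a ≠ R.la ∨
      (a = R.nh ∧ OneP K R ∧ b ≠ K (Symb.head true)) ∨
      (a = R.nh ∧ ¬ OneP K R ∧ b ≠ K (Symb.head false)) ∨
      (a ≠ R.nh ∧ OneP K R ∧ b ≠ K (Symb.bit true)) ∨
      (a ≠ R.nh ∧ ¬ OneP K R ∧ b ≠ K (Symb.bit false))))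

/-- The transition relation on a pair that starts with the separator. -/
def TransHashP {D : Type*} (K : Symb → D) (R : Reg D) (a b : D) (R' : Reg D) : Prop :=
  (R.ph = K Symb.hash → R'.ph = K (Symb.bit false)) ∧
  (R.ph ≠ K Symb.hash → R'.ph = K (Symb.bit true)) ∧
  R'.pid = a ∧ R'.st = b ∧ R'.hid = a ∧ R'.hsucc = a ∧ R'.lst = R.pid ∧ R'.wr = R.nbit ∧
  -- `hsucc` still holds the separator if the head is on the last cell, which announces a new cell;
  -- `hpred` holds it if the head is on the first cell, where a left move has no effect.
  (R.ndir = K (Symb.bit true) → R'.nh = R.hsucc) ∧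
  (R.ndir ≠ K (Symb.bit true) → R.hpred = K Symb.hash → R'.nh = R.hid) ∧
  (R.ndir ≠ K (Symb.bit true) → R.hpred ≠ K Symb.hash → R'.nh = R.hpred) ∧
  (R.lk = K Symb.hash → R'.lk = R.lk) ∧
  -- A lock survives one separator only: at the next one there is no successor and the path ends.
  (R.lk ≠ K Symb.hash → R.lk = K (Symb.bit false) ∧ R'.lk = K (Symb.bit true) ∧
    R'.lx = R.lx ∧ R'.la = R.la ∧ R'.lb = R.lb)

/-- The row of the transition table for the state `p` and the bit `c`. -/
def RowP {D : Type*} (K : Symb → D) (R : Reg D) (b : D) (R' : Reg D) (p : ℕ) (c : Bool)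
    (e : Bool × Bool × ℕ) : Prop :=
  R.st = K (Symb.state p) → b = K (Symb.head c) → R'.nst = K (Symb.state e.2.2) ∧
    R'.nbit = K (Symb.bit e.1) ∧ R'.ndir = K (Symb.bit e.2.1)

/-- The transition relation on a pair that starts with the identifier of a cell. -/
def TransCellP {D : Type*} (M : DTM) (K : Symb → D) (R : Reg D) (a b : D) (R' : Reg D) : Prop :=
  R'.ph = R.ph ∧ R'.pid = a ∧ R'.st = R.st ∧ R'.wr = R.wr ∧
  (HeadP K b → R'.hid = a ∧ R'.hpred = R.pid) ∧
  (¬ HeadP K b → R'.hid = R.hid ∧ R'.hpred = R.hpred ∧ R'.nst = R.nst ∧ R'.nbit = R.nbit ∧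
    R'.ndir = R.ndir) ∧
  (∀ p < M.table.length, ∀ c, RowP K R b R' p c (M.trans p c)) ∧
  (R.pid = R.hid → R.pid ≠ K Symb.hash → R'.hsucc = a) ∧
  (¬ (R.pid = R.hid ∧ R.pid ≠ K Symb.hash) → R'.hsucc = R.hsucc) ∧
  -- A new cell becomes both the last cell and the head cell, after which the error condition asks
  -- for the end of the block.
  (R.pid = R.lst → R'.nh = a ∧ R'.lst = a) ∧
  (R.pid ≠ R.lst → R'.nh = R.nh ∧ R'.lst = R.lst) ∧
  -- The essential guess: keep the lock as it is or, if there is none, lock the current pair.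
  ((R'.lk = R.lk ∧ R'.lx = R.lx ∧ R'.la = R.la ∧ R'.lb = R.lb) ∨
    (R.lk = K Symb.hash ∧ R'.lk = K (Symb.bit false) ∧ R'.lx = R.pid ∧ R'.la = a ∧ R'.lb = b))

/-- The transition relation. -/
def TransP {D : Type*} (M : DTM) (anySt : Bool) (K : Symb → D) (R : Reg D) (a b : D)
    (R' : Reg D) : Prop :=
  ¬ StopP M anySt K R a ∧ (a = K Symb.hash → TransHashP K R a b R') ∧
    (a ≠ K Symb.hash → TransCellP M K R a b R')

/-! ### The automaton as constraints -/

/-- Equality of two variables. -/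
def eqv (x y : ℕ) : BExp := BExp.eq (DExp.var x) (DExp.var y)

/-- Equality of the current action with a variable. -/
def eqs (x : ℕ) : BExp := BExp.eq DExp.star (DExp.var x)

/-- Disjunction of constraints. -/
def bor (b c : BExp) : BExp := BExp.neg (BExp.and (BExp.neg b) (BExp.neg c))

/-- Implication of constraints. -/
def bimp (b c : BExp) : BExp := BExp.neg (BExp.and b (BExp.neg c))

/-- Conjunction of a list of constraints. -/
def conj (l : List BExp) : BExp := l.foldr BExp.and BExp.tru

/-- Disjunction of a list of constraints. -/
def disj (l : List BExp) : BExp := BExp.neg (conj (l.map BExp.neg))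

section
variable {D : Type*} {δ : DEnv D} {d : D}

@[simp] theorem eqv_holds {x y : ℕ} : (eqv x y).Holds δ d ↔ δ x = δ y := Iff.rfl

@[simp] theorem eqs_holds {x : ℕ} : (eqs x).Holds δ d ↔ d = δ x := Iff.rfl

@[simp] theorem neg_holds {b : BExp} : (BExp.neg b).Holds δ d ↔ ¬ b.Holds δ d := Iff.rfl

@[simp] theorem and_holds {b c : BExp} :
    (BExp.and b c).Holds δ d ↔ b.Holds δ d ∧ c.Holds δ d := Iff.rfl

@[simp] theorem tru_holds : BExp.tru.Holds δ d ↔ True := Iff.rfl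

@[simp] theorem bor_holds {b c : BExp} :
    (bor b c).Holds δ d ↔ b.Holds δ d ∨ c.Holds δ d := by
  simp only [bor, neg_holds, and_holds]; tauto

@[simp] theorem bimp_holds {b c : BExp} :
    (bimp b c).Holds δ d ↔ (b.Holds δ d → c.Holds δ d) := by
  simp only [bimp, neg_holds, and_holds]; tauto

theorem conj_holds {l : List BExp} : (conj l).Holds δ d ↔ ∀ b ∈ l, b.Holds δ d := by
  induction l with
  | nil => simp [conj]
  | cons b l ih => rw [List.forall_mem_cons, ← ih]; rfl

theorem disj_holds {l : List BExp} : (disj l).Holds δ d ↔ ∃ b ∈ l, b.Holds δ d := by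
  simp [disj, conj_holds]

end

/-- The number of symbols listed in the initial block. -/
def DTM.numConst (M : DTM) : ℕ := M.table.length + 5

/-- Constraint for `StopP`. -/
def stopB (anySt : Bool) (M : DTM) : BExp :=
  conj [eqv 16 33, BExp.neg (eqv 0 33), bif anySt then BExp.tru else eqv 2 (38 + M.final)]

/-- Constraint for `ConstP`. -/
def constB (M : DTM) : BExp := disj ((List.range M.numConst).map fun i => eqv 16 (33 + i))

/-- The values listed in the initial block are pairwise distinct. -/
def distinctB (M : DTM) : BExp :=
  conj ((List.range M.numConst).flatMap fun i =>
    (List.range i).map fun j => BExp.neg (eqv (33 + i) (33 + j)))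

/-- Constraint for `OneP`. -/
def oneB : BExp := bor (BExp.and (bor (eqv 15 36) (eqv 15 37)) (eqv 10 35)) (eqv 15 35)

/-- The error constraint. -/
def errB (anySt : Bool) (M : DTM) : BExp :=
  disj [BExp.neg (distinctB M),
    conj [eqv 0 33, BExp.neg (BExp.and (eqv 16 33) (eqs 38))],
    conj [BExp.neg (eqv 0 33), eqv 16 33, BExp.neg (stopB anySt M), BExp.neg (eqs 6)],
    conj [eqv 12 34, eqv 16 14],
    conj [eqv 0 34, eqv 16 33, eqv 1 33],
    conj [eqv 0 34, BExp.neg (eqv 16 33), disj [constB M,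
      conj [eqv 1 33, BExp.neg (bor (eqs 36) (eqs 37))],
      conj [BExp.neg (eqv 1 33), BExp.neg (bor (eqs 34) (eqs 35))]]],
    conj [eqv 0 35, eqv 1 9, BExp.neg (eqv 11 33), BExp.neg (eqv 16 33)],
    conj [eqv 0 35, eqv 1 9, eqv 11 33, bor (constB M) (BExp.neg (eqs 36))],
    conj [eqv 0 35, eqv 12 35, eqv 1 13, disj [BExp.neg (eqv 16 14),
      conj [eqv 16 11, oneB, BExp.neg (eqs 37)],
      conj [eqv 16 11, BExp.neg oneB, BExp.neg (eqs 36)],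
      conj [BExp.neg (eqv 16 11), oneB, BExp.neg (eqs 35)],
      conj [BExp.neg (eqv 16 11), BExp.neg oneB, BExp.neg (eqs 34)]]]]

/-- Constraint for `TransHashP`. -/
def transHashB : BExp :=
  conj [bimp (eqv 0 33) (eqv 17 34), bimp (BExp.neg (eqv 0 33)) (eqv 17 35),
    eqv 18 16, BExp.eq (DExp.var 19) DExp.star, eqv 20 16, eqv 22 16, eqv 26 1, eqv 27 7,
    bimp (eqv 8 35) (eqv 28 5),
    bimp (BExp.neg (eqv 8 35)) (bimp (eqv 4 33) (eqv 28 3)),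
    bimp (BExp.neg (eqv 8 35)) (bimp (BExp.neg (eqv 4 33)) (eqv 28 4)),
    bimp (eqv 12 33) (eqv 29 12),
    bimp (BExp.neg (eqv 12 33)) (conj [eqv 12 34, eqv 29 35, eqv 30 13, eqv 31 14, eqv 32 15])]

/-- The constraint for the row of the table for state `p` and bit `c`. -/
def rowB (p : ℕ) (c : Bool) (e : Bool × Bool × ℕ) : BExp :=
  bimp (eqv 2 (38 + p)) (bimp (eqs (bif c then 37 else 36)) (conj [eqv 23 (38 + e.2.2),
    eqv 24 (bif e.1 then 35 else 34), eqv 25 (bif e.2.1 then 35 else 34)]))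

/-- The constraint for the table. -/
def tableB (M : DTM) : BExp :=
  conj ((List.range M.table.length).flatMap fun p =>
    [rowB p false (M.table.getD p default).1, rowB p true (M.table.getD p default).2])

/-- Constraint for `TransCellP`. -/
def transCellB (M : DTM) : BExp :=
  conj [eqv 17 0, eqv 18 16, eqv 19 2, eqv 27 10,
    bimp (bor (eqs 36) (eqs 37)) (BExp.and (eqv 20 16) (eqv 21 1)),
    bimp (BExp.neg (bor (eqs 36) (eqs 37)))
      (conj [eqv 20 3, eqv 21 4, eqv 23 6, eqv 24 7, eqv 25 8]),
    tableB M,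
    bimp (eqv 1 3) (bimp (BExp.neg (eqv 1 33)) (eqv 22 16)),
    bimp (BExp.neg (BExp.and (eqv 1 3) (BExp.neg (eqv 1 33)))) (eqv 22 5),
    bimp (eqv 1 9) (BExp.and (eqv 28 16) (eqv 26 16)),
    bimp (BExp.neg (eqv 1 9)) (BExp.and (eqv 28 11) (eqv 26 9)),
    bor (conj [eqv 29 12, eqv 30 13, eqv 31 14, eqv 32 15])
      (conj [eqv 12 33, eqv 29 34, eqv 30 1, eqv 31 16, BExp.eq (DExp.var 32) DExp.star])]

/-- The transition constraint. -/
def transB (anySt : Bool) (M : DTM) : BExp :=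
  conj [BExp.neg (stopB anySt M), bimp (eqv 16 33) transHashB,
    bimp (BExp.neg (eqv 16 33)) (transCellB M)]

/-! ### Correctness of the constraints -/

section
variable {D : Type*} {δ : DEnv D} {d : D} {M : DTM} {anySt : Bool}

/-- The valuation of the listed symbols in an environment. -/
def symVal (δ : DEnv D) : Symb → D := fun s => δ s.toVar

/-- The symbols of the prelude occupy an interval of variables that starts at `33`, so constraints
on all of them are indexed by a range. -/
theorem isConst_iff (M : DTM) (i : ℕ) :
    (∃ s, M.IsConst s ∧ s.toVar = 33 + i) ↔ i < M.numConst := by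
  constructor
  · rintro ⟨s, hs, h⟩
    rcases s with _ | p | b | b | k <;> simp only [Symb.toVar, DTM.IsConst] at h hs <;>
      simp only [DTM.numConst] <;> first | omega | (split_ifs at h <;> omega)
  · intro hi
    rcases Nat.lt_or_ge i 5 with h | h
    · interval_cases i
      · exact ⟨Symb.hash, trivial, rfl⟩
      · exact ⟨Symb.bit false, trivial, rfl⟩
      · exact ⟨Symb.bit true, trivial, rfl⟩
      · exact ⟨Symb.head false, trivial, rfl⟩
      · exact ⟨Symb.head true, trivial, rfl⟩
    · refine ⟨Symb.state (i - 5), ?_, ?_⟩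
      · simp only [DTM.IsConst]; simp only [DTM.numConst] at hi; omega
      · simp only [Symb.toVar]; omega

theorem toVar_of_isConst {s : Symb} (h : M.IsConst s) : ∃ i < M.numConst, s.toVar = 33 + i := by
  rcases s with _ | p | b | b | k
  · exact ⟨0, by simp [DTM.numConst], rfl⟩
  · exact ⟨p + 5, by simpa [DTM.numConst, DTM.IsConst] using h, by simp [Symb.toVar]; omega⟩
  · cases b
    · exact ⟨1, by simp [DTM.numConst], rfl⟩
    · exact ⟨2, by simp [DTM.numConst], rfl⟩
  · cases b
    · exact ⟨3, by simp [DTM.numConst], rfl⟩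
    · exact ⟨4, by simp [DTM.numConst], rfl⟩
  · exact h.elim

theorem toVar_injOn {s s' : Symb} (h : M.IsConst s) (h' : M.IsConst s')
    (e : s.toVar = s'.toVar) : s = s' := by
  rcases s with _ | p | b | b | k <;> rcases s' with _ | p' | b' | b' | k' <;>
    simp only [DTM.IsConst] at h h' <;> simp only [Symb.toVar] at e <;>
    first | rfl | omega | (congr 1; omega) | skip
  all_goals (try cases b) <;> (try cases b') <;> simp at e ⊢ <;> omega

theorem distinctB_holds :
    (distinctB M).Holds δ d ↔ Set.InjOn (symVal δ) {s | M.IsConst s} := by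
  simp only [distinctB, conj_holds, List.mem_flatMap, List.mem_range, List.mem_map,
    forall_exists_index, and_imp]
  constructor
  · intro h s hs s' hs' e
    obtain ⟨i, hi, ei⟩ := toVar_of_isConst hs
    obtain ⟨j, hj, ej⟩ := toVar_of_isConst hs'
    simp only [symVal, ei, ej] at e
    refine toVar_injOn hs hs' ?_
    rw [ei, ej]
    rcases lt_trichotomy i j with hij | hij | hij
    · exact absurd e.symm (h _ j hj i hij rfl)
    · rw [hij]
    · exact absurd e (h _ i hi j hij rfl)
  · rintro h b i hi j hj rfl
    simp only [neg_holds, eqv_holds]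
    intro e
    obtain ⟨s, hs, es⟩ := (isConst_iff M i).2 hi
    obtain ⟨s', hs', es'⟩ := (isConst_iff M j).2 (hj.trans hi)
    have := h hs hs' (by simp only [symVal, es, es', e])
    subst this
    omega

theorem constB_holds : (constB M).Holds δ d ↔ ConstP M (symVal δ) (δ 16) := by
  simp only [constB, disj_holds, List.mem_map, List.mem_range, ConstP, symVal]
  constructor
  · rintro ⟨b, ⟨i, hi, rfl⟩, h⟩
    obtain ⟨s, hs, es⟩ := (isConst_iff M i).2 hi
    exact ⟨s, hs, by rw [es]; exact h⟩
  · rintro ⟨s, hs, h⟩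
    obtain ⟨i, hi, ei⟩ := toVar_of_isConst hs
    exact ⟨_, ⟨i, hi, rfl⟩, by rw [ei] at h; exact h⟩

theorem stopB_holds :
    (stopB anySt M).Holds δ d ↔ StopP M anySt (symVal δ) (regAt δ 0) (δ 16) := by
  cases anySt <;> simp [stopB, conj_holds, StopP, symVal, regAt, Symb.toVar]

theorem oneB_holds : oneB.Holds δ d ↔ OneP (symVal δ) (regAt δ 0) := by
  simp [oneB, OneP, HeadP, symVal, regAt, Symb.toVar]

/-- The constraint has one disjunct more than `ErrP`: a prelude with repeated values is an error by
itself. -/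
theorem errB_holds : (errB anySt M).Holds δ d ↔ ¬ Set.InjOn (symVal δ) {s | M.IsConst s} ∨
    ErrP M anySt (symVal δ) (regAt δ 0) (δ 16) d := by
  simp only [errB, disj_holds, conj_holds, List.mem_cons, List.not_mem_nil, or_false,
    forall_eq_or_imp, exists_eq_or_imp, forall_eq, exists_eq_left, neg_holds, eqv_holds, eqs_holds,
    and_holds, bor_holds, distinctB_holds, constB_holds, stopB_holds, oneB_holds, ErrP]
  rfl

theorem transHashB_holds : transHashB.Holds δ d ↔
    TransHashP (symVal δ) (regAt δ 0) (δ 16) d (regAt δ 17) := by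
  simp only [transHashB, conj_holds, List.mem_cons, List.not_mem_nil, or_false,
    forall_eq_or_imp, forall_eq, neg_holds, eqv_holds, bimp_holds, TransHashP]
  rfl

theorem rowB_holds {p : ℕ} {c : Bool} {e : Bool × Bool × ℕ} : (rowB p c e).Holds δ d ↔
    RowP (symVal δ) (regAt δ 0) d (regAt δ 17) p c e := by
  obtain ⟨e1, e2, e3⟩ := e
  cases c <;> cases e1 <;> cases e2 <;>
    simp [rowB, conj_holds, RowP, regAt, symVal, Symb.toVar]

theorem tableB_holds : (tableB M).Holds δ d ↔ ∀ p < M.table.length, ∀ c,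
    RowP (symVal δ) (regAt δ 0) d (regAt δ 17) p c (M.trans p c) := by
  simp only [tableB, conj_holds, List.mem_flatMap, List.mem_range, forall_exists_index, and_imp,
    List.mem_cons, List.not_mem_nil, or_false]
  constructor
  · intro h p hp c
    cases c
    · exact rowB_holds.1 (h _ p hp (Or.inl rfl))
    · exact rowB_holds.1 (h _ p hp (Or.inr rfl))
  · rintro h b p hp (rfl | rfl)
    · exact rowB_holds.2 (h p hp false)
    · exact rowB_holds.2 (h p hp true)

theorem transCellB_holds : (transCellB M).Holds δ d ↔
    TransCellP M (symVal δ) (regAt δ 0) (δ 16) d (regAt δ 17) := by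
  simp only [transCellB, conj_holds, List.mem_cons, List.not_mem_nil, or_false,
    forall_eq_or_imp, forall_eq, neg_holds, eqv_holds, eqs_holds, bimp_holds, bor_holds,
    and_holds, tableB_holds, TransCellP]
  rfl

theorem transB_holds : (transB anySt M).Holds δ d ↔
    TransP M anySt (symVal δ) (regAt δ 0) (δ 16) d (regAt δ 17) := by
  simp only [transB, conj_holds, List.mem_cons, List.not_mem_nil, or_false,
    forall_eq_or_imp, forall_eq, neg_holds, eqv_holds, bimp_holds, stopB_holds, transHashB_holds,
    transCellB_holds, TransP]
  rfl

end


/-! ### Paths of registers -/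

section
variable {D : Type*}

/-- The sequence of pairs of actions of a trace. -/
def pairsOf (t : Trace D) (m : ℕ) : D × D := (t (2 * m), t (2 * m + 1))

/-- `R` is reached from `R₀` after `m` pairs. -/
inductive RPath (M : DTM) (anySt : Bool) (K : Symb → D) (u : ℕ → D × D) (R₀ : Reg D) :
    ℕ → Reg D → Prop
  | zero : RPath M anySt K u R₀ 0 R₀
  | succ {m R R'} : RPath M anySt K u R₀ m R → TransP M anySt K R (u m).1 (u m).2 R' →
      RPath M anySt K u R₀ (m + 1) R'

/-- Store values in the registers from `17` on. -/
def storeReg (R : Reg D) (δ : DEnv D) : DEnv D := fun y =>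
  match y with
  | 17 => R.ph | 18 => R.pid | 19 => R.st | 20 => R.hid | 21 => R.hpred | 22 => R.hsucc
  | 23 => R.nst | 24 => R.nbit | 25 => R.ndir | 26 => R.lst | 27 => R.wr | 28 => R.nh
  | 29 => R.lk | 30 => R.lx | 31 => R.la | 32 => R.lb
  | y => δ y

theorem regAt_storeReg (R : Reg D) (δ : DEnv D) : regAt (storeReg R δ) 17 = R := rfl

theorem storeReg_of (R : Reg D) (δ : DEnv D) {y : ℕ} (h : y < 17 ∨ 33 ≤ y) :
    storeReg R δ y = δ y := by
  unfold storeReg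
  split <;> first | omega | rfl

theorem toVar_ge (s : Symb) : 33 ≤ s.toVar := by
  rcases s with _ | p | b | b | k <;> simp only [Symb.toVar] <;> first | omega | (split_ifs <;> omega)

theorem symVal_congr {δ δ' : DEnv D} (h : ∀ y, 33 ≤ y → δ' y = δ y) : symVal δ' = symVal δ :=
  funext fun s => h _ (toVar_ge s)

theorem symVal_load (δ : DEnv D) (c : D) : symVal (load δ c) = symVal δ :=
  symVal_congr fun y hy => by simp [load, show ¬ y < 16 by omega, show ¬ y = 16 by omega]

theorem regAt_load (δ : DEnv D) (c : D) : regAt (load δ c) 0 = regAt δ 17 := rfl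

theorem load_16 (δ : DEnv D) (c : D) : load δ c 16 = c := rfl

/-- The transition constraint compares offsets `0` and `17` of the new environment. Loading has
moved the old registers to offset `0`, so in terms of `δ` they are still found at `17`. -/
theorem succ_iff {M : DTM} {anySt : Bool} {δ δ' : DEnv D} {c d : D} :
    Succ (transB anySt M) δ c d δ' ↔ (∀ y, y < 17 ∨ 33 ≤ y → δ' y = load δ c y) ∧
      TransP M anySt (symVal δ) (regAt δ 17) c d (regAt δ' 17) := by
  refine and_congr_right fun h => ?_
  rw [transB_holds]
  have e1 : symVal δ' = symVal δ := by
    rw [← symVal_load δ c]; exact symVal_congr fun y hy => h y (Or.inr hy)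
  have e2 : regAt δ' 0 = regAt δ 17 := by
    rw [← regAt_load δ c]
    simp only [regAt]
    simp (disch := omega) only [h]
  have e3 : δ' 16 = c := h 16 (Or.inl (by omega))
  rw [e1, e2, e3]

theorem symVal_of_succ {M : DTM} {anySt : Bool} {δ δ' : DEnv D} {c d : D}
    (h : Succ (transB anySt M) δ c d δ') : symVal δ' = symVal δ := by
  rw [← symVal_load δ c]
  exact symVal_congr fun y hy => h.1 y (Or.inr hy)

theorem rpath_of_path {M : DTM} {anySt : Bool} {t : Trace D} {δ₀ δ : DEnv D} {m : ℕ}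
    (h : Path (transB anySt M) t δ₀ m δ) : symVal δ = symVal δ₀ ∧
      RPath M anySt (symVal δ₀) (pairsOf t) (regAt δ₀ 17) m (regAt δ 17) := by
  induction h with
  | zero => exact ⟨rfl, RPath.zero⟩
  | succ _ hs ih =>
    refine ⟨(symVal_of_succ hs).trans ih.1, RPath.succ ih.2 ?_⟩
    rw [← ih.1]
    exact (succ_iff.1 hs).2

theorem succ_storeReg {M : DTM} {anySt : Bool} {δ : DEnv D} {c d : D} {R' : Reg D}
    (h : TransP M anySt (symVal δ) (regAt δ 17) c d R') :
    Succ (transB anySt M) δ c d (storeReg R' (load δ c)) := by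
  rw [succ_iff, regAt_storeReg]
  exact ⟨fun y hy => storeReg_of _ _ hy, h⟩

theorem path_of_rpath {M : DTM} {anySt : Bool} {t : Trace D} {δ₀ : DEnv D} {R : Reg D} {m : ℕ}
    (h : RPath M anySt (symVal δ₀) (pairsOf t) (regAt δ₀ 17) m R) :
    ∃ δ, Path (transB anySt M) t δ₀ m δ ∧ regAt δ 17 = R := by
  induction h with
  | zero => exact ⟨δ₀, Path.zero, rfl⟩
  | succ _ hs ih =>
    obtain ⟨δ, hp, rfl⟩ := ih
    refine ⟨_, Path.succ hp (succ_storeReg (R' := _) ?_), regAt_storeReg _ _⟩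
    rw [(rpath_of_path hp).1]
    exact hs

/-- The listed values never change along a path, so they separate from the registers and
environments can be forgotten. -/
theorem noError_iff_rpath {M : DTM} {anySt : Bool} {t : Trace D} {δ₀ : DEnv D} :
    NoError (errB anySt M) (transB anySt M) t δ₀ ↔
      Set.InjOn (symVal δ₀) {s | M.IsConst s} ∧
      ∀ m R, RPath M anySt (symVal δ₀) (pairsOf t) (regAt δ₀ 17) m R →
        ¬ ErrP M anySt (symVal δ₀) R (pairsOf t m).1 (pairsOf t m).2 := by
  simp only [NoError, errB_holds, symVal_load, regAt_load, load_16, not_or, not_not]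
  constructor
  · intro h
    refine ⟨(h 0 δ₀ Path.zero).1, fun m R hR => ?_⟩
    obtain ⟨δ, hp, rfl⟩ := path_of_rpath hR
    rw [← (rpath_of_path hp).1]
    exact (h m δ hp).2
  · rintro ⟨h1, h2⟩ m δ hp
    obtain ⟨e, hR⟩ := rpath_of_path hp
    rw [e]
    exact ⟨h1, h2 m _ hR⟩

end

/-! ### The sequence of pairs of an encoding -/

/-- Identifiers: the separator, which comes before the state, and those of the cells. -/
def ident : ℕ → Symb
  | 0 => Symb.hash
  | k + 1 => Symb.cell k

/-- What comes after an identifier in the encoding of a configuration. -/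
def Cfg.content (c : Cfg) : ℕ → Symb
  | 0 => Symb.state c.state
  | k + 1 => if k = c.head then Symb.head (c.tape.getD k false) else Symb.bit (c.tape.getD k false)

/-- The length of the tape in the `i`-th configuration. -/
def DTM.len (M : DTM) (w : List Bool) (i : ℕ) : ℕ := (M.cfg w i).tape.length

/-- Block and position within the block of the `m`-th pair. -/
def DTM.pos (M : DTM) (w : List Bool) : ℕ → ℕ × ℕ
  | 0 => (0, 0)
  | m + 1 => if (M.pos w m).2 < M.len w (M.pos w m).1 then ((M.pos w m).1, (M.pos w m).2 + 1)
      else ((M.pos w m).1 + 1, 0)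

/-- The `m`-th pair. -/
def DTM.item (M : DTM) (w : List Bool) (m : ℕ) : Symb × Symb :=
  (ident (M.pos w m).2, (M.cfg w (M.pos w m).1).content (M.pos w m).2)

/-- The index of the first pair of a block. -/
def DTM.start (M : DTM) (w : List Bool) : ℕ → ℕ
  | 0 => 0
  | i + 1 => M.start w i + (M.len w i + 1)

theorem DTM.pos_start_add (M : DTM) (w : List Bool) (i j : ℕ) (hj : j ≤ M.len w i) :
    M.pos w (M.start w i + j) = (i, j) := by
  induction i generalizing j with
  | zero =>
    induction j with
    | zero => rfl
    | succ j ih =>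
      have := ih (by omega)
      rw [← Nat.add_assoc, DTM.pos, this, if_pos (by simp only; omega)]
  | succ i ih0 =>
    induction j with
    | zero =>
      have h := ih0 _ le_rfl
      rw [DTM.start, Nat.add_zero, ← Nat.add_assoc, DTM.pos, h, if_neg (by simp)]
    | succ j ih =>
      have := ih (by omega)
      rw [← Nat.add_assoc, DTM.pos, this, if_pos (by simp only; omega)]

theorem DTM.pos_le (M : DTM) (w : List Bool) (m : ℕ) :
    (M.pos w m).2 ≤ M.len w (M.pos w m).1 ∧ m = M.start w (M.pos w m).1 + (M.pos w m).2 := by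
  induction m with
  | zero => simp [DTM.pos, DTM.start]
  | succ m ih =>
    rw [DTM.pos]
    split_ifs with h
    · exact ⟨h, by simp only; omega⟩
    · refine ⟨Nat.zero_le _, ?_⟩
      simp only [DTM.start]
      omega

theorem DTM.start_strictMono (M : DTM) (w : List Bool) : StrictMono (M.start w) :=
  strictMono_nat_of_lt_succ fun i => by rw [DTM.start]; omega

theorem DTM.pos_fst_le_iff (M : DTM) (w : List Bool) (m n : ℕ) :
    (M.pos w m).1 ≤ n ↔ m < M.start w (n + 1) := by
  obtain ⟨h1, h2⟩ := M.pos_le w m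
  constructor
  · intro h
    have : M.start w ((M.pos w m).1 + 1) ≤ M.start w (n + 1) :=
      (M.start_strictMono w).monotone (by omega)
    rw [DTM.start] at this
    omega
  · intro h
    by_contra h'
    have : M.start w (n + 1) ≤ M.start w (M.pos w m).1 :=
      (M.start_strictMono w).monotone (by omega)
    omega

/-- The word formed by the first `N` pairs. -/
def pairWord (f : ℕ → Symb × Symb) (N : ℕ) : List Symb :=
  (List.range N).flatMap fun m => [(f m).1, (f m).2]

theorem pairWord_add (f : ℕ → Symb × Symb) (a b : ℕ) :
    pairWord f (a + b) = pairWord f a ++ pairWord (fun j => f (a + j)) b := by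
  simp [pairWord, List.range_add, List.flatMap_append, List.flatMap_map]

theorem pairWord_length (f : ℕ → Symb × Symb) (N : ℕ) : (pairWord f N).length = 2 * N := by
  induction N with
  | zero => rfl
  | succ N ih => rw [pairWord_add, List.length_append, ih]; simp [pairWord]; ring

/-- With the separator in front, the state plays the part of a content whose identifier is the
separator. This is why the encoding splits into pairs. -/
theorem Cfg.hash_enc (c : Cfg) : Symb.hash :: c.enc =
    pairWord (fun j => (ident j, c.content j)) (c.tape.length + 1) := by
  rw [Nat.add_comm, pairWord_add, Cfg.enc]
  simp [pairWord, ident, Cfg.content, Nat.add_comm 1]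

theorem DTM.flatMap_enc (M : DTM) (w : List Bool) (n : ℕ) :
    (List.range n).flatMap (fun i => Symb.hash :: (M.cfg w i).enc) =
      pairWord (M.item w) (M.start w n) := by
  induction n with
  | zero => rfl
  | succ n ih =>
    rw [List.range_succ, List.flatMap_append, ih, DTM.start, pairWord_add]
    simp only [List.flatMap_cons, List.flatMap_nil, List.append_nil, Cfg.hash_enc]
    congr 1
    unfold pairWord
    refine List.flatMap_congr fun j hj => ?_
    simp only [List.mem_range] at hj
    simp only [DTM.item]
    rw [M.pos_start_add w n j (by change j < M.len w n + 1 at hj; omega)]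

section
variable {D : Type*}

theorem Trace.take_add (t : Trace D) (a b : ℕ) :
    t.take (a + b) = t.take a ++ (t.drop a).take b := by
  simp [Trace.take, List.range_add, Trace.drop]

theorem Trace.take_append_iff (t : Trace D) (v : Symb → D) (l l' : List Symb) :
    t.take (l ++ l').length = (l ++ l').map v ↔
      t.take l.length = l.map v ∧ (t.drop l.length).take l'.length = l'.map v := by
  rw [List.length_append, Trace.take_add, List.map_append]
  constructor
  · intro h
    exact List.append_inj h (by simp [Trace.take])
  · rintro ⟨h1, h2⟩
    rw [h1, h2]

theorem take_pairWord_iff (t : Trace D) (v : Symb → D) (f : ℕ → Symb × Symb) (N : ℕ) :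
    t.take (pairWord f N).length = (pairWord f N).map v ↔
      ∀ m < N, pairsOf t m = (v (f m).1, v (f m).2) := by
  induction N with
  | zero => simp [pairWord, Trace.take]
  | succ N ih =>
    rw [pairWord_add, Trace.take_append_iff, ih, pairWord_length]
    simp only [pairWord, List.flatMap_cons, List.flatMap_nil, List.append_nil,
      Nat.add_zero, List.length_cons, List.length_nil, Trace.take, Trace.drop, List.map_cons,
      List.map_nil, List.range_succ, List.range_zero, List.nil_append,
      List.cons_append, List.cons.injEq, and_true, Nat.lt_succ_iff_lt_or_eq]
    constructor
    · rintro ⟨h1, h2, h3⟩ m (hm | rfl)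
      · exact h1 m hm
      · exact Prod.ext h2 h3
    · intro h
      refine ⟨fun m hm => h m (Or.inl hm), ?_, ?_⟩
      · exact congrArg Prod.fst (h N (Or.inr rfl))
      · exact congrArg Prod.snd (h N (Or.inr rfl))

/-- The closing separator is the first half of a pair whose second half is unconstrained. -/
theorem DTM.encodesUpTo_iff (M : DTM) (v : Symb → D) (w : List Bool) (n : ℕ) (t : Trace D) :
    M.EncodesUpTo v w n t ↔ t.take M.prelude.length = M.prelude.map v ∧
      (∀ m < M.start w (n + 1),
        pairsOf (t.drop M.prelude.length) m = (v (M.item w m).1, v (M.item w m).2)) ∧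
      (pairsOf (t.drop M.prelude.length) (M.start w (n + 1))).1 = v Symb.hash := by
  rw [DTM.EncodesUpTo, DTM.runWord, DTM.flatMap_enc, Trace.take_append_iff,
    Trace.take_append_iff, take_pairWord_iff, List.length_append, pairWord_length, and_assoc]
  refine and_congr_right fun _ => and_congr_right fun _ => ?_
  simp [Trace.take, Trace.drop, pairsOf]

end


/-! ### Runs of machines -/

namespace DTM
variable {M : DTM} {w : List Bool}

/-- The value of the transition function in the `i`-th configuration. -/
def act (M : DTM) (w : List Bool) (i : ℕ) : Bool × Bool × ℕ :=
  M.trans (M.cfg w i).state ((M.cfg w i).tape.getD (M.cfg w i).head false)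

theorem cfg_succ (M : DTM) (w : List Bool) (i : ℕ) : M.cfg w (i + 1) = M.step (M.cfg w i) :=
  Function.iterate_succ_apply' _ _ _

theorem state_succ (i : ℕ) : (M.cfg w (i + 1)).state = (M.act w i).2.2 := by
  rw [cfg_succ]; rfl

theorem head_succ (i : ℕ) : (M.cfg w (i + 1)).head =
    if (M.act w i).2.1 then (M.cfg w i).head + 1 else (M.cfg w i).head - 1 := by
  rw [cfg_succ]; rfl

theorem len_succ (i : ℕ) : M.len w (i + 1) =
    if (M.cfg w (i + 1)).head < M.len w i then M.len w i else M.len w i + 1 := by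
  rw [head_succ, len, len, cfg_succ, step]
  simp only [List.length_set]
  change List.length (if (if (M.act w i).2.1 then _ else _) < _ then _ else _) = _
  split_ifs <;> simp

theorem head_lt (hw : w ≠ []) (i : ℕ) : (M.cfg w i).head < M.len w i := by
  induction i with
  | zero => exact List.length_pos_iff.2 hw
  | succ i ih =>
    rw [len_succ]
    split_ifs with h
    · exact h
    · rw [head_succ] at h ⊢
      split_ifs at h ⊢ <;> omega

theorem len_le_succ (i : ℕ) : M.len w i ≤ M.len w (i + 1) := by
  rw [len_succ]; split_ifs <;> omega

theorem len_mono : Monotone (M.len w) := monotone_nat_of_le_succ len_le_succ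

/-- Cells outside the tape read as `0` anyway, so the cell that a step may append does not show. -/
theorem getD_succ (hw : w ≠ []) (i k : ℕ) : (M.cfg w (i + 1)).tape.getD k false =
    if k = (M.cfg w i).head then (M.act w i).1 else (M.cfg w i).tape.getD k false := by
  have hh : (M.cfg w i).head < (M.cfg w i).tape.length := head_lt hw i
  have key : ((M.cfg w i).tape.set (M.cfg w i).head (M.act w i).1).getD k false =
      if k = (M.cfg w i).head then (M.act w i).1 else (M.cfg w i).tape.getD k false := by
    simp only [List.getD_eq_getElem?_getD, List.getElem?_set]
    by_cases h : (M.cfg w i).head = k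
    · subst h; simp [hh]
    · simp [h, Ne.symm h]
  rw [← key, cfg_succ, step]
  change List.getD (if _ then (M.cfg w i).tape.set (M.cfg w i).head (M.act w i).1 else
    (M.cfg w i).tape.set (M.cfg w i).head (M.act w i).1 ++ [false]) k false = _
  have happ : ∀ l : List Bool, (l ++ [false]).getD k false = l.getD k false := by
    intro l
    simp only [List.getD_eq_getElem?_getD, List.getElem?_append]
    split_ifs with h
    · rfl
    · rw [List.getElem?_eq_none (by omega : _ ≤ k)]
      cases k - l.length <;> simp
  split_ifs <;> first | rfl | exact happ _

theorem trans_lt (hM : M.Valid) {p : ℕ} (hp : p < M.table.length) (c : Bool) :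
    (M.trans p c).2.2 < M.table.length := by
  have := hM.2 (M.table.getD p default) (by
    rw [List.getD_eq_getElem _ _ hp]; exact List.getElem_mem hp)
  cases c
  · exact this.1
  · exact this.2

theorem state_lt (hM : M.Valid) (i : ℕ) : (M.cfg w i).state < M.table.length := by
  induction i with
  | zero => exact lt_of_le_of_lt (Nat.zero_le _) hM.1
  | succ i ih => rw [state_succ]; exact trans_lt hM ih _

/-- The checks stop at the end of block `i`. -/
def StopsAfter (M : DTM) (anySt : Bool) (w : List Bool) (i : ℕ) : Prop :=
  anySt = true ∨ (M.cfg w i).state = M.final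

end DTM

/-! ### Injective valuations -/

section
variable {D : Type*} {M : DTM} {v : Symb → D} {w : List Bool}

theorem ident_injective : Function.Injective ident := by
  intro j k h
  cases j <;> cases k <;> simp_all [ident]

theorem ident_mem (M : DTM) (k : ℕ) : ident k ∈ M.symbols := by
  cases k <;> simp [ident, DTM.symbols]

theorem isConst_mem {s : Symb} (h : M.IsConst s) : s ∈ M.symbols := by
  rintro p rfl
  exact h

theorem val_ident (hv : Set.InjOn v M.symbols) {j k : ℕ} :
    v (ident j) = v (ident k) ↔ j = k := by
  rw [hv.eq_iff (ident_mem M j) (ident_mem M k), ident_injective.eq_iff]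

theorem val_ident_hash (hv : Set.InjOn v M.symbols) {j : ℕ} :
    v (ident j) = v Symb.hash ↔ j = 0 := val_ident hv (k := 0)

theorem val_hash_ident (hv : Set.InjOn v M.symbols) {j : ℕ} :
    v Symb.hash = v (ident j) ↔ j = 0 := eq_comm.trans (val_ident_hash hv)

theorem val_bit (hv : Set.InjOn v M.symbols) {b c : Bool} :
    v (Symb.bit b) = v (Symb.bit c) ↔ b = c := by
  rw [hv.eq_iff (by simp [DTM.symbols]) (by simp [DTM.symbols])]; simp

theorem val_head (hv : Set.InjOn v M.symbols) {b c : Bool} :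
    v (Symb.head b) = v (Symb.head c) ↔ b = c := by
  rw [hv.eq_iff (by simp [DTM.symbols]) (by simp [DTM.symbols])]; simp

theorem val_bit_head (hv : Set.InjOn v M.symbols) {b c : Bool} :
    v (Symb.bit b) = v (Symb.head c) ↔ False := by
  rw [hv.eq_iff (by simp [DTM.symbols]) (by simp [DTM.symbols])]; simp

theorem val_head_bit (hv : Set.InjOn v M.symbols) {b c : Bool} :
    v (Symb.head b) = v (Symb.bit c) ↔ False := by
  rw [hv.eq_iff (by simp [DTM.symbols]) (by simp [DTM.symbols])]; simp

theorem val_bit_hash (hv : Set.InjOn v M.symbols) {b : Bool} :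
    v (Symb.bit b) = v Symb.hash ↔ False := by
  rw [hv.eq_iff (by simp [DTM.symbols]) (by simp [DTM.symbols])]; simp

theorem val_hash_bit (hv : Set.InjOn v M.symbols) {b : Bool} :
    v Symb.hash = v (Symb.bit b) ↔ False := by
  rw [hv.eq_iff (by simp [DTM.symbols]) (by simp [DTM.symbols])]; simp

theorem val_state (hv : Set.InjOn v M.symbols) {p q : ℕ} (hp : p < M.table.length)
    (hq : q < M.table.length) : v (Symb.state p) = v (Symb.state q) ↔ p = q := by
  rw [hv.eq_iff (by simp [DTM.symbols, hp]) (by simp [DTM.symbols, hq])]; simp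

theorem Cfg.content_succ (c : Cfg) (k : ℕ) : c.content (k + 1) =
    if k = c.head then Symb.head (c.tape.getD k false) else Symb.bit (c.tape.getD k false) := rfl

theorem headP_content (hv : Set.InjOn v M.symbols) {c : Cfg} {k : ℕ} :
    HeadP v (v (c.content (k + 1))) ↔ k = c.head := by
  rw [HeadP, Cfg.content_succ]
  split_ifs with h
  · simp [h, val_head hv]
  · simp [h, val_bit_head hv]

theorem constP_ident_succ (hv : Set.InjOn v M.symbols) (k : ℕ) :
    ¬ ConstP M v (v (ident (k + 1))) := by
  rintro ⟨s, hs, h⟩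
  have := hv (ident_mem M _) (isConst_mem hs) h
  subst this
  exact hs

/-! ### The registers on an encoding -/

/-- The values of the registers after the `j`-th pair of block `i`. -/
structure Inv (M : DTM) (v : Symb → D) (w : List Bool) (i j : ℕ) (R : Reg D) : Prop where
  ph_zero : i = 0 → R.ph = v (Symb.bit false)
  ph_succ : i ≠ 0 → R.ph = v (Symb.bit true)
  pid : R.pid = v (ident j)
  st : R.st = v (Symb.state (M.cfg w i).state)
  hid : R.hid = v (ident (if (M.cfg w i).head < j then (M.cfg w i).head + 1 else 0))
  hsucc : R.hsucc = v (ident (if (M.cfg w i).head + 1 < j then (M.cfg w i).head + 2 else 0))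
  hpred : (M.cfg w i).head < j → R.hpred = v (ident (M.cfg w i).head)
  nst : (M.cfg w i).head < j → R.nst = v (Symb.state (M.act w i).2.2)
  nbit : (M.cfg w i).head < j → R.nbit = v (Symb.bit (M.act w i).1)
  ndir : (M.cfg w i).head < j → R.ndir = v (Symb.bit (M.act w i).2.1)
  wr : ∀ i', i = i' + 1 → R.wr = v (Symb.bit (M.act w i').1)
  nh : ∀ i', i = i' + 1 → R.nh = v (ident
    (if (M.cfg w i).head < max (M.len w i') j then (M.cfg w i).head + 1 else 0))
  lst : ∀ i', i = i' + 1 → R.lst = v (ident (max (M.len w i') j))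
  lock : R.lk = v Symb.hash ∨
    (R.lk = v (Symb.bit false) ∧ ∃ k < j, R.lx = v (ident k) ∧ R.la = v (ident (k + 1)) ∧
      R.lb = v ((M.cfg w i).content (k + 1))) ∨
    (R.lk = v (Symb.bit true) ∧ ∃ i', i = i' + 1 ∧ ∃ k < M.len w i', R.lx = v (ident k) ∧
      R.la = v (ident (k + 1)) ∧ R.lb = v ((M.cfg w i').content (k + 1)))

theorem Inv.ph_ne (hv : Set.InjOn v M.symbols) {i j : ℕ} {R : Reg D} (h : Inv M v w i j R) :
    R.ph ≠ v Symb.hash := by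
  rcases Nat.eq_zero_or_pos i with hi | hi
  · rw [h.ph_zero hi, Ne, val_bit_hash hv]; exact not_false
  · rw [h.ph_succ hi.ne', Ne, val_bit_hash hv]; exact not_false

theorem Inv.stopP_iff (hv : Set.InjOn v M.symbols) (hM : M.Valid) {anySt : Bool} {i j : ℕ}
    {R : Reg D} (h : Inv M v w i j R) {a : D} :
    StopP M anySt v R a ↔ a = v Symb.hash ∧ M.StopsAfter anySt w i := by
  simp only [StopP, h.ph_ne hv, DTM.StopsAfter, ne_eq, not_false_eq_true, true_and, h.st,
    val_state hv (DTM.state_lt hM i) hM.1]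

theorem Inv.start {R R' : Reg D}
    (hph : R.ph = v Symb.hash) (hlk : R.lk = v Symb.hash)
    (h : TransHashP v R (v Symb.hash) (v (Symb.state 0)) R') : Inv M v w 0 0 R' := by
  obtain ⟨h1, -, h3, h4, h5, h6, -, -, -, -, -, h12, -⟩ := h
  exact
  { ph_zero := fun _ => h1 hph
    ph_succ := fun h => absurd rfl h
    pid := h3
    st := h4
    hid := by rw [h5]; rfl
    hsucc := by rw [h6]; rfl
    hpred := fun h => absurd h (Nat.not_lt_zero _)
    nst := fun h => absurd h (Nat.not_lt_zero _)
    nbit := fun h => absurd h (Nat.not_lt_zero _)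
    ndir := fun h => absurd h (Nat.not_lt_zero _)
    wr := fun _ h => by omega
    nh := fun _ h => by omega
    lst := fun _ h => by omega
    lock := Or.inl ((h12 hlk).trans hlk) }

/-- The head cell precedes the end of the block because `w ≠ []`, so `hpred`, `nbit` and `ndir` have
been set by then. They give the written bit and the new head cell for the block that starts. -/
theorem Inv.hash (hv : Set.InjOn v M.symbols) (hw : w ≠ []) {i : ℕ} {R R' : Reg D}
    (h : Inv M v w i (M.len w i) R)
    (hT : TransHashP v R (v Symb.hash) (v (Symb.state (M.cfg w (i + 1)).state)) R') :
    Inv M v w (i + 1) 0 R' := by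
  obtain ⟨-, h2, h3, h4, h5, h6, h7, h8, h9, h10, h11, h12, h13⟩ := hT
  have hh := DTM.head_lt (M := M) hw i
  exact
  { ph_zero := fun h => by omega
    ph_succ := fun _ => h2 (h.ph_ne hv)
    pid := h3
    st := h4
    hid := by rw [h5]; rfl
    hsucc := by rw [h6]; rfl
    hpred := fun h => absurd h (Nat.not_lt_zero _)
    nst := fun h => absurd h (Nat.not_lt_zero _)
    nbit := fun h => absurd h (Nat.not_lt_zero _)
    ndir := fun h => absurd h (Nat.not_lt_zero _)
    wr := by
      rintro i' e
      obtain rfl : i = i' := by omega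
      rw [h8, h.nbit hh]
    nh := by
      rintro i' e
      obtain rfl : i = i' := by omega
      rw [h.ndir hh, val_bit hv] at h9
      rw [h.ndir hh, Ne, val_bit hv, h.hpred hh, val_ident_hash hv] at h10
      rw [h.ndir hh, Ne, val_bit hv, h.hpred hh, Ne, val_ident_hash hv] at h11
      rw [h.hid, if_pos hh] at h10
      rw [h.hsucc] at h9
      rw [DTM.head_succ]
      cases hd : (M.act w i).2.1
      · simp only [hd, Bool.false_eq_true, not_false_eq_true, true_imp_iff, if_false]
          at h10 h11 ⊢
        rcases Nat.eq_zero_or_pos (M.cfg w i).head with h0 | h0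
        · rw [h10 h0, h0, if_pos (by omega)]
        · rw [h11 h0.ne', if_pos (by omega)]
          congr 2; omega
      · rw [h9 hd]
        simp
    lst := by
      rintro i' e
      obtain rfl : i = i' := by omega
      rw [h7, h.pid]; simp
    lock := by
      rcases h.lock with hl | ⟨hl, k, hk, e1, e2, e3⟩ | ⟨hl, -⟩
      · exact Or.inl ((h12 hl).trans hl)
      · obtain ⟨-, g1, g2, g3, g4⟩ := h13 (by rw [hl, Ne, val_bit_hash hv]; exact not_false)
        exact Or.inr (Or.inr ⟨g1, i, rfl, k, hk, by rw [g2, e1], by rw [g3, e2], by rw [g4, e3]⟩)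
      · obtain ⟨g0, -⟩ := h13 (by rw [hl, Ne, val_bit_hash hv]; exact not_false)
        rw [hl, val_bit hv] at g0
        exact absurd g0 (by simp) }

theorem Inv.cell (hv : Set.InjOn v M.symbols) (hM : M.Valid) (hw : w ≠ []) {i j : ℕ}
    {R R' : Reg D} (hj : j < M.len w i) (h : Inv M v w i j R)
    (hT : TransCellP M v R (v (ident (j + 1))) (v ((M.cfg w i).content (j + 1))) R') :
    Inv M v w i (j + 1) R' := by
  obtain ⟨h1, h2, h3, h4, h5, h6, h7, h8, h9, h10, h11, h12⟩ := hT
  rw [headP_content hv] at h5 h6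
  have hext : ∀ i', i = i' + 1 → (R.pid = R.lst ↔ M.len w i' ≤ j) := by
    intro i' e
    rw [h.pid, h.lst i' e, val_ident hv]; omega
  -- A block is longer than the previous one by at most one cell, and that cell carries the head.
  have hlen : ∀ i', i = i' + 1 → M.len w i' ≤ j → j = M.len w i' ∧ (M.cfg w i).head = j := by
    rintro i' rfl h'
    rw [DTM.len_succ] at hj
    have := DTM.head_lt (M := M) hw (i' + 1)
    rw [DTM.len_succ] at this
    split_ifs at hj this <;> omega
  have htab : j = (M.cfg w i).head → R'.nst = v (Symb.state (M.act w i).2.2) ∧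
      R'.nbit = v (Symb.bit (M.act w i).1) ∧ R'.ndir = v (Symb.bit (M.act w i).2.1) := by
    intro e
    refine h7 _ (DTM.state_lt hM i) _ h.st ?_
    rw [Cfg.content, if_pos e, e]
  exact
  { ph_zero := fun e => by rw [h1, h.ph_zero e]
    ph_succ := fun e => by rw [h1, h.ph_succ e]
    pid := h2
    st := by rw [h3, h.st]
    hid := by
      by_cases e : j = (M.cfg w i).head
      · rw [(h5 e).1, if_pos (by omega), e]
      · rw [(h6 e).1, h.hid]
        congr 2
        have : (M.cfg w i).head < j ↔ (M.cfg w i).head < j + 1 := by omega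
        simp only [this]
    hsucc := by
      rw [h.pid, h.hid, Ne, val_ident_hash hv, val_ident hv] at h8 h9
      by_cases e : j = (M.cfg w i).head + 1
      · rw [h8 (by rw [if_pos (by omega)]; exact e) (by omega), if_pos (by omega), e]
      · rw [h9 (by split_ifs <;> omega), h.hsucc]
        congr 2
        have : (M.cfg w i).head + 1 < j ↔ (M.cfg w i).head + 1 < j + 1 := by omega
        simp only [this]
    hpred := fun hl => by
      by_cases e : j = (M.cfg w i).head
      · rw [(h5 e).2, h.pid, e]
      · rw [(h6 e).2.1, h.hpred (by omega)]
    nst := fun hl => by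
      by_cases e : j = (M.cfg w i).head
      · exact (htab e).1
      · rw [(h6 e).2.2.1, h.nst (by omega)]
    nbit := fun hl => by
      by_cases e : j = (M.cfg w i).head
      · exact (htab e).2.1
      · rw [(h6 e).2.2.2.1, h.nbit (by omega)]
    ndir := fun hl => by
      by_cases e : j = (M.cfg w i).head
      · exact (htab e).2.2
      · rw [(h6 e).2.2.2.2, h.ndir (by omega)]
    wr := fun i' e => by rw [h4, h.wr i' e]
    nh := fun i' e => by
      by_cases hx : M.len w i' ≤ j
      · obtain ⟨e1, e2⟩ := hlen i' e hx
        rw [(h10 ((hext i' e).2 hx)).1, if_pos (by omega), e2]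
      · rw [(h11 (mt (hext i' e).1 hx)).1, h.nh i' e]
        congr 2
        rw [max_eq_left (by omega), max_eq_left (by omega)]
    lst := fun i' e => by
      by_cases hx : M.len w i' ≤ j
      · rw [(h10 ((hext i' e).2 hx)).2, max_eq_right (by omega)]
      · rw [(h11 (mt (hext i' e).1 hx)).2, h.lst i' e, max_eq_left (by omega),
          max_eq_left (by omega)]
    lock := by
      rcases h12 with ⟨g1, g2, g3, g4⟩ | ⟨g0, g1, g2, g3, g4⟩
      · rcases h.lock with hl | ⟨hl, k, hk, e1, e2, e3⟩ | ⟨hl, i', hi', k, hk, e1, e2, e3⟩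
        · exact Or.inl (g1.trans hl)
        · exact Or.inr (Or.inl ⟨g1.trans hl, k, by omega, g2.trans e1, g3.trans e2, g4.trans e3⟩)
        · exact Or.inr (Or.inr ⟨g1.trans hl, i', hi', k, hk, g2.trans e1, g3.trans e2,
            g4.trans e3⟩)
      · exact Or.inr (Or.inl ⟨g1, j, by omega, g2.trans h.pid, g3, g4⟩) }

end


section
variable {D : Type*} {M : DTM} {v K : Symb → D} {w : List Bool} {anySt : Bool}

/-! ### Dependence on the listed symbols only -/

theorem StopP.congr (hM : M.Valid) (h : ∀ s, M.IsConst s → K s = v s) {R : Reg D} {a : D} :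
    StopP M anySt K R a ↔ StopP M anySt v R a := by
  rw [StopP, StopP, h Symb.hash trivial, h (Symb.state M.final) hM.1]

theorem ConstP.congr (h : ∀ s, M.IsConst s → K s = v s) {a : D} :
    ConstP M K a ↔ ConstP M v a := by
  constructor
  · rintro ⟨s, hs, rfl⟩; exact ⟨s, hs, h s hs⟩
  · rintro ⟨s, hs, rfl⟩; exact ⟨s, hs, (h s hs).symm⟩

theorem ErrP.congr (hM : M.Valid) (h : ∀ s, M.IsConst s → K s = v s) {R : Reg D} {a b : D} :
    ErrP M anySt K R a b ↔ ErrP M anySt v R a b := by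
  simp only [ErrP, StopP.congr hM h, ConstP.congr h, OneP, HeadP, h Symb.hash trivial,
    h (Symb.bit _) trivial, h (Symb.head _) trivial,
    h (Symb.state 0) (lt_of_le_of_lt (Nat.zero_le _) hM.1 : 0 < M.table.length)]

theorem TransP.congr (hM : M.Valid) (h : ∀ s, M.IsConst s → K s = v s) {R R' : Reg D}
    {a b : D} : TransP M anySt K R a b R' ↔ TransP M anySt v R a b R' := by
  have hrow : (∀ p < M.table.length, ∀ c, RowP K R b R' p c (M.trans p c)) ↔
      ∀ p < M.table.length, ∀ c, RowP v R b R' p c (M.trans p c) := by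
    refine forall_congr' fun p => forall_congr' fun hp => forall_congr' fun c => ?_
    rw [RowP, RowP, h (Symb.state p) hp, h (Symb.head c) trivial, h (Symb.bit _) trivial,
      h (Symb.bit _) trivial, h (Symb.state _) (DTM.trans_lt hM hp c)]
  simp only [TransP, StopP.congr hM h, TransHashP, TransCellP, hrow, HeadP, h Symb.hash trivial,
    h (Symb.bit _) trivial, h (Symb.head _) trivial]

/-- Paths depend on the valuation only through the symbols of the prelude, so identifiers of cells
may be renamed during a proof without affecting the automaton. -/
theorem RPath.congr (hM : M.Valid) (h : ∀ s, M.IsConst s → K s = v s) {u : ℕ → D × D}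
    {R₀ R : Reg D} {m : ℕ} (hp : RPath M anySt K u R₀ m R) : RPath M anySt v u R₀ m R := by
  induction hp with
  | zero => exact RPath.zero
  | succ _ hs ih => exact RPath.succ ih ((TransP.congr hM h).1 hs)

theorem Symb.exists_injective_nat : ∃ f : Symb → ℕ, Function.Injective f := by
  refine ⟨fun s => match s with
    | Symb.cell k => 2 * k + 1
    | s => 2 * s.toVar, fun s s' h => ?_⟩
  rcases s with _ | p | b | b | k <;> rcases s' with _ | p' | b' | b' | k' <;>
    (try cases b) <;> (try cases b') <;> simp [Symb.toVar] at h ⊢ <;> omega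

/-- A valuation that is injective on finitely many symbols extends to an injective valuation. -/
theorem exists_injective_extension [Infinite D] {F : Set Symb} (hF : F.Finite)
    (hK : Set.InjOn K F) : ∃ v : Symb → D, Function.Injective v ∧ ∀ s ∈ F, K s = v s := by
  classical
  have hinf : ((K '' F)ᶜ).Infinite := (hF.image K).infinite_compl
  have := hinf.to_subtype
  let f := Infinite.natEmbedding ((K '' F)ᶜ : Set D)
  obtain ⟨c, hc⟩ := Symb.exists_injective_nat
  refine ⟨fun s => if s ∈ F then K s else f (c s), fun s s' e => ?_, fun s hs => (if_pos hs).symm⟩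
  dsimp only at e
  split_ifs at e with h h' h'
  · exact hK h h' e
  · exact absurd ⟨s, h, e⟩ (f (c s')).2
  · exact absurd ⟨s', h', e.symm⟩ (f (c s)).2
  · exact hc (f.injective (Subtype.ext e))

/-- A valuation of the listed symbols extends to an injective valuation. -/
theorem exists_val_extension [Infinite D] (hK : Set.InjOn K {s | M.IsConst s}) :
    ∃ v : Symb → D, Set.InjOn v M.symbols ∧ ∀ s, M.IsConst s → K s = v s := by
  have hfin : {s | M.IsConst s}.Finite := by
    refine Set.Finite.of_injOn (f := Symb.toVar) (t := Set.Iio (33 + M.numConst)) ?_ ?_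
      (Set.finite_Iio _)
    · intro s hs
      obtain ⟨i, hi, e⟩ := toVar_of_isConst hs
      simp only [Set.mem_Iio, e]
      omega
    · intro s hs s' hs' e
      exact toVar_injOn hs hs' e
  obtain ⟨v, hv, h⟩ := exists_injective_extension hfin hK
  exact ⟨v, hv.injOn, h⟩

/-! ### Existence of successors -/

/-- At most one row of the table applies, since the listed values are distinct; if none does, any
values will do. -/
theorem exists_table (hK : Set.InjOn K {s | M.IsConst s}) (R : Reg D) (b : D) :
    ∃ x y z : D, (∀ p < M.table.length, ∀ c, R.st = K (Symb.state p) → b = K (Symb.head c) →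
      x = K (Symb.state (M.trans p c).2.2) ∧ y = K (Symb.bit (M.trans p c).1) ∧
        z = K (Symb.bit (M.trans p c).2.1)) := by
  by_cases h : ∃ p c, p < M.table.length ∧ R.st = K (Symb.state p) ∧ b = K (Symb.head c)
  · obtain ⟨p, c, hp, h1, h2⟩ := h
    refine ⟨K (Symb.state (M.trans p c).2.2), K (Symb.bit (M.trans p c).1),
      K (Symb.bit (M.trans p c).2.1), fun p' hp' c' h1' h2' => ?_⟩
    have e1 : Symb.state p = Symb.state p' := hK hp hp' (h1.symm.trans h1')
    have e2 : Symb.head c = Symb.head c' := by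
      refine hK ?_ ?_ (h2.symm.trans h2') <;> exact trivial
    injection e1 with e1
    injection e2 with e2
    subst e1 e2
    exact ⟨rfl, rfl, rfl⟩
  · exact ⟨b, b, b, fun p hp c h1 h2 => absurd ⟨p, c, hp, h1, h2⟩ h⟩

/-- The clauses for the registers outside the lock never conflict, so either choice of the lock can
be completed to a successor. -/
theorem exists_transCell (hK : Set.InjOn K {s | M.IsConst s}) (R : Reg D) (a b lk lx la lb : D)
    (hl : (lk = R.lk ∧ lx = R.lx ∧ la = R.la ∧ lb = R.lb) ∨
      (R.lk = K Symb.hash ∧ lk = K (Symb.bit false) ∧ lx = R.pid ∧ la = a ∧ lb = b)) :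
    ∃ R', TransCellP M K R a b R' ∧ R'.lk = lk ∧ R'.lx = lx ∧ R'.la = la ∧ R'.lb = lb := by
  classical
  obtain ⟨x, y, z, h⟩ := exists_table hK R b
  refine ⟨{ ph := R.ph, pid := a, st := R.st, wr := R.wr
            hid := if HeadP K b then a else R.hid
            hpred := if HeadP K b then R.pid else R.hpred
            nst := if HeadP K b then x else R.nst
            nbit := if HeadP K b then y else R.nbit
            ndir := if HeadP K b then z else R.ndir
            hsucc := if R.pid = R.hid ∧ R.pid ≠ K Symb.hash then a else R.hsucc
            nh := if R.pid = R.lst then a else R.nh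
            lst := if R.pid = R.lst then a else R.lst
            lk := lk, lx := lx, la := la, lb := lb }, ⟨rfl, rfl, rfl, rfl, fun h => ?_, fun h => ?_,
            fun p hp c h1 h2 => ?_, fun h1 h2 => ?_, fun h => ?_, fun h => ?_, fun h => ?_, hl⟩,
            rfl, rfl, rfl, rfl⟩
  · simp [h]
  · simp [h]
  · have hb : HeadP K b := by cases c <;> simp [HeadP, h2]
    simp only [hb, if_true]
    exact h p hp c h1 h2
  · exact if_pos ⟨h1, h2⟩
  · exact if_neg h
  · simp [h]
  · simp [h]

theorem exists_transHash (R : Reg D) (a b lk : D)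
    (hl : (R.lk = K Symb.hash ∧ lk = K Symb.hash) ∨
      (R.lk ≠ K Symb.hash ∧ R.lk = K (Symb.bit false) ∧ lk = K (Symb.bit true))) :
    ∃ R', TransHashP K R a b R' ∧ R'.lk = lk ∧ R'.lx = R.lx ∧ R'.la = R.la ∧ R'.lb = R.lb := by
  classical
  refine ⟨{ R with ph := if R.ph = K Symb.hash then K (Symb.bit false) else K (Symb.bit true)
                   pid := a, st := b, hid := a, hsucc := a, lst := R.pid, wr := R.nbit
                   nh := if R.ndir = K (Symb.bit true) then R.hsucc else
                     if R.hpred = K Symb.hash then R.hid else R.hpred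
                   lk := lk }, ⟨fun h => if_pos h, fun h => if_neg h, rfl, rfl, rfl, rfl, rfl, rfl,
                   fun h => if_pos h, fun h h' => ?_, fun h h' => ?_, fun h => ?_, fun h => ?_⟩,
                   rfl, rfl, rfl, rfl⟩
  · simp [h, h']
  · simp [h, h']
  · rcases hl with ⟨h1, h2⟩ | ⟨h1, -⟩
    · exact h2.trans h.symm
    · exact absurd h h1
  · rcases hl with ⟨h1, -⟩ | ⟨-, h2, h3⟩
    · exact absurd h1 h
    · exact ⟨h2, h3, rfl, rfl, rfl⟩

/-- Paths without lock continue until they stop. -/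
theorem exists_transP (hK : Set.InjOn K {s | M.IsConst s}) (R : Reg D) (a b : D)
    (hs : ¬ StopP M anySt K R a) (hl : R.lk = K Symb.hash) :
    ∃ R', TransP M anySt K R a b R' ∧ R'.lk = K Symb.hash := by
  by_cases ha : a = K Symb.hash
  · obtain ⟨R', h, h', -⟩ := exists_transHash (K := K) R a b _ (Or.inl ⟨hl, rfl⟩)
    exact ⟨R', ⟨hs, fun _ => h, fun h => absurd ha h⟩, h'⟩
  · obtain ⟨R', h, h', -⟩ := exists_transCell hK R a b _ _ _ _ (Or.inl ⟨rfl, rfl, rfl, rfl⟩)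
    exact ⟨R', ⟨hs, fun h => absurd h ha, fun _ => h⟩, h'.trans hl⟩

/-! ### Paths on an encoding -/

/-- The pairs up to the `m`-th one are those of the encoding. -/
def Matches (M : DTM) (v : Symb → D) (w : List Bool) (u : ℕ → D × D) (m : ℕ) : Prop :=
  ∀ m' ≤ m, u m' = (v (M.item w m').1, v (M.item w m').2)

theorem DTM.pos_succ_cases (M : DTM) (w : List Bool) (m : ℕ) {i j : ℕ} (h : M.pos w m = (i, j)) :
    (j < M.len w i ∧ M.pos w (m + 1) = (i, j + 1)) ∨
      (j = M.len w i ∧ M.pos w (m + 1) = (i + 1, 0)) := by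
  have h1 := (M.pos_le w m).1
  rw [h] at h1
  rw [DTM.pos, h]
  split_ifs with h2
  · exact Or.inl ⟨h2, rfl⟩
  · exact Or.inr ⟨by simp only at h1 h2; omega, rfl⟩

/-- The transition relation alone keeps the registers right as long as the trace agrees with an
encoding; absence of errors is not needed. After `m + 1` pairs the registers describe the position
of the pair with index `m`. -/
theorem RPath.inv (hv : Set.InjOn v M.symbols) (hM : M.Valid) (hw : w ≠ []) {u : ℕ → D × D}
    {R₀ : Reg D} (hph : R₀.ph = v Symb.hash) (hlk : R₀.lk = v Symb.hash) {m : ℕ}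
    (hu : Matches M v w u m) {R : Reg D} (hR : RPath M anySt v u R₀ (m + 1) R) :
    Inv M v w (M.pos w m).1 (M.pos w m).2 R := by
  induction m generalizing R with
  | zero =>
    cases hR with
    | succ hR hs =>
      cases hR
      rw [hu 0 le_rfl] at hs
      exact Inv.start hph hlk (hs.2.1 rfl)
  | succ m ih =>
    cases hR with
    | succ hR hs =>
      have hI := ih (fun m' hm' => hu m' (by omega)) hR
      obtain ⟨⟨i, j⟩, hp⟩ : ∃ p, M.pos w m = p := ⟨_, rfl⟩
      rw [hu (m + 1) le_rfl] at hs
      simp only [hp] at hI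
      rcases M.pos_succ_cases w m hp with ⟨hj, hp'⟩ | ⟨rfl, hp'⟩
      · simp only [DTM.item, hp'] at hs ⊢
        refine Inv.cell hv hM hw hj hI (hs.2.2 ?_)
        rw [Ne, val_ident_hash hv]
        exact Nat.succ_ne_zero j
      · simp only [DTM.item, hp'] at hs ⊢
        exact Inv.hash hv hw hI (hs.2.1 rfl)

/-- A universal check has force only if the paths that perform it exist. Every lock that `Inv`
allows is realised: none, any cell read so far in the block, or any cell of the previous block. The
last kind arises from the second when a separator is read. -/
theorem exists_rpath (hv : Set.InjOn v M.symbols) (hM : M.Valid) (hw : w ≠ []) {u : ℕ → D × D}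
    {R₀ : Reg D} (hph : R₀.ph = v Symb.hash) (hlk : R₀.lk = v Symb.hash) {m i j : ℕ}
    (hu : Matches M v w u m) (hp : M.pos w m = (i, j))
    (hs : ∀ i' < i, ¬ M.StopsAfter anySt w i') :
    (∃ R, RPath M anySt v u R₀ (m + 1) R ∧ R.lk = v Symb.hash) ∧
    (∀ k < j, ∃ R, RPath M anySt v u R₀ (m + 1) R ∧ R.lk = v (Symb.bit false) ∧
      R.lx = v (ident k) ∧ R.la = v (ident (k + 1)) ∧ R.lb = v ((M.cfg w i).content (k + 1))) ∧
    (∀ i', i = i' + 1 → ∀ k < M.len w i', ∃ R, RPath M anySt v u R₀ (m + 1) R ∧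
      R.lk = v (Symb.bit true) ∧ R.lx = v (ident k) ∧ R.la = v (ident (k + 1)) ∧
      R.lb = v ((M.cfg w i').content (k + 1))) := by
  have hK : Set.InjOn v {s | M.IsConst s} := hv.mono fun s hs => isConst_mem hs
  induction m generalizing i j with
  | zero =>
    obtain ⟨rfl, rfl⟩ : (0 : ℕ) = i ∧ (0 : ℕ) = j := by simpa [DTM.pos] using hp
    refine ⟨?_, fun k hk => absurd hk (Nat.not_lt_zero k), fun i' h => by omega⟩
    obtain ⟨R', h1, h2⟩ := exists_transP (anySt := anySt) hK R₀ (u 0).1 (u 0).2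
      (fun h => h.2.1 hph) hlk
    exact ⟨R', RPath.succ RPath.zero h1, h2⟩
  | succ m ih =>
    have hum : Matches M v w u m := fun m' hm' => hu m' (by omega)
    obtain ⟨⟨i₁, j₁⟩, hp₁⟩ : ∃ p, M.pos w m = p := ⟨_, rfl⟩
    have hun := hu (m + 1) le_rfl
    simp only [DTM.item, hp] at hun
    have hI : ∀ R, RPath M anySt v u R₀ (m + 1) R → Inv M v w i₁ j₁ R := by
      intro R hR
      simpa only [hp₁] using RPath.inv hv hM hw hph hlk hum hR
    rcases M.pos_succ_cases w m hp₁ with ⟨hj, hp'⟩ | ⟨rfl, hp'⟩ <;> rw [hp] at hp' <;>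
      obtain ⟨rfl, rfl⟩ := Prod.mk.inj hp'
    · obtain ⟨⟨R, hR, hRl⟩, ih2, ih3⟩ := ih hum hp₁ hs
      have hne : (u (m + 1)).1 ≠ v Symb.hash := by
        rw [hun, Ne, val_ident_hash hv]
        exact Nat.succ_ne_zero j₁
      have step : ∀ R : Reg D, RPath M anySt v u R₀ (m + 1) R → ∀ lk lx la lb : D,
          ((lk = R.lk ∧ lx = R.lx ∧ la = R.la ∧ lb = R.lb) ∨
          (R.lk = v Symb.hash ∧ lk = v (Symb.bit false) ∧ lx = R.pid ∧ la = (u (m + 1)).1 ∧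
            lb = (u (m + 1)).2)) →
          ∃ R', RPath M anySt v u R₀ (m + 1 + 1) R' ∧ R'.lk = lk ∧ R'.lx = lx ∧ R'.la = la ∧
            R'.lb = lb := by
        intro R hR lk lx la lb hl
        obtain ⟨R', h1, h2⟩ := exists_transCell hK R _ _ lk lx la lb hl
        exact ⟨R', RPath.succ hR ⟨fun h => hne h.1, fun h => absurd h hne, fun _ => h1⟩, h2⟩
      refine ⟨?_, fun k hk => ?_, fun i' hi' k hk => ?_⟩
      · obtain ⟨R', h1, h2, -⟩ := step R hR _ _ _ _ (Or.inl ⟨rfl, rfl, rfl, rfl⟩)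
        exact ⟨R', h1, h2.trans hRl⟩
      · rcases Nat.lt_succ_iff_lt_or_eq.1 hk with hk | rfl
        · obtain ⟨R, hR, e1, e2, e3, e4⟩ := ih2 k hk
          obtain ⟨R', h1, g1, g2, g3, g4⟩ := step R hR _ _ _ _ (Or.inl ⟨rfl, rfl, rfl, rfl⟩)
          exact ⟨R', h1, g1.trans e1, g2.trans e2, g3.trans e3, g4.trans e4⟩
        · obtain ⟨R', h1, g1, g2, g3, g4⟩ := step R hR _ _ _ _ (Or.inr ⟨hRl, rfl, rfl, rfl, rfl⟩)
          refine ⟨R', h1, g1, g2.trans (hI R hR).pid, ?_, ?_⟩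
          · rw [g3, hun]
          · rw [g4, hun]
      · obtain ⟨R, hR, e1, e2, e3, e4⟩ := ih3 i' hi' k hk
        obtain ⟨R', h1, g1, g2, g3, g4⟩ := step R hR _ _ _ _ (Or.inl ⟨rfl, rfl, rfl, rfl⟩)
        exact ⟨R', h1, g1.trans e1, g2.trans e2, g3.trans e3, g4.trans e4⟩
    · obtain ⟨⟨R, hR, hRl⟩, ih2, -⟩ := ih hum hp₁ fun i' hi' => hs i' (by omega)
      have heq : (u (m + 1)).1 = v Symb.hash := by rw [hun]; rfl
      have hns : ∀ R, RPath M anySt v u R₀ (m + 1) R → ¬ StopP M anySt v R (u (m + 1)).1 := by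
        intro R hR
        rw [(hI R hR).stopP_iff hv hM]
        exact fun h => hs i₁ (by omega) h.2
      refine ⟨?_, fun k hk => absurd hk (Nat.not_lt_zero k), fun i' hi' k hk => ?_⟩
      · obtain ⟨R', h1, h2⟩ := exists_transP hK R (u (m + 1)).1 (u (m + 1)).2 (hns R hR) hRl
        exact ⟨R', RPath.succ hR h1, h2⟩
      · obtain rfl : i₁ = i' := by omega
        obtain ⟨R, hR, e1, e2, e3, e4⟩ := ih2 k hk
        obtain ⟨R', h1, g1, g2, g3, g4⟩ := exists_transHash (K := v) R (u (m + 1)).1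
          (u (m + 1)).2 _ (Or.inr ⟨by rw [e1, Ne, val_bit_hash hv]; exact not_false, e1, rfl⟩)
        exact ⟨R', RPath.succ hR ⟨hns R hR, fun _ => h1, fun h => absurd heq h⟩, g1, g2.trans e2,
          g3.trans e3, g4.trans e4⟩

end


section
variable {D : Type*} {M : DTM} {v K : Symb → D} {w : List Bool} {anySt : Bool}

/-! ### Errors on an encoding -/

/-- The tape grows by at most one cell per step, and only when the head moves onto that cell. -/
theorem DTM.ext_cell (hw : w ≠ []) {i j : ℕ} (hj : j < M.len w (i + 1)) (h : M.len w i ≤ j) :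
    j = M.len w i ∧ (M.cfg w (i + 1)).head = j := by
  have := DTM.head_lt (M := M) hw (i + 1)
  rw [DTM.len_succ] at hj this
  split_ifs at hj this <;> omega

theorem Inv.pid_eq_lst (hv : Set.InjOn v M.symbols) {i j : ℕ} {R : Reg D}
    (h : Inv M v w (i + 1) j R) : R.pid = R.lst ↔ M.len w i ≤ j := by
  rw [h.pid, h.lst i rfl, val_ident hv]; omega

/-- The last step wrote under the old head, which was inside the old tape, so the new cell holds
`0`. -/
theorem Inv.content_ext (hw : w ≠ []) {i j : ℕ} (hj : j < M.len w (i + 1)) (h : M.len w i ≤ j) :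
    (M.cfg w (i + 1)).content (j + 1) = Symb.head false := by
  obtain ⟨h1, h2⟩ := DTM.ext_cell hw hj h
  have := DTM.head_lt (M := M) hw i
  rw [Cfg.content_succ, if_pos h2.symm, DTM.getD_succ hw, if_neg (by omega),
    List.getD_eq_default _ _ h]

/-- A content changes only under the old head, which is visible in the locked content itself; there
the new bit is the one stored in `wr`. -/
theorem Inv.oneP_iff (hv : Set.InjOn v M.symbols) (hw : w ≠ []) {i j k : ℕ} {R : Reg D}
    (h : Inv M v w (i + 1) j R) (hlb : R.lb = v ((M.cfg w i).content (k + 1))) :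
    OneP v R ↔ (M.cfg w (i + 1)).tape.getD k false = true := by
  rw [OneP, hlb, headP_content hv, h.wr i rfl, val_bit hv, DTM.getD_succ hw, Cfg.content_succ]
  split_ifs with e
  · simp [val_head_bit hv, e]
  · simp [val_bit hv, e]

theorem Inv.eq_nh_iff (hv : Set.InjOn v M.symbols) {i j : ℕ} {R : Reg D}
    (h : Inv M v w (i + 1) j R) (hj : j < M.len w i) :
    v (ident (j + 1)) = R.nh ↔ j = (M.cfg w (i + 1)).head := by
  rw [h.nh i rfl, val_ident hv, max_eq_left hj.le]
  split_ifs with hd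
  · exact Nat.succ_inj
  · exact ⟨False.elim, fun e => by omega⟩

theorem Inv.lock_false (hv : Set.InjOn v M.symbols) {i j : ℕ} {R : Reg D}
    (h : Inv M v w i j R) (hl : R.lk = v (Symb.bit false)) : ∃ k < j, R.la = v (ident (k + 1)) := by
  rcases h.lock with hl' | ⟨-, k, hk, -, h, -⟩ | ⟨hl', -⟩
  · rw [hl, val_bit_hash hv] at hl'; exact hl'.elim
  · exact ⟨k, hk, h⟩
  · rw [hl, val_bit hv] at hl'; simp at hl'

theorem Inv.lock_true (hv : Set.InjOn v M.symbols) {i j : ℕ} {R : Reg D}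
    (h : Inv M v w (i + 1) j R) (hl : R.lk = v (Symb.bit true)) :
    ∃ k < M.len w i, R.lx = v (ident k) ∧ R.la = v (ident (k + 1)) ∧
      R.lb = v ((M.cfg w i).content (k + 1)) := by
  rcases h.lock with hl' | ⟨hl', -⟩ | ⟨-, i', e, h⟩
  · rw [hl, val_bit_hash hv] at hl'; exact hl'.elim
  · rw [hl, val_bit hv] at hl'; simp at hl'
  · obtain rfl : i = i' := by omega
    exact h

theorem Inv.ph_false (hv : Set.InjOn v M.symbols) {i j : ℕ} {R : Reg D}
    (h : Inv M v w i j R) : R.ph = v (Symb.bit false) ↔ i = 0 := by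
  refine ⟨fun e => ?_, h.ph_zero⟩
  by_contra hi
  rw [h.ph_succ hi, val_bit hv] at e
  simp at e

theorem Inv.ph_true (hv : Set.InjOn v M.symbols) {i j : ℕ} {R : Reg D}
    (h : Inv M v w i j R) : R.ph = v (Symb.bit true) ↔ i ≠ 0 := by
  refine ⟨fun e hi => ?_, h.ph_succ⟩
  rw [h.ph_zero hi, val_bit hv] at e
  simp at e

/-- The cases follow the disjuncts of `ErrP`. The lock is compared by means of `Inv.eq_nh_iff` for
the head and `Inv.oneP_iff` for the bit. -/
theorem Inv.not_err_cell (hv : Set.InjOn v M.symbols) (hw : w ≠ []) {i j : ℕ} {R : Reg D}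
    (h : Inv M v w i j R) (hj : j < M.len w i) :
    ¬ ErrP M anySt v R (v (ident (j + 1))) (v ((M.cfg w i).content (j + 1))) := by
  have hne : v (ident (j + 1)) ≠ v Symb.hash := by
    rw [Ne, val_ident_hash hv]; exact Nat.succ_ne_zero j
  rintro (⟨h1, -⟩ | ⟨-, h1, -⟩ | ⟨h1, h2⟩ | ⟨-, h1, -⟩ | ⟨h1, -, h2⟩ | ⟨h1, h2, h3, -⟩ |
    ⟨h1, h2, -, h3⟩ | ⟨h1, h2, h3, h4⟩)
  · exact h.ph_ne hv h1
  · exact hne h1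
  · obtain ⟨k, hk, e⟩ := h.lock_false hv h1
    rw [e, val_ident hv] at h2
    omega
  · exact hne h1
  · rw [h.ph_false hv] at h1
    subst h1
    have hhead : (M.cfg w 0).head = 0 := rfl
    rw [h.pid, Ne, val_ident_hash hv, headP_content hv, hhead, Cfg.content_succ, hhead] at h2
    rcases h2 with h2 | ⟨h2, h3⟩ | ⟨h2, h3⟩
    · exact constP_ident_succ hv j h2
    · exact h3 h2
    · rw [if_neg h2, val_bit hv, val_bit hv] at h3
      generalize (M.cfg w 0).tape.getD j false = c at h3
      cases c <;> simp at h3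
  · rw [h.ph_true hv] at h1
    obtain ⟨i, rfl⟩ : ∃ i', i = i' + 1 := Nat.exists_eq_succ_of_ne_zero h1
    rw [h.pid_eq_lst hv] at h2
    obtain ⟨e1, e2⟩ := DTM.ext_cell hw hj h2
    apply h3
    -- The head is on the very cell that comes next, so `nh` still holds the separator.
    rw [h.nh i rfl, if_neg (by omega)]
    rfl
  · rw [h.ph_true hv] at h1
    obtain ⟨i, rfl⟩ : ∃ i', i = i' + 1 := Nat.exists_eq_succ_of_ne_zero h1
    rw [h.pid_eq_lst hv] at h2
    rcases h3 with h3 | h3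
    · exact constP_ident_succ hv j h3
    · exact h3 (by rw [Inv.content_ext hw hj h2])
  · rw [h.ph_true hv] at h1
    obtain ⟨i, rfl⟩ : ∃ i', i = i' + 1 := Nat.exists_eq_succ_of_ne_zero h1
    obtain ⟨k, hk, e1, e2, e3⟩ := h.lock_true hv h2
    rw [h.pid, e1, val_ident hv] at h3
    subst h3
    simp only [ne_eq] at h4
    rw [h.eq_nh_iff hv hk, h.oneP_iff hv hw e3, e2, Cfg.content_succ] at h4
    generalize (M.cfg w (i + 1)).tape.getD j false = c at h4
    split_ifs at h4 with hd <;> cases c <;> simp only [hd] at h4 <;> simp at h4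

/-- The value after the separator matters only if the checks go on, since the rest of the trace is
arbitrary after a stop; hence the conditional hypothesis on `b`. -/
theorem Inv.not_err_hash (hv : Set.InjOn v M.symbols) (hM : M.Valid) (hw : w ≠ []) {i : ℕ}
    {R : Reg D} (h : Inv M v w i (M.len w i) R) {b : D} (hb : ¬ M.StopsAfter anySt w i →
      b = v ((M.cfg w (i + 1)).content 0)) : ¬ ErrP M anySt v R (v (ident 0)) b := by
  have hh := DTM.head_lt (M := M) hw i
  change ¬ ErrP M anySt v R (v Symb.hash) b
  rintro (⟨h1, -⟩ | ⟨-, -, h1, h2⟩ | ⟨h1, h2⟩ | ⟨-, -, h1⟩ | ⟨-, h1, -⟩ | ⟨-, -, -, h1⟩ |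
    ⟨h1, -, h2, -⟩ | ⟨h1, h2, h3, -⟩)
  · exact h.ph_ne hv h1
  · rw [h.stopP_iff hv hM] at h1
    refine h2 ?_
    rw [hb fun h => h1 ⟨rfl, h⟩, h.nst hh, Cfg.content, DTM.state_succ]
  · obtain ⟨k, hk, e⟩ := h.lock_false hv h1
    rw [e, val_hash_ident hv] at h2
    omega
  · rw [h.pid, val_ident_hash hv] at h1
    omega
  · exact h1 rfl
  · exact h1 rfl
  · rw [h.ph_true hv] at h1
    obtain ⟨i, rfl⟩ : ∃ i', i = i' + 1 := Nat.exists_eq_succ_of_ne_zero h1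
    rw [h.nh i rfl, val_ident_hash hv, if_pos (by omega)] at h2
    omega
  · rw [h.ph_true hv] at h1
    obtain ⟨i, rfl⟩ : ∃ i', i = i' + 1 := Nat.exists_eq_succ_of_ne_zero h1
    obtain ⟨k, hk, e1, -⟩ := h.lock_true hv h2
    rw [h.pid, e1, val_ident hv] at h3
    have := DTM.len_le_succ (M := M) (w := w) i
    omega

/-- On the encoding of a run, paths do not meet errors before they stop. -/
theorem not_err_of_encodes (hv : Set.InjOn v M.symbols) (hM : M.Valid) (hw : w ≠ [])
    {u : ℕ → D × D} {R₀ : Reg D} (hph : R₀.ph = v Symb.hash) (hlk : R₀.lk = v Symb.hash)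
    (hu : ∀ m, (∀ i < (M.pos w m).1, ¬ M.StopsAfter anySt w i) →
      u m = (v (M.item w m).1, v (M.item w m).2))
    (hu' : ∀ i, (∀ i' < i, ¬ M.StopsAfter anySt w i') → (u (M.start w (i + 1))).1 = v Symb.hash)
    {m : ℕ} {R : Reg D} (hR : RPath M anySt v u R₀ m R) :
    (∀ m', m' + 1 = m → ∀ i < (M.pos w m').1, ¬ M.StopsAfter anySt w i) ∧
      ¬ ErrP M anySt v R (u m).1 (u m).2 := by
  have key : ∀ m, (∀ i < (M.pos w m).1, ¬ M.StopsAfter anySt w i) → Matches M v w u m := by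
    intro m hm m' hm'
    refine hu m' fun i hi => hm i (lt_of_lt_of_le hi ?_)
    rw [DTM.pos_fst_le_iff]
    exact lt_of_le_of_lt hm' ((M.pos_fst_le_iff w m _).1 le_rfl)
  induction hR with
  | zero =>
    refine ⟨fun m' h => by omega, ?_⟩
    rw [hu 0 (by simp [DTM.pos])]
    rintro (⟨-, h1⟩ | ⟨h1, -⟩ | ⟨h1, -⟩ | ⟨h1, -⟩ | ⟨h1, -⟩ | ⟨h1, -⟩ | ⟨h1, -⟩ | ⟨h1, -⟩)
    · exact h1 ⟨rfl, rfl⟩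
    · exact h1 hph
    · rw [hlk, val_hash_bit hv] at h1; exact h1
    all_goals rw [hph, val_hash_bit hv] at h1; exact h1
  | @succ m R R' hR hs ih =>
    -- The transition on this pair exists, so it is not the separator at which the checks stop; the
    -- path has not gone past a stopping block.
    have hal : ∀ i < (M.pos w m).1, ¬ M.StopsAfter anySt w i := by
      cases m with
      | zero => simp [DTM.pos]
      | succ m =>
        have ih1 := ih.1 m rfl
        have hI := RPath.inv hv hM hw hph hlk (key m ih1) hR
        obtain ⟨⟨i, j⟩, hp⟩ : ∃ p, M.pos w m = p := ⟨_, rfl⟩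
        rw [hp] at ih1
        simp only [hp] at hI
        rcases M.pos_succ_cases w m hp with ⟨-, hp'⟩ | ⟨rfl, hp'⟩
        · rw [hp']; exact ih1
        · rw [hp']
          intro i' hi'
          rcases Nat.lt_succ_iff_lt_or_eq.1 hi' with hi' | rfl
          · exact ih1 i' hi'
          · intro hst
            refine hs.1 ((hI.stopP_iff hv hM).2 ⟨?_, hst⟩)
            have e : m + 1 = M.start w (i' + 1) := by
              have := (M.pos_le w m).2
              rw [hp] at this
              rw [DTM.start]
              simp only at this
              omega
            rw [e]
            exact hu' i' ih1
    refine ⟨fun m' h => by obtain rfl : m' = m := by omega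
                           exact hal, ?_⟩
    have hI := RPath.inv hv hM hw hph hlk (key m hal) (RPath.succ hR hs)
    obtain ⟨⟨i, j⟩, hp⟩ : ∃ p, M.pos w m = p := ⟨_, rfl⟩
    rw [hp] at hal
    simp only [hp] at hI
    rcases M.pos_succ_cases w m hp with ⟨hj, hp'⟩ | ⟨rfl, hp'⟩
    · rw [hu (m + 1) (by rw [hp']; exact hal)]
      simp only [DTM.item, hp']
      exact hI.not_err_cell hv hw hj
    · have e : m + 1 = M.start w (i + 1) := by
        have := (M.pos_le w m).2
        rw [hp] at this
        rw [DTM.start]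
        simp only at this
        omega
      have h1 : (u (m + 1)).1 = v (ident 0) := by
        rw [e]
        exact hu' i hal
      rw [h1]
      refine hI.not_err_hash hv hM hw fun hst => ?_
      rw [hu (m + 1)]
      · simp only [DTM.item, hp']
      · rw [hp']
        intro i' hi'
        rcases Nat.lt_succ_iff_lt_or_eq.1 hi' with hi' | rfl
        · exact hal i' hi'
        · exact hst

/-! ### Encodings from the absence of errors -/

/-- The first block, of which it is known where it ends and which bits it contains. -/
structure FirstBlock (K : Symb → D) (w : List Bool) (u : ℕ → D × D) : Prop where
  ne : ∀ k < w.length, (u (k + 1)).1 ≠ K Symb.hash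
  bits : ∀ k < w.length, ∀ c, (u (k + 1)).2 = K (Symb.bit c) ∨ (u (k + 1)).2 = K (Symb.head c) →
    c = w.getD k false
  last : (u (w.length + 1)).1 = K Symb.hash

theorem FirstBlock.congr {u : ℕ → D × D} (h : ∀ s, M.IsConst s → K s = v s)
    (hF : FirstBlock K w u) : FirstBlock v w u where
  ne k hk := by rw [← h Symb.hash trivial]; exact hF.ne k hk
  bits k hk c := by
    rw [← h (Symb.bit c) trivial, ← h (Symb.head c) trivial]; exact hF.bits k hk c
  last := by rw [← h Symb.hash trivial]; exact hF.last

theorem content_isConst (hM : M.Valid) (i j : ℕ) : M.IsConst ((M.cfg w i).content j) := by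
  cases j with
  | zero => exact DTM.state_lt hM i
  | succ j => rw [Cfg.content_succ]; split_ifs <;> trivial

/-- Without errors, the content of the next cell is right, and its identifier is right or new. -/
theorem cell_of_not_err (hv : Set.InjOn v M.symbols) (hM : M.Valid) (hw : w ≠ [])
    {u : ℕ → D × D} {R₀ : Reg D} (hph : R₀.ph = v Symb.hash) (hlk : R₀.lk = v Symb.hash)
    (hF : FirstBlock v w u)
    (hE : ∀ m R, RPath M anySt v u R₀ m R → ¬ ErrP M anySt v R (u m).1 (u m).2)
    {m i j : ℕ} (hu : Matches M v w u m) (hp : M.pos w m = (i, j)) (hj : j < M.len w i)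
    (hs : ∀ i' < i, ¬ M.StopsAfter anySt w i') :
    (u (m + 1)).2 = v ((M.cfg w i).content (j + 1)) ∧
      ((u (m + 1)).1 = v (ident (j + 1)) ∨
        (¬ ConstP M v (u (m + 1)).1 ∧ (∀ k < j, (u (m + 1)).1 ≠ v (ident (k + 1))) ∧
          ∀ i' < i, M.len w i' ≤ j)) := by
  obtain ⟨⟨R, hR, -⟩, h2, h3⟩ := exists_rpath hv hM hw hph hlk hu hp hs
  have hI : ∀ R, RPath M anySt v u R₀ (m + 1) R → Inv M v w i j R := by
    intro R hR
    simpa only [hp] using RPath.inv hv hM hw hph hlk hu hR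
  -- The path that has locked cell `k` makes a repetition of its identifier an error.
  have hdup : ∀ k < j, (u (m + 1)).1 ≠ v (ident (k + 1)) := by
    intro k hk e
    obtain ⟨R, hR, e1, -, e2, -⟩ := h2 k hk
    exact hE _ R hR (Or.inr (Or.inr (Or.inl ⟨e1, e.trans e2.symm⟩)))
  have hER := hE _ R hR
  simp only [ErrP, not_or] at hER
  cases i with
  | zero =>
    obtain rfl : m = j := by
      have := (M.pos_le w m).2
      rw [hp] at this
      simpa [DTM.start] using this
    have h5 := hER.2.2.2.2.1
    have hne := hF.ne m hj
    simp only [(hI R hR).ph_zero rfl, hne, ne_eq, not_false_eq_true, true_and, not_or,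
      (hI R hR).pid, val_ident_hash hv] at h5
    refine ⟨?_, Or.inr ⟨h5.1, hdup, fun i' hi' => absurd hi' (Nat.not_lt_zero _)⟩⟩
    have hhead : (M.cfg w 0).head = 0 := rfl
    have htape : (M.cfg w 0).tape = w := rfl
    rw [Cfg.content_succ, hhead, htape]
    split_ifs with h0
    · have : HeadP v (u (m + 1)).2 := by
        by_contra h; exact h5.2.1 ⟨h0, h⟩
      rcases this with h | h <;> rw [h, ← hF.bits m hj _ (Or.inr h)]
    · have : (u (m + 1)).2 = v (Symb.bit false) ∨ (u (m + 1)).2 = v (Symb.bit true) := by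
        by_contra h; exact h5.2.2 ⟨h0, not_or.1 h⟩
      rcases this with h | h <;> rw [h, ← hF.bits m hj _ (Or.inl h)]
  | succ i =>
    rcases Nat.lt_or_ge j (M.len w i) with hlt | hge
    -- The path that locked this cell in the previous block makes its comparison at this pair.
    · obtain ⟨R, hR, e1, e2, e3, e4⟩ := h3 i rfl j hlt
      have h := hI R hR
      have hER := hE _ R hR
      simp only [ErrP, not_or] at hER
      have h8 := hER.2.2.2.2.2.2.2
      simp only [h.ph_succ (Nat.succ_ne_zero i), e1, h.pid, e2, true_and, not_or, e3,
        not_not, ne_eq] at h8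
      obtain ⟨ha, h8⟩ := h8
      rw [ha, h.eq_nh_iff hv hlt, h.oneP_iff hv hw e4] at h8
      refine ⟨?_, Or.inl ha⟩
      rw [Cfg.content_succ]
      generalize (M.cfg w (i + 1)).tape.getD j false = c at h8
      by_cases hd : j = (M.cfg w (i + 1)).head <;> cases c <;> simpa [hd] using h8
    · have h := hI R hR
      obtain ⟨e1, e2⟩ := DTM.ext_cell hw hj hge
      have h7 := hER.2.2.2.2.2.2.1
      have hnh : R.nh = v Symb.hash := by
        rw [h.nh i rfl, if_neg (by omega)]; rfl
      simp only [h.ph_succ (Nat.succ_ne_zero i), (h.pid_eq_lst hv).2 hge, hnh, true_and, not_or,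
        ne_eq, not_not] at h7
      refine ⟨by rw [Inv.content_ext hw hj hge]; exact h7.2, Or.inr ⟨h7.1, hdup, fun i' hi' => ?_⟩⟩
      exact le_trans (DTM.len_mono (Nat.lt_succ_iff.1 hi')) hge

/-- The first block ends by `FirstBlock`. A later block ends because the previous cells have been
repeated, with a new one if needed, and the head has its place. -/
theorem hash_of_not_err (hv : Set.InjOn v M.symbols) (hM : M.Valid) (hw : w ≠ [])
    {u : ℕ → D × D} {R₀ : Reg D} (hph : R₀.ph = v Symb.hash) (hlk : R₀.lk = v Symb.hash)
    (hF : FirstBlock v w u)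
    (hE : ∀ m R, RPath M anySt v u R₀ m R → ¬ ErrP M anySt v R (u m).1 (u m).2)
    {m i : ℕ} (hu : Matches M v w u m) (hp : M.pos w m = (i, M.len w i))
    (hs : ∀ i' < i, ¬ M.StopsAfter anySt w i') :
    (u (m + 1)).1 = v Symb.hash ∧ (¬ M.StopsAfter anySt w i →
      (u (m + 1)).2 = v ((M.cfg w (i + 1)).content 0)) := by
  obtain ⟨⟨R, hR, -⟩, -⟩ := exists_rpath hv hM hw hph hlk hu hp hs
  have h : Inv M v w i (M.len w i) R := by
    simpa only [hp] using RPath.inv hv hM hw hph hlk hu hR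
  have hER := hE _ R hR
  have hh := DTM.head_lt (M := M) hw i
  simp only [ErrP, not_or] at hER
  have ha : (u (m + 1)).1 = v Symb.hash := by
    cases i with
    | zero =>
      have := (M.pos_le w m).2
      rw [hp] at this
      have e : m = w.length := by
        simp only [DTM.start, Nat.zero_add] at this
        exact this
      rw [e]
      exact hF.last
    | succ i =>
      have h6 := hER.2.2.2.2.2.1
      by_contra ha
      refine h6 ⟨h.ph_succ (Nat.succ_ne_zero i), (h.pid_eq_lst hv).2 (DTM.len_le_succ i), ?_, ha⟩
      rw [h.nh i rfl, Ne, val_ident_hash hv, if_pos (by omega)]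
      omega
  refine ⟨ha, fun hst => ?_⟩
  have h2 := hER.2.1
  simp only [h.ph_ne hv, ha, h.stopP_iff hv hM, hst, h.nst hh, ne_eq, not_false_eq_true, true_and,
    and_false, not_not] at h2
  rw [h2, Cfg.content, DTM.state_succ]

/-- Induction on the pairs, with a valuation that is revised on the way. When a new cell appears,
its value may differ from the one held in reserve for its symbol, and may even be in reserve for
another unused symbol. Composing the valuation with the transposition of the two values repairs
this, keeps injectivity, and leaves all that has been read unchanged. -/
theorem exists_val_of_not_err (hM : M.Valid) (hw : w ≠ []) {v₀ : Symb → D}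
    (hv₀ : Set.InjOn v₀ M.symbols) {u : ℕ → D × D} {R₀ : Reg D} (hph : R₀.ph = v₀ Symb.hash)
    (hlk : R₀.lk = v₀ Symb.hash) (hF : FirstBlock v₀ w u)
    (hE : ∀ m R, RPath M anySt v₀ u R₀ m R → ¬ ErrP M anySt v₀ R (u m).1 (u m).2) (m : ℕ)
    (hs : ∀ i < (M.pos w m).1, ¬ M.StopsAfter anySt w i) :
    ∃ v : Symb → D, Set.InjOn v M.symbols ∧ (∀ s, M.IsConst s → v₀ s = v s) ∧
      Matches M v w u m := by
  classical
  induction m with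
  | zero =>
    refine ⟨v₀, hv₀, fun _ _ => rfl, fun m' hm' => ?_⟩
    obtain rfl : m' = 0 := by omega
    have := hE 0 R₀ RPath.zero
    simp only [ErrP, not_or] at this
    have h1 := this.1
    simp only [hph, true_and, not_not] at h1
    exact Prod.ext h1.1 h1.2
  | succ m ih =>
    obtain ⟨⟨i, j⟩, hp⟩ : ∃ p, M.pos w m = p := ⟨_, rfl⟩
    have hs' : ∀ i' < i, ¬ M.StopsAfter anySt w i' := by
      rcases M.pos_succ_cases w m hp with ⟨-, hp'⟩ | ⟨-, hp'⟩ <;> rw [hp'] at hs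
      · exact hs
      · exact fun i' hi' => hs i' (by simp only; omega)
    obtain ⟨v, hv, hc, hu⟩ := ih (by rw [hp]; exact hs')
    have hph' : R₀.ph = v Symb.hash := by rw [hph, hc Symb.hash trivial]
    have hlk' : R₀.lk = v Symb.hash := by rw [hlk, hc Symb.hash trivial]
    have hF' := hF.congr hc
    have hE' : ∀ m R, RPath M anySt v u R₀ m R → ¬ ErrP M anySt v R (u m).1 (u m).2 := by
      intro m R hR
      rw [← ErrP.congr hM hc]
      exact hE m R (hR.congr hM fun s h => (hc s h).symm)
    rcases M.pos_succ_cases w m hp with ⟨hj, hp'⟩ | ⟨rfl, hp'⟩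
    · obtain ⟨hb, ha | ⟨ha1, ha2, ha3⟩⟩ :=
        cell_of_not_err hv hM hw hph' hlk' hF' hE' hu hp hj hs'
      · refine ⟨v, hv, hc, fun m' hm' => ?_⟩
        rcases Nat.le_succ_iff.1 hm' with hm' | rfl
        · exact hu m' hm'
        · simp only [DTM.item, hp']
          exact Prod.ext ha hb
      · set a := (u (m + 1)).1 with hadef
        set σ := Equiv.swap a (v (ident (j + 1))) with hσ
        have hfix : ∀ s ∈ M.symbols, s ≠ ident (j + 1) → v s ≠ a → σ (v s) = v s := by
          intro s hs h1 h2
          refine Equiv.swap_apply_of_ne_of_ne h2 fun h => h1 ?_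
          exact hv hs (ident_mem M _) h
        have hfixc : ∀ s, M.IsConst s → σ (v s) = v s := by
          intro s hs
          refine hfix s (isConst_mem hs) ?_ fun h => ha1 ⟨s, hs, h.symm⟩
          rintro rfl
          exact hs
        refine ⟨fun s => σ (v s), fun s hs s' hs' e => hv hs hs' (σ.injective e),
          fun s hs => (hc s hs).trans (hfixc s hs).symm, fun m' hm' => ?_⟩
        rcases Nat.le_succ_iff.1 hm' with hm' | rfl
        · rw [hu m' hm']
          -- The new symbol has not occurred yet: no earlier pair has a position beyond `j`, neither
          -- in this block nor in a shorter one before it.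
          have hle : (M.pos w m').2 ≤ j := by
            obtain ⟨⟨i', j'⟩, hq⟩ : ∃ p, M.pos w m' = p := ⟨_, rfl⟩
            have h1 : i' ≤ i := by
              have := (M.pos_fst_le_iff w m' i).2
                (lt_of_le_of_lt hm' ((M.pos_fst_le_iff w m i).1 (by rw [hp])))
              rwa [hq] at this
            have h2 := M.pos_le w m'
            have h3 := M.pos_le w m
            rw [hq] at h2 ⊢
            rw [hp] at h3
            simp only at h2 h3 ⊢
            rcases Nat.lt_or_ge i' i with h | h
            · exact h2.1.trans (ha3 i' h)
            · obtain rfl : i' = i := by omega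
              omega
          refine Prod.ext ?_ (hfixc _ (content_isConst hM _ _)).symm
          simp only [DTM.item]
          refine (hfix _ (ident_mem M _) ?_ ?_).symm
          · rw [Ne, ident_injective.eq_iff]; omega
          · obtain ⟨k, hk⟩ : ∃ k, (M.pos w m').2 = k := ⟨_, rfl⟩
            rw [hk]
            rw [hk] at hle
            cases k with
            | zero => exact fun h => ha1 ⟨Symb.hash, trivial, h.symm⟩
            | succ k => exact fun h => ha2 k (by omega) h.symm
        · simp only [DTM.item, hp']
          refine Prod.ext ?_ ?_
          · simp [hσ, hadef]
          · rw [hfixc _ (content_isConst hM _ _)]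
            exact hb
    · have hh := hash_of_not_err hv hM hw hph' hlk' hF' hE' hu hp hs'
      refine ⟨v, hv, hc, fun m' hm' => ?_⟩
      rcases Nat.le_succ_iff.1 hm' with hm' | rfl
      · exact hu m' hm'
      · simp only [DTM.item, hp']
        refine Prod.ext hh.1 (hh.2 ?_)
        rw [hp'] at hs
        exact hs i (Nat.lt_succ_self i)

end


/-! ### The formulae -/

/-- The variables for the symbols of the initial block after the separator. -/
def restVars (M : DTM) : List ℕ := (List.range M.table.length).map (38 + ·) ++ [34, 35, 36, 37]

/-- Read the separator, and initialise the phase and the lock. -/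
def startGuard : BExp := conj [eqs 33, eqv 17 33, eqv 29 33]

/-- The formula of the automaton that checks encodings of runs. -/
def autom (d g : Bool) (X : ℕ) (anySt : Bool) (M : DTM) : Formula :=
  quants d (33 :: List.range' 17 16) (modal d startGuard (reads d (restVars M)
    (fixp g X (loopBody d X (errB anySt M) (transB anySt M)))))

/-- The current action satisfies `b`, and the rest of the trace satisfies `φ`. -/
def chk (b : BExp) (φ : Formula) : Formula :=
  Formula.and (Formula.nec (BExp.neg b) Formula.ff) (Formula.nec BExp.tru φ)

/-- The cells without head of an input. -/
def chkBits (r : List Bool) (φ : Formula) : Formula :=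
  r.foldr (fun c φ => chk (BExp.neg (eqs 33)) (chk (eqs (bif c then 35 else 34)) φ)) φ

/-- The trace starts with an encoding of the initial configuration on input `w`, except that
the identifiers of the cells may coincide. -/
def inputForm (M : DTM) (w : List Bool) : Formula :=
  reads false (33 :: restVars M) (chk (eqs 33) (chk (eqs 38) (chk (BExp.neg (eqs 33))
    (chk (eqs (bif w.headI then 37 else 36)) (chkBits w.tail (chk (eqs 33)
      (Formula.nec (BExp.neg BExp.tru) Formula.ff)))))))

/-- The formula for the run on input `w`. -/
def runForm (M : DTM) (w : List Bool) : Formula :=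
  Formula.and (autom false true 0 false M) (inputForm M w)

/-- The formula for prefixes of runs that do not encode a terminating run. -/
def nonTermForm (M : DTM) : Formula :=
  Formula.and (autom false false 0 true M) (autom true true 1 false M)

section
variable {D : Type*} {M : DTM} {w : List Bool} {anySt : Bool}

theorem prelude_map_toVar (M : DTM) : M.prelude.map Symb.toVar = 33 :: restVars M := by
  simp only [DTM.prelude, restVars, List.map_cons, List.map_append, List.map_map, List.cons_append,
    List.map_nil, Symb.toVar]
  rfl

theorem restVars_nodup (M : DTM) : (restVars M).Nodup := by
  rw [restVars, List.nodup_append]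
  refine ⟨List.nodup_range.map fun a b h => by simpa using h, by simp, ?_⟩
  intro a ha b hb
  simp only [List.mem_map, List.mem_range] at ha
  obtain ⟨i, -, rfl⟩ := ha
  simp only [List.mem_cons, List.not_mem_nil, or_false] at hb
  omega

theorem mem_restVars {M : DTM} {y : ℕ} (h : y ∈ restVars M) : 34 ≤ y := by
  simp only [restVars, List.mem_append, List.mem_map, List.mem_range, List.mem_cons,
    List.not_mem_nil, or_false] at h
  rcases h with ⟨i, -, rfl⟩ | h <;> omega

theorem vars_nodup (M : DTM) : (33 :: restVars M).Nodup :=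
  List.nodup_cons.2 ⟨fun h => by have := mem_restVars h; omega, restVars_nodup M⟩

theorem take_eq_iff {t : Trace D} {l : List D} :
    t.take l.length = l ↔ ∀ i (h : i < l.length), l[i] = t i := by
  constructor
  · intro h i hi
    have := congrArg (fun l => l[i]?) h
    simp only [Trace.take, List.getElem?_map, List.getElem?_range hi, Option.map_some,
      List.getElem?_eq_getElem hi, Option.some.injEq] at this
    exact this.symm
  · intro h
    refine List.ext_getElem (by simp [Trace.take]) fun i h1 h2 => ?_
    simp [Trace.take, h i h2]

theorem take_prelude_iff {t : Trace D} {δ : DEnv D} :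
    t.take M.prelude.length = M.prelude.map (symVal δ) ↔
      ∀ i (h : i < (33 :: restVars M).length), δ (33 :: restVars M)[i] = t i := by
  have e : M.prelude.map (symVal δ) = (33 :: restVars M).map δ := by
    rw [← prelude_map_toVar, List.map_map]; rfl
  have e' : M.prelude.length = ((33 :: restVars M).map δ).length := by
    rw [← prelude_map_toVar]; simp
  rw [e, e', take_eq_iff]
  simp only [List.getElem_map, List.length_map]

theorem prelude_length (M : DTM) : M.prelude.length = (restVars M).length + 1 := by
  rw [← List.length_map (f := Symb.toVar), prelude_map_toVar]; rfl

theorem startGuard_holds {δ : DEnv D} {c : D} :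
    startGuard.Holds δ c ↔ c = δ 33 ∧ δ 17 = δ 33 ∧ δ 29 = δ 33 := by
  simp [startGuard, conj_holds]

/-- The guard initialises only the phase and the lock. The other registers start with arbitrary
values, which the first transition overwrites or `Inv` ignores. -/
theorem mem_autom {g : Bool} {X : ℕ} {t : Trace D} {ρ : TEnv D} {δ : DEnv D} :
    t ∈ (autom false g X anySt M).sem ρ δ ↔
      ∀ δ' : DEnv D, (∀ y < 17, δ' y = δ y) → (∀ y ≥ 33, y ∉ 33 :: restVars M → δ' y = δ y) →
        t.take M.prelude.length = M.prelude.map (symVal δ') → δ' 17 = δ' 33 → δ' 29 = δ' 33 →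
        t.drop M.prelude.length ∈
          (fixp g X (loopBody false X (errB anySt M) (transB anySt M))).sem ρ δ' := by
  rw [autom, mem_quants]
  change (∀ δ', _ → (startGuard.Holds δ' (t 0) → t.tail ∈ (reads false (restVars M) _).sem ρ δ'))
    ↔ _
  simp only [startGuard_holds, mem_reads (restVars_nodup M), Trace.tail_drop, prelude_length]
  constructor
  · intro h δ' h1 h2 h3 h4 h5
    rw [← prelude_length, take_prelude_iff] at h3
    -- The environment between the two quantifier blocks: the variables that are yet to be read keep
    -- their old values.
    refine h (fun y => if y ∈ restVars M then δ y else δ' y) (fun y hy => ?_) ?_ δ'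
      (fun y hy => ?_) fun i hi => ?_
    · simp only [List.mem_cons, List.mem_range'_1, not_or] at hy
      split_ifs with h
      · rfl
      · rcases Nat.lt_or_ge y 17 with h' | h'
        · exact h1 y h'
        · exact h2 y (by omega) (by simp [h, hy.1])
    · have h33 : 33 ∉ restVars M := fun h => by have := mem_restVars h; omega
      have h17 : 17 ∉ restVars M := fun h => by have := mem_restVars h; omega
      have h29 : 29 ∉ restVars M := fun h => by have := mem_restVars h; omega
      simp only [h33, h17, h29, if_false]
      exact ⟨(h3 0 (by simp)).symm, h4, h5⟩
    · simp [hy]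
    · exact h3 (i + 1) (by simpa using hi)
  · intro h δ₁ h1 h2 δ' h3 h4
    have h33 : 33 ∉ restVars M := fun h => by have := mem_restVars h; omega
    have h17 : 17 ∉ restVars M := fun h => by have := mem_restVars h; omega
    have h29 : 29 ∉ restVars M := fun h => by have := mem_restVars h; omega
    refine h δ' (fun y hy => ?_) (fun y hy hy' => ?_) ?_ ?_ ?_
    · rw [h3 y fun h => by have := mem_restVars h; omega]
      refine h1 y fun h => ?_
      simp only [List.mem_cons, List.mem_range'_1] at h
      omega
    · simp only [List.mem_cons, not_or] at hy'
      rw [h3 y hy'.2]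
      refine h1 y fun h => ?_
      simp only [List.mem_cons, List.mem_range'_1] at h
      omega
    · rw [← prelude_length, take_prelude_iff]
      intro i hi
      cases i with
      | zero => exact (h3 33 h33).trans h2.1.symm
      | succ i => exact h4 i (by simpa using hi)
    · rw [h3 17 h17, h3 33 h33, h2.2.1]
    · rw [h3 29 h29, h3 33 h33, h2.2.2]

/-- The register file in which the automaton starts exists. -/
theorem exists_env_of_mem_autom {g : Bool} {X : ℕ} {t : Trace D} {ρ : TEnv D} {δ : DEnv D}
    (h : t ∈ (autom false g X anySt M).sem ρ δ) :
    ∃ δ' : DEnv D, t.take M.prelude.length = M.prelude.map (symVal δ') ∧ δ' 17 = δ' 33 ∧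
      δ' 29 = δ' 33 ∧ t.drop M.prelude.length ∈
          (fixp g X (loopBody false X (errB anySt M) (transB anySt M))).sem ρ δ' := by
  classical
  rw [mem_autom] at h
  have hn := vars_nodup M
  -- All registers receive the separator, which is what the phase and the lock require.
  let δ' : DEnv D := fun y => if y ∈ 33 :: restVars M then t ((33 :: restVars M).idxOf y) else
    if 17 ≤ y ∧ y < 33 then t 0 else δ y
  have h33 : δ' 33 = t 0 := by simp [δ']
  have h1 : ∀ y, 17 ≤ y → y < 33 → δ' y = t 0 := by
    intro y h1 h2
    have : y ∉ 33 :: restVars M := by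
      simp only [List.mem_cons, not_or]
      exact ⟨by omega, fun h => by have := mem_restVars h; omega⟩
    simp only [δ', if_neg this, if_pos (And.intro h1 h2)]
  have h2 : t.take M.prelude.length = M.prelude.map (symVal δ') := by
    rw [take_prelude_iff]
    intro i hi
    simp only [δ', List.getElem_mem, if_true]
    rw [hn.idxOf_getElem]
  refine ⟨δ', h2, by rw [h33, h1] <;> omega, by rw [h33, h1] <;> omega, h δ' (fun y hy => ?_)
    (fun y hy hy' => ?_) h2 (by rw [h33, h1] <;> omega) (by rw [h33, h1] <;> omega)⟩
  · have : y ∉ 33 :: restVars M := by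
      simp only [List.mem_cons, not_or]
      exact ⟨by omega, fun h => by have := mem_restVars h; omega⟩
    simp only [δ', if_neg this, if_neg (show ¬ (17 ≤ y ∧ y < 33) by omega)]
  · simp only [δ', if_neg hy', if_neg (show ¬ (17 ≤ y ∧ y < 33) by omega)]

theorem mem_autom_of_forall {g : Bool} {X : ℕ} {t : Trace D} {ρ : TEnv D} {δ : DEnv D}
    (h : ∀ δ' : DEnv D, t.take M.prelude.length = M.prelude.map (symVal δ') → δ' 17 = δ' 33 →
      δ' 29 = δ' 33 → t.drop M.prelude.length ∈
          (fixp g X (loopBody false X (errB anySt M) (transB anySt M))).sem ρ δ') :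
    t ∈ (autom false g X anySt M).sem ρ δ :=
  mem_autom.2 fun δ' _ _ h1 h2 h3 => h δ' h1 h2 h3

theorem mem_prelude {s : Symb} : s ∈ M.prelude ↔ M.IsConst s := by
  rcases s with _ | p | b | b | k
  · simp [DTM.prelude, DTM.IsConst]
  · simp [DTM.prelude, DTM.IsConst]
  · cases b <;> simp [DTM.prelude, DTM.IsConst]
  · cases b <;> simp [DTM.prelude, DTM.IsConst]
  · simp [DTM.prelude, DTM.IsConst]

theorem prelude_congr {K v : Symb → D} (h : M.prelude.map K = M.prelude.map v) {s : Symb}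
    (hs : M.IsConst s) : K s = v s :=
  List.map_inj_left.1 h s (mem_prelude.2 hs)

/-! ### From encodings to the automaton -/

/-- The separator that closes the shorter word opens the next block of the longer one. -/
theorem DTM.EncodesUpTo.mono {v : Symb → D} {n n' : ℕ} {t : Trace D}
    (h : M.EncodesUpTo v w n' t) (hn : n ≤ n') : M.EncodesUpTo v w n t := by
  rw [DTM.encodesUpTo_iff] at h ⊢
  obtain ⟨h1, h2, h3⟩ := h
  refine ⟨h1, fun m hm => h2 m (lt_of_lt_of_le hm ?_), ?_⟩
  · exact (M.start_strictMono w).monotone (by omega)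
  · rcases Nat.lt_or_eq_of_le hn with hlt | rfl
    · rw [h2 _ (M.start_strictMono w (by omega))]
      have := M.pos_start_add w (n + 1) 0 (Nat.zero_le _)
      rw [Nat.add_zero] at this
      simp only [DTM.item, this, ident]
    · exact h3

/-- The second conclusion, that paths do not outlive the end of a stopping block, provides the bound
needed for least fixed points. -/
theorem rpath_of_encodes {v : Symb → D} (hv : Set.InjOn v M.symbols) (hM : M.Valid) (hw : w ≠ [])
    {t : Trace D} (h : ∀ n, (∀ i < n, ¬ M.StopsAfter anySt w i) → M.EncodesUpTo v w n t)
    {δ : DEnv D} (h1 : t.take M.prelude.length = M.prelude.map (symVal δ)) (h2 : δ 17 = δ 33)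
    (h3 : δ 29 = δ 33) :
    NoError (errB anySt M) (transB anySt M) (t.drop M.prelude.length) δ ∧
    ∀ m δ', Path (transB anySt M) (t.drop M.prelude.length) δ m δ' →
      ∀ m', m' + 1 = m → ∀ i < (M.pos w m').1, ¬ M.StopsAfter anySt w i := by
  have hK : ∀ s, M.IsConst s → symVal δ s = v s := fun s hs =>
    prelude_congr (h1.symm.trans ((M.encodesUpTo_iff v w 0 t).1 (h 0 (by simp))).1) hs
  have hu : ∀ m, (∀ i < (M.pos w m).1, ¬ M.StopsAfter anySt w i) →
      pairsOf (t.drop M.prelude.length) m = (v (M.item w m).1, v (M.item w m).2) := fun m hm =>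
    ((M.encodesUpTo_iff v w _ t).1 (h _ hm)).2.1 m ((M.pos_fst_le_iff w m _).1 le_rfl)
  have hu' : ∀ i, (∀ i' < i, ¬ M.StopsAfter anySt w i') →
      (pairsOf (t.drop M.prelude.length) (M.start w (i + 1))).1 = v Symb.hash := fun i hi =>
    ((M.encodesUpTo_iff v w _ t).1 (h _ hi)).2.2
  have key : ∀ m R, RPath M anySt (symVal δ) (pairsOf (t.drop M.prelude.length)) (regAt δ 17) m R →
      _ := fun m R hR => not_err_of_encodes (anySt := anySt) hv hM hw
        (h2.trans (hK Symb.hash trivial)) (h3.trans (hK Symb.hash trivial)) hu hu'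
        (hR.congr hM hK)
  refine ⟨noError_iff_rpath.2 ⟨?_, fun m R hR => ?_⟩, fun m δ' hp => (key m _ (rpath_of_path hp).2).1⟩
  · intro s hs s' hs' e
    rw [hK s hs, hK s' hs'] at e
    exact hv (isConst_mem hs) (isConst_mem hs') e
  · rw [ErrP.congr hM hK]
    exact (key m R hR).2

theorem mem_autom_gfp_of_encodes {v : Symb → D} (hv : Set.InjOn v M.symbols) (hM : M.Valid)
    (hw : w ≠ []) {X : ℕ} {t : Trace D} {ρ : TEnv D} {δ : DEnv D}
    (h : ∀ n, (∀ i < n, ¬ M.StopsAfter anySt w i) → M.EncodesUpTo v w n t) :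
    t ∈ (autom false true X anySt M).sem ρ δ :=
  mem_autom_of_forall fun _ h1 h2 h3 => mem_gfp_loop.2 (rpath_of_encodes hv hM hw h h1 h2 h3).1

theorem mem_autom_lfp_of_encodes {v : Symb → D} (hv : Set.InjOn v M.symbols) (hM : M.Valid)
    (hw : w ≠ []) {X : ℕ} {t : Trace D} {ρ : TEnv D} {δ : DEnv D} {n : ℕ}
    (hn : M.StopsAfter anySt w n) (h : M.EncodesUpTo v w n t) :
    t ∈ (autom false false X anySt M).sem ρ δ := by
  refine mem_autom_of_forall fun δ' h1 h2 h3 => ?_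
  have hle : ∀ n', (∀ i < n', ¬ M.StopsAfter anySt w i) → n' ≤ n := fun n' hn' => by
    by_contra hlt
    exact hn' n (by omega) hn
  obtain ⟨g1, g2⟩ := rpath_of_encodes hv hM hw (fun n' hn' => h.mono (hle n' hn')) h1 h2 h3
  -- The pair with index `M.start w (n + 1)` begins with the separator after block `n`, and no path
  -- gets beyond it.
  refine mem_lfp_loop_of_bound (M.start w (n + 1) + 1) (fun δ'' hp => ?_) g1
  refine g2 _ _ hp _ rfl n ?_ hn
  have := M.pos_start_add w (n + 1) 0 (Nat.zero_le _)
  rw [Nat.add_zero] at this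
  rw [this]
  exact Nat.lt_succ_self n

/-! ### From the automaton to encodings -/

theorem encodesUpTo_of_noError (hM : M.Valid) (hw : w ≠ []) {v : Symb → D}
    (hv : Set.InjOn v M.symbols) {t : Trace D}
    (ht : t.take M.prelude.length = M.prelude.map v) {R₀ : Reg D} (hph : R₀.ph = v Symb.hash)
    (hlk : R₀.lk = v Symb.hash) (hF : FirstBlock v w (pairsOf (t.drop M.prelude.length)))
    (hE : ∀ m R, RPath M anySt v (pairsOf (t.drop M.prelude.length)) R₀ m R →
      ¬ ErrP M anySt v R (pairsOf (t.drop M.prelude.length) m).1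
        (pairsOf (t.drop M.prelude.length) m).2) (n : ℕ)
    (hs : ∀ i < n, ¬ M.StopsAfter anySt w i) :
    ∃ v' : Symb → D, Set.InjOn v' M.symbols ∧ M.EncodesUpTo v' w n t := by
  have hp := M.pos_start_add w n _ le_rfl
  obtain ⟨v', hv', hc, hu⟩ := exists_val_of_not_err (anySt := anySt) hM hw hv hph hlk hF hE
    (M.start w n + M.len w n) (by rw [hp]; exact hs)
  refine ⟨v', hv', (M.encodesUpTo_iff v' w n t).2 ⟨?_, fun m hm => hu m ?_, ?_⟩⟩
  · rw [ht]
    exact List.map_congr_left fun s hs => hc s (mem_prelude.1 hs)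
  · rw [DTM.start] at hm; omega
  · have := hash_of_not_err hv' hM hw (hph.trans (hc Symb.hash trivial))
      (hlk.trans (hc Symb.hash trivial)) (hF.congr hc) (anySt := anySt) (fun m R hR => by
        rw [← ErrP.congr hM hc]
        exact hE m R (hR.congr hM fun s h => (hc s h).symm)) hu hp hs
    exact this.1

theorem mem_runWord (hM : M.Valid) {n : ℕ} {s : Symb} :
    s ∈ M.runWord w n ↔ M.IsConst s ∨ ∃ k < M.len w n, s = Symb.cell k := by
  rw [DTM.runWord, DTM.flatMap_enc, List.mem_append, List.mem_append, mem_prelude, pairWord,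
    List.mem_flatMap, List.mem_singleton]
  constructor
  · rintro ((h | ⟨m, hm, h⟩) | rfl)
    · exact Or.inl h
    · simp only [List.mem_cons, List.not_mem_nil, or_false] at h
      rcases h with rfl | rfl
      · have h1 := (M.pos_le w m).1
        have h2 := (M.pos_fst_le_iff w m n).2 (by simpa using hm)
        have h3 := DTM.len_mono (M := M) (w := w) h2
        simp only [DTM.item]
        generalize (M.pos w m).2 = j at h1
        cases j with
        | zero => exact Or.inl trivial
        | succ j => exact Or.inr ⟨j, by omega, rfl⟩
      · exact Or.inl (content_isConst hM _ _)
    · exact Or.inl trivial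
  · rintro (h | ⟨k, hk, rfl⟩)
    · exact Or.inl (Or.inl h)
    · refine Or.inl (Or.inr ⟨M.start w n + (k + 1), ?_, ?_⟩)
      · rw [List.mem_range, DTM.start]; omega
      · rw [DTM.item, M.pos_start_add w n (k + 1) hk]
        simp [ident]

/-- Valuations for different prefixes agree on the symbols that occur in both, so they glue. On an
unbounded tape every cell occurs at some time and the limit is defined everywhere. On a bounded tape
some cells never occur, and the valuation for a configuration of maximal length also supplies values
for these. -/
theorem encodesRunOn_of_forall (hM : M.Valid) {t : Trace D}
    (h : ∀ n, M.Alive w n → ∃ v : Symb → D, Set.InjOn v M.symbols ∧ M.EncodesUpTo v w n t) :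
    M.EncodesRunOn w t := by
  classical
  have h0 : M.Alive w 0 := fun i hi => absurd hi (Nat.not_lt_zero i)
  have : Nonempty (Symb → D) := ⟨(h 0 h0).choose⟩
  choose! v hv he using h
  have hal : ∀ {n n'}, n ≤ n' → M.Alive w n' → M.Alive w n :=
    fun hn h i hi => h i (lt_of_lt_of_le hi hn)
  have hagree : ∀ n n', M.Alive w n → M.Alive w n' → ∀ s ∈ M.runWord w n, s ∈ M.runWord w n' →
      v n s = v n' s := by
    have key : ∀ n n', n ≤ n' → M.Alive w n' → ∀ s ∈ M.runWord w n, v n s = v n' s := by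
      intro n n' hn hn' s hs
      have h1 := he n (hal hn hn')
      have h2 := (he n' hn').mono hn
      exact List.map_inj_left.1 (h1.symm.trans h2) s hs
    intro n n' hn hn' s hs hs'
    rcases le_total n n' with h | h
    · exact key n n' h hn' s hs
    · exact (key n' n h hn s hs').symm
  have hfin : ∀ (u : Symb → D) n, M.Alive w n → (∀ s ∈ M.runWord w n, u s = v n s) →
      M.EncodesUpTo u w n t := by
    intro u n hn hu
    rw [DTM.EncodesUpTo, List.map_congr_left hu]
    exact he n hn
  by_cases hb : ∃ N, M.Alive w N ∧ ∀ n, M.Alive w n → M.len w n ≤ M.len w N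
  · obtain ⟨N, hN, hb⟩ := hb
    refine ⟨v N, hv N hN, fun n hn => hfin _ n hn fun s hs => ?_⟩
    refine hagree N n hN hn s ?_ hs
    rw [mem_runWord hM] at hs ⊢
    rcases hs with hs | ⟨k, hk, rfl⟩
    · exact Or.inl hs
    · exact Or.inr ⟨k, hk.trans_le (hb n hn), rfl⟩
  · push Not at hb
    have hex : ∀ k, ∃ n, M.Alive w n ∧ k < M.len w n := by
      intro k
      induction k with
      | zero =>
        obtain ⟨n, h1, h2⟩ := hb 0 h0
        exact ⟨n, h1, by omega⟩
      | succ k ih =>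
        obtain ⟨n, h1, h2⟩ := ih
        obtain ⟨n', h3, h4⟩ := hb n h1
        exact ⟨n', h3, by omega⟩
    choose f hf1 hf2 using hex
    let u : Symb → D := fun s => match s with
      | Symb.cell k => v (f k) (Symb.cell k)
      | s => v 0 s
    have hu : ∀ n, M.Alive w n → ∀ s ∈ M.runWord w n, u s = v n s := by
      intro n hn s hs
      have hc : M.IsConst s → v 0 s = v n s := fun h =>
        hagree 0 n h0 hn s ((mem_runWord hM).2 (Or.inl h)) hs
      cases s with
      | cell k =>
        refine hagree (f k) n (hf1 k) hn _ ?_ hs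
        exact (mem_runWord hM).2 (Or.inr ⟨k, hf2 k, rfl⟩)
      | _ =>
        refine hc ?_
        rcases (mem_runWord hM).1 hs with h | ⟨k, -, h⟩
        · exact h
        · cases h
    refine ⟨u, fun s hs s' hs' e => ?_, fun n hn => hfin u n hn (hu n hn)⟩
    have hex' : ∀ s ∈ M.symbols, ∃ n, M.Alive w n ∧ s ∈ M.runWord w n := by
      intro s hs
      cases s with
      | cell k => exact ⟨f k, hf1 k, (mem_runWord hM).2 (Or.inr ⟨k, hf2 k, rfl⟩)⟩
      | state p => exact ⟨0, h0, (mem_runWord hM).2 (Or.inl (hs p rfl))⟩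
      | _ => exact ⟨0, h0, (mem_runWord hM).2 (Or.inl trivial)⟩
    have hmono : ∀ {n n'}, n ≤ n' → ∀ {s}, s ∈ M.runWord w n → s ∈ M.runWord w n' := by
      intro n n' hn s hs
      rw [mem_runWord hM] at hs ⊢
      exact hs.imp_right fun ⟨k, hk, e⟩ => ⟨k, hk.trans_le (DTM.len_mono hn), e⟩
    obtain ⟨n, hn, hns⟩ := hex' s hs
    obtain ⟨n', hn', hns'⟩ := hex' s' hs'
    rcases le_total n n' with hle | hle
    · rw [hu n' hn' s (hmono hle hns), hu n' hn' s' hns'] at e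
      exact hv n' hn' hs hs' e
    · rw [hu n hn s hns, hu n hn s' (hmono hle hns')] at e
      exact hv n hn hs hs' e

end


section
variable {D : Type*} {M : DTM} {w : List Bool} {anySt : Bool}

/-! ### Inputs -/

theorem mem_chk {b : BExp} {φ : Formula} {ρ : TEnv D} {δ : DEnv D} {t : Trace D} :
    t ∈ (chk b φ).sem ρ δ ↔ b.Holds δ (t 0) ∧ t.tail ∈ φ.sem ρ δ := by
  change (¬ b.Holds δ (t 0) → False) ∧ (True → t.tail ∈ φ.sem ρ δ) ↔ _
  tauto

theorem Trace.drop_drop (t : Trace D) (m n : ℕ) : (t.drop m).drop n = t.drop (m + n) := by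
  funext k; simp only [Trace.drop]; congr 1; omega

theorem Trace.tail_eq_drop (t : Trace D) : t.tail = t.drop 1 := by
  funext k; simp only [Trace.drop, Trace.tail]; congr 1; omega

theorem Trace.drop_zero (t : Trace D) : t.drop 0 = t := by
  funext k; simp only [Trace.drop, Nat.zero_add]

theorem mem_chkBits {r : List Bool} {φ : Formula} {ρ : TEnv D} {δ : DEnv D} {t : Trace D} :
    t ∈ (chkBits r φ).sem ρ δ ↔ (∀ k < r.length, (pairsOf t k).1 ≠ symVal δ Symb.hash ∧
      (pairsOf t k).2 = symVal δ (Symb.bit (r.getD k false))) ∧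
      t.drop (2 * r.length) ∈ φ.sem ρ δ := by
  induction r generalizing t with
  | nil => simp [chkBits, Trace.drop_zero]
  | cons c r ih =>
    change t ∈ (chk _ (chk _ (chkBits r φ))).sem ρ δ ↔ _
    have e : t.tail.tail = t.drop 2 := by rw [Trace.tail_eq_drop, Trace.tail_drop]
    have e2 : 2 + 2 * r.length = 2 * (r.length + 1) := by ring
    have e3 : ∀ k, pairsOf (t.drop 2) k = pairsOf t (k + 1) := by
      intro k
      simp only [pairsOf, Trace.drop]
      congr 2 <;> ring
    rw [mem_chk, mem_chk, e, ih, Trace.drop_drop, List.length_cons, e2, ← and_assoc, ← and_assoc]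
    refine and_congr_left fun _ => ?_
    simp only [e3, neg_holds, eqs_holds]
    constructor
    · rintro ⟨⟨h1, h2⟩, h3⟩ k hk
      cases k with
      | zero => exact ⟨h1, by cases c <;> exact h2⟩
      | succ k => simpa using h3 k (by omega)
    · intro h
      refine ⟨⟨(h 0 (by omega)).1, ?_⟩, fun k hk => by simpa using h (k + 1) (by omega)⟩
      have := (h 0 (by omega)).2
      cases c <;> exact this

theorem mem_inputForm {ρ : TEnv D} {δ : DEnv D} {t : Trace D} :
    t ∈ (inputForm M w).sem ρ δ ↔ ∀ δ' : DEnv D, (∀ y, y ∉ 33 :: restVars M → δ' y = δ y) →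
      t.take M.prelude.length = M.prelude.map (symVal δ') →
      t M.prelude.length = symVal δ' Symb.hash ∧
      t (M.prelude.length + 1) = symVal δ' (Symb.state 0) ∧
      t (M.prelude.length + 2) ≠ symVal δ' Symb.hash ∧
      t (M.prelude.length + 3) = symVal δ' (Symb.head w.headI) ∧
      (∀ k < w.tail.length, (pairsOf (t.drop (M.prelude.length + 4)) k).1 ≠ symVal δ' Symb.hash ∧
        (pairsOf (t.drop (M.prelude.length + 4)) k).2 =
          symVal δ' (Symb.bit (w.tail.getD k false))) ∧
      t (M.prelude.length + 4 + 2 * w.tail.length) = symVal δ' Symb.hash := by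
  rw [inputForm, mem_reads (vars_nodup M)]
  refine forall_congr' fun δ' => forall_congr' fun _ => imp_congr take_prelude_iff.symm ?_
  rw [show (33 :: restVars M).length = M.prelude.length from (prelude_length M).symm]
  simp only [mem_chk, mem_chkBits, Trace.tail_eq_drop, Trace.drop_drop, neg_holds, eqs_holds]
  -- `[¬ true] ff` stands for truth, which the grammar of sHMLd lacks.
  have e2 : ∀ ρ : TEnv D, ∀ s : Trace D,
      s ∈ (Formula.nec (BExp.neg BExp.tru) Formula.ff).sem ρ δ' ↔ True :=
    fun ρ s => ⟨fun _ => trivial, fun _ h => absurd trivial h⟩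
  simp only [e2, and_true]
  cases w.headI <;> rfl

theorem mem_inputForm_of_encodes (hM : M.Valid) (hw : w ≠ []) {v : Symb → D}
    (hv : Set.InjOn v M.symbols) {ρ : TEnv D} {δ : DEnv D} {t : Trace D}
    (h : M.EncodesUpTo v w 0 t) : t ∈ (inputForm M w).sem ρ δ := by
  rw [mem_inputForm]
  intro δ' _ h1
  rw [DTM.encodesUpTo_iff] at h
  obtain ⟨h2, h3, h4⟩ := h
  have hK : ∀ s, M.IsConst s → symVal δ' s = v s := fun s hs => prelude_congr (h1.symm.trans h2) hs
  have hs0 : M.IsConst (Symb.state 0) := lt_of_le_of_lt (Nat.zero_le _) hM.1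
  have hstart : M.start w 1 = w.length + 1 := by
    rw [DTM.start, DTM.start, Nat.zero_add]; rfl
  rw [Nat.zero_add, hstart] at h3 h4
  have hlen : w.tail.length + 1 = w.length := by
    cases w with
    | nil => exact absurd rfl hw
    | cons b r => rfl
  have hpos : ∀ j ≤ w.length, M.pos w j = (0, j) := by
    intro j hj
    have := M.pos_start_add w 0 j hj
    rwa [DTM.start, Nat.zero_add] at this
  have hne : ∀ k, v (Symb.cell k) ≠ v Symb.hash := fun k h => by
    have := (val_ident_hash hv (j := k + 1)).1 h
    omega
  have h00 := h3 0 (by omega)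
  have h01 := h3 1 (by omega)
  simp only [DTM.item, hpos 0 (by omega), pairsOf, Prod.mk.injEq] at h00
  simp only [DTM.item, hpos 1 (by omega), pairsOf, Prod.mk.injEq] at h01
  have htape : (M.cfg w 0).tape = w := rfl
  have hhead : (M.cfg w 0).head = 0 := rfl
  rw [hK Symb.hash trivial, hK _ hs0, hK (Symb.head _) trivial]
  refine ⟨h00.1, h00.2, ?_, ?_, fun k hk => ?_, ?_⟩
  · rw [show t (M.prelude.length + 2) = _ from h01.1]
    exact hne 0
  · rw [show t (M.prelude.length + 3) = _ from h01.2, Cfg.content_succ, hhead, if_pos rfl, htape]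
    cases w with
    | nil => exact absurd rfl hw
    | cons b r => rfl
  · have := h3 (k + 2) (by omega)
    have e : pairsOf (t.drop (M.prelude.length + 4)) k =
        pairsOf (t.drop M.prelude.length) (k + 2) := by
      simp only [pairsOf, Trace.drop]
      congr 2 <;> ring
    rw [e, this]
    simp only [DTM.item, hpos (k + 2) (by omega)]
    refine ⟨hne (k + 1), ?_⟩
    rw [Cfg.content_succ, hhead, if_neg (Nat.succ_ne_zero k), htape, hK (Symb.bit _) trivial]
    cases w with
    | nil => exact absurd rfl hw
    | cons b r => rfl
  · simp only [pairsOf, Trace.drop] at h4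
    rw [← h4]
    congr 1
    omega

theorem firstBlock_of_mem_inputForm (hw : w ≠ []) {ρ : TEnv D} {δ δ' : DEnv D}
    {t : Trace D} (h : t ∈ (inputForm M w).sem ρ δ)
    (h1 : t.take M.prelude.length = M.prelude.map (symVal δ'))
    (hK : Set.InjOn (symVal δ') {s | M.IsConst s}) :
    FirstBlock (symVal δ') w (pairsOf (t.drop M.prelude.length)) := by
  classical
  rw [mem_inputForm] at h
  -- `inputForm` reads the prelude again under its own quantifiers, and finds the same values there.
  let δ₁ : DEnv D := fun y => if y ∈ 33 :: restVars M then δ' y else δ y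
  have e1 : t.take M.prelude.length = M.prelude.map (symVal δ₁) := by
    rw [take_prelude_iff] at h1 ⊢
    intro i hi
    simp only [δ₁, List.getElem_mem, if_true]
    exact h1 i hi
  have hc : ∀ s, M.IsConst s → symVal δ₁ s = symVal δ' s := fun s hs =>
    prelude_congr (e1.symm.trans h1) hs
  obtain ⟨-, -, g3, g4, g5, g6⟩ := h δ₁ (fun y hy => if_neg hy) e1
  rw [hc Symb.hash trivial] at g3 g6
  rw [hc (Symb.head _) trivial] at g4
  have hlen : w.tail.length + 1 = w.length := by
    cases w with
    | nil => exact absurd rfl hw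
    | cons b r => rfl
  have e : ∀ k, pairsOf (t.drop (M.prelude.length + 4)) k =
        pairsOf (t.drop M.prelude.length) (k + 2) := by
    intro k
    simp only [pairsOf, Trace.drop]
    congr 2 <;> ring
  refine ⟨fun k hk => ?_, fun k hk c hb => ?_, ?_⟩
  · cases k with
    | zero => exact g3
    | succ k =>
      have := (g5 k (by omega)).1
      rwa [e, hc Symb.hash trivial] at this
  · cases k with
    | zero =>
      have g4' : (pairsOf (t.drop M.prelude.length) (0 + 1)).2 = _ := g4
      rw [g4'] at hb
      rcases hb with hb | hb
      · have h : Symb.head w.headI = Symb.bit c := hK (by exact trivial) (by exact trivial) hb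
        cases h
      · have h : Symb.head w.headI = Symb.head c := hK (by exact trivial) (by exact trivial) hb
        injection h with h
        rw [← h]
        cases w with
        | nil => exact absurd rfl hw
        | cons b r => rfl
    | succ k =>
      have := (g5 k (by omega)).2
      rw [e, hc (Symb.bit _) trivial] at this
      rw [this] at hb
      rcases hb with hb | hb
      · have h : Symb.bit (w.tail.getD k false) = Symb.bit c :=
          hK (by exact trivial) (by exact trivial) hb
        injection h with h
        rw [← h]
        cases w with
        | nil => exact absurd rfl hw
        | cons b r => rfl
      · have h : Symb.bit (w.tail.getD k false) = Symb.head c :=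
          hK (by exact trivial) (by exact trivial) hb
        cases h
  · simp only [pairsOf, Trace.drop]
    rw [← g6]
    congr 1
    omega

/-! ### Correctness of the formula for a run on a given input -/

theorem alive_iff {n : ℕ} : M.Alive w n ↔ ∀ i < n, ¬ M.StopsAfter false w i := by
  simp [DTM.Alive, DTM.StopsAfter]

/-- A greatest fixed point cannot force the first block to end; `inputForm` does so, and it fixes
the bits. The automaton then determines everything up to the halting configuration, if there is one.
-/
theorem mem_runForm (hM : M.Valid) [Infinite D] (hw : w ≠ []) {ρ : TEnv D} {δ : DEnv D}
    {t : Trace D} : t ∈ (runForm M w).sem ρ δ ↔ M.EncodesRunOn w t := by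
  change t ∈ (autom false true 0 false M).sem ρ δ ∧ t ∈ (inputForm M w).sem ρ δ ↔ _
  constructor
  · rintro ⟨h1, h2⟩
    obtain ⟨δ', e1, e2, e3, h⟩ := exists_env_of_mem_autom h1
    obtain ⟨hK, hE⟩ := noError_iff_rpath.1 (mem_gfp_loop.1 h)
    have hF := firstBlock_of_mem_inputForm hw h2 e1 hK
    obtain ⟨v, hv, hc⟩ := exists_val_extension hK
    refine encodesRunOn_of_forall hM fun n hn => ?_
    refine encodesUpTo_of_noError (anySt := false) hM hw hv (R₀ := regAt δ' 17) ?_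
      (e2.trans (hc Symb.hash trivial)) (e3.trans (hc Symb.hash trivial)) (hF.congr hc) ?_ n
      (alive_iff.1 hn)
    · rw [e1]
      exact List.map_congr_left fun s hs => hc s (mem_prelude.1 hs)
    · intro m R hR
      rw [← ErrP.congr hM hc]
      exact hE m R (hR.congr hM fun s hs => (hc s hs).symm)
  · rintro ⟨v, hv, h⟩
    refine ⟨mem_autom_gfp_of_encodes hv hM hw fun n hn => h n (alive_iff.2 hn), ?_⟩
    exact mem_inputForm_of_encodes hM hw hv (h 0 fun i hi => absurd hi (Nat.not_lt_zero i))

/-! ### Terminating checks -/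

/-- A path without lock has a successor unless it stops. If it never stopped, dependent choice would
yield an infinite path, which the least fixed point excludes. -/
theorem exists_stop_of_mem_lfp {X : ℕ} {E : BExp} {ρ : TEnv D} {δ : DEnv D} {t : Trace D}
    (h : t ∈ (Formula.lfp X (loopBody false X E (transB anySt M))).sem ρ δ)
    (hK : Set.InjOn (symVal δ) {s | M.IsConst s}) (hlk : δ 29 = δ 33) :
    ∃ m R, RPath M anySt (symVal δ) (pairsOf t) (regAt δ 17) m R ∧
      StopP M anySt (symVal δ) R (pairsOf t m).1 := by
  by_contra hno
  push Not at hno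
  have step : ∀ m δ₁, Path (transB anySt M) t δ m δ₁ ∧ δ₁ 29 = δ 33 →
      ∃ δ₂, Succ (transB anySt M) δ₁ (t (2 * m)) (t (2 * m + 1)) δ₂ ∧
        (Path (transB anySt M) t δ (m + 1) δ₂ ∧ δ₂ 29 = δ 33) := by
    rintro m δ₁ ⟨hp, hl⟩
    obtain ⟨e, hR⟩ := rpath_of_path hp
    obtain ⟨R', h1, h2⟩ := exists_transP (anySt := anySt) hK (regAt δ₁ 17) (pairsOf t m).1
      (pairsOf t m).2 (hno m _ hR) hl
    rw [← e] at h1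
    have hs := succ_storeReg h1
    exact ⟨_, hs, Path.succ hp hs, h2⟩
  refine (noError_of_mem_lfp_loop h).2 ?_
  choose! f hf1 hf2 using step
  let g : ∀ m : ℕ, {δ₁ : DEnv D // Path (transB anySt M) t δ m δ₁ ∧ δ₁ 29 = δ 33} := fun m =>
    Nat.rec ⟨δ, Path.zero, hlk⟩ (fun m x => ⟨f m x.1, hf2 m x.1 x.2⟩) m
  exact ⟨fun m => (g m).1, rfl, fun m => hf1 m (g m).1 (g m).2⟩

/-- The stop supplied by the least fixed point occurs at a separator, so the first block is finite
and an input can be read off from it. From there on the argument is that for a known input. -/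
theorem encodes_of_mem_autom_lfp (hM : M.Valid) [Infinite D] {X : ℕ} {ρ : TEnv D} {δ : DEnv D}
    {t : Trace D} (h : t ∈ (autom false false X anySt M).sem ρ δ) :
    ∃ (w : List Bool) (n : ℕ) (v : Symb → D), w ≠ [] ∧ Set.InjOn v M.symbols ∧
      (∀ i < n, ¬ M.StopsAfter anySt w i) ∧ M.StopsAfter anySt w n ∧ M.EncodesUpTo v w n t := by
  classical
  obtain ⟨δ', e1, e2, e3, h⟩ := exists_env_of_mem_autom h
  obtain ⟨hK, hE⟩ := noError_iff_rpath.1 (noError_of_mem_lfp_loop h).1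
  obtain ⟨m, R, hR, hst⟩ := exists_stop_of_mem_lfp h hK e3
  set u := pairsOf (t.drop M.prelude.length) with hu
  set K := symVal δ' with hKdef
  have hK33 : K Symb.hash = δ' 33 := rfl
  have hm0 : m ≠ 0 := by
    rintro rfl
    cases hR
    exact hst.2.1 e2
  have hex : ∃ l, (u (l + 1)).1 = K Symb.hash :=
    ⟨m - 1, by rw [Nat.sub_add_cancel (by omega)]; exact hst.1⟩
  have hl := Nat.find_spec hex
  have hmin : ∀ k < Nat.find hex, (u (k + 1)).1 ≠ K Symb.hash := fun k hk => Nat.find_min hex hk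
  set l := Nat.find hex
  -- An empty first block is caught by the fourth error, one step after the start.
  have hl0 : l ≠ 0 := by
    intro hl0
    rw [hl0] at hl
    obtain ⟨R', h1, -⟩ := exists_transP (anySt := anySt) hK (regAt δ' 17) (u 0).1 (u 0).2
      (fun h => h.2.1 e2) e3
    have h0 := hE 0 _ RPath.zero
    simp only [ErrP, not_or] at h0
    have ha : (u 0).1 = K Symb.hash := by
      by_contra ha
      exact h0.1 ⟨e2, fun h => ha h.1⟩
    have hT := h1.2.1 ha
    exact hE 1 R' (RPath.succ RPath.zero h1) (Or.inr (Or.inr (Or.inr (Or.inl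
      ⟨hT.1 e2, hl, hT.2.2.1.trans ha⟩))))
  -- A cell counts as `1` if its content is a `1` with or without head. Whether the content is
  -- admissible at that place is left to the automaton.
  let w : List Bool := (List.range l).map fun k =>
    decide ((u (k + 1)).2 = K (Symb.bit true) ∨ (u (k + 1)).2 = K (Symb.head true))
  have hwl : w.length = l := by simp [w]
  have hw : w ≠ [] := fun h => hl0 (by rw [← hwl, h]; rfl)
  have hF : FirstBlock K w u := by
    refine ⟨fun k hk => hmin k (hwl ▸ hk), fun k hk c hb => ?_, by rw [hwl]; exact hl⟩
    have hk' : k < l := hwl ▸ hk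
    have : w.getD k false = decide ((u (k + 1)).2 = K (Symb.bit true) ∨
        (u (k + 1)).2 = K (Symb.head true)) := by
      simp [w, List.getD_eq_getElem?_getD, hk']
    rw [this]
    have i1 : ∀ b b', K (Symb.bit b) = K (Symb.head b') → False := fun b b' h => by
      have : Symb.bit b = Symb.head b' := hK (by exact trivial) (by exact trivial) h
      cases this
    have i2 : ∀ b b', K (Symb.bit b) = K (Symb.bit b') → b = b' := fun b b' h => by
      have : Symb.bit b = Symb.bit b' := hK (by exact trivial) (by exact trivial) h
      injection this
    have i3 : ∀ b b', K (Symb.head b) = K (Symb.head b') → b = b' := fun b b' h => by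
      have : Symb.head b = Symb.head b' := hK (by exact trivial) (by exact trivial) h
      injection this
    cases c
    · refine (decide_eq_false ?_).symm
      rcases hb with hb | hb <;> rw [hb] <;> rintro (h | h)
      · exact absurd (i2 _ _ h) (by simp)
      · exact i1 _ _ h
      · exact i1 _ _ h.symm
      · exact absurd (i3 _ _ h) (by simp)
    · exact (decide_eq_true hb).symm
  obtain ⟨v, hv, hc⟩ := exists_val_extension hK
  have hph' : (regAt δ' 17).ph = v Symb.hash := e2.trans (hc Symb.hash trivial)
  have hlk' : (regAt δ' 17).lk = v Symb.hash := e3.trans (hc Symb.hash trivial)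
  have hE' : ∀ m R, RPath M anySt v u (regAt δ' 17) m R → ¬ ErrP M anySt v R (u m).1 (u m).2 := by
    intro m R hR
    rw [← ErrP.congr hM hc]
    exact hE m R (hR.congr hM fun s hs => (hc s hs).symm)
  -- If no block were a stopping one, the encoding would extend to the place where the path stops,
  -- and `Inv` would exhibit a stopping block there.
  have hends : ∃ n, M.StopsAfter anySt w n := by
    by_contra hno
    push Not at hno
    obtain ⟨m', rfl⟩ := Nat.exists_eq_succ_of_ne_zero hm0
    obtain ⟨v', hv', hc', hu'⟩ := exists_val_of_not_err (anySt := anySt) hM hw hv hph' hlk'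
      (hF.congr hc) hE' m' fun i _ => hno i
    have hcc : ∀ s, M.IsConst s → K s = v' s := fun s hs => (hc s hs).trans (hc' s hs)
    have hI := RPath.inv hv' hM hw (hph'.trans (hc' Symb.hash trivial))
      (hlk'.trans (hc' Symb.hash trivial)) hu' (hR.congr hM hcc)
    exact hno _ ((hI.stopP_iff hv' hM).1 ((StopP.congr hM hcc).1 hst)).2
  have hal : ∀ i < Nat.find hends, ¬ M.StopsAfter anySt w i := fun i hi => Nat.find_min hends hi
  obtain ⟨v', hv', he⟩ := encodesUpTo_of_noError (anySt := anySt) hM hw hv (t := t)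
    (by rw [e1]; exact List.map_congr_left fun s hs => hc s (mem_prelude.1 hs)) hph' hlk'
    (hF.congr hc) hE' (Nat.find hends) hal
  exact ⟨w, _, v', hw, hv', hal, Nat.find_spec hends, he⟩

/-- Every prefix of a run includes the initial configuration, so checking the first block is enough.
-/
theorem mem_autom_lfp_true (hM : M.Valid) [Infinite D] {X : ℕ} {ρ : TEnv D} {δ : DEnv D}
    {t : Trace D} : t ∈ (autom false false X true M).sem ρ δ ↔ M.EncodesRunPrefix t := by
  constructor
  · intro h
    obtain ⟨w, n, v, hw, hv, hn, -, he⟩ := encodes_of_mem_autom_lfp hM h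
    exact ⟨w, 0, v, hw, hv, fun i hi => absurd hi (Nat.not_lt_zero i), he.mono (Nat.zero_le n)⟩
  · rintro ⟨w, n, v, hw, hv, -, he⟩
    exact mem_autom_lfp_of_encodes hv hM hw (n := 0) (Or.inl rfl) (he.mono (Nat.zero_le n))

theorem mem_autom_lfp_false (hM : M.Valid) [Infinite D] {X : ℕ} {ρ : TEnv D} {δ : DEnv D}
    {t : Trace D} : t ∈ (autom false false X false M).sem ρ δ ↔ M.EncodesTerminatingRun t := by
  constructor
  · intro h
    obtain ⟨w, n, v, hw, hv, hn, hs, he⟩ := encodes_of_mem_autom_lfp hM h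
    exact ⟨w, n, v, hw, hv, ⟨alive_iff.2 hn, hs.resolve_left (by simp)⟩, he⟩
  · rintro ⟨w, n, v, hw, hv, hn, he⟩
    exact mem_autom_lfp_of_encodes hv hM hw (Or.inr hn.2) he

/-! ### Duality for the automaton and the languages of the two formulae -/

theorem dual_quants (vs : List ℕ) (φ : Formula) :
    (quants false vs φ).dual = quants true vs φ.dual := by
  induction vs with
  | nil => rfl
  | cons x vs ih => exact congrArg (Formula.ex x) ih

theorem dual_reads (vs : List ℕ) (φ : Formula) :
    (reads false vs φ).dual = reads true vs φ.dual := by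
  induction vs with
  | nil => rfl
  | cons x vs ih => exact congrArg (fun ψ => Formula.ex x (Formula.pos _ ψ)) ih

theorem dual_autom (X : ℕ) (anySt : Bool) (M : DTM) :
    (autom false false X anySt M).dual = autom true true X anySt M := by
  simp only [autom, dual_quants, modal, cond_false, cond_true, Formula.dual, dual_reads, fixp,
    loopBody, junct, falsum]

theorem mem_nonTermForm (hM : M.Valid) [Infinite D] {ρ : TEnv D} {δ : DEnv D} {t : Trace D} :
    t ∈ (nonTermForm M).sem ρ δ ↔ M.EncodesRunPrefix t ∧ ¬ M.EncodesTerminatingRun t := by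
  change t ∈ (autom false false 0 true M).sem ρ δ ∧ t ∈ (autom true true 1 false M).sem ρ δ ↔ _
  have e : ρ = TEnv.compl (TEnv.compl ρ) := by funext X δ; simp [TEnv.compl]
  rw [mem_autom_lfp_true hM, ← dual_autom, e, Formula.mem_dual_sem, mem_autom_lfp_false hM]

theorem runForm_lang [Infinite D] (hM : M.Valid) (hw : w ≠ []) :
    (runForm M w).lang D = {t : Trace D | M.EncodesRunOn w t} := by
  have := Infinite.nonempty D
  ext t
  simp only [Formula.lang, Set.mem_ofPred_eq, mem_runForm hM hw, forall_const]

theorem nonTermForm_lang [Infinite D] (hM : M.Valid) : (nonTermForm M).lang D =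
    {t : Trace D | M.EncodesRunPrefix t ∧ ¬ M.EncodesTerminatingRun t} := by
  have := Infinite.nonempty D
  ext t
  simp only [Formula.lang, Set.mem_ofPred_eq, mem_nonTermForm hM, forall_const]

end


/-! ### Well-formedness of the formulae -/

/-- All variables of the constraint satisfy `P`. -/
def BExp.Within (P : ℕ → Prop) (b : BExp) : Prop := ∀ y ∈ b.vars, P y

section
variable {P : ℕ → Prop}

theorem within_eqv {x y : ℕ} : (eqv x y).Within P ↔ P x ∧ P y := by
  simp [BExp.Within, eqv, BExp.vars, DExp.vars]

theorem within_eqs {x : ℕ} : (eqs x).Within P ↔ P x := by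
  simp [BExp.Within, eqs, BExp.vars, DExp.vars]

theorem within_var_star {x : ℕ} : (BExp.eq (DExp.var x) DExp.star).Within P ↔ P x := by
  simp [BExp.Within, BExp.vars, DExp.vars]

theorem within_star_var {x : ℕ} : (BExp.eq DExp.star (DExp.var x)).Within P ↔ P x := by
  simp [BExp.Within, BExp.vars, DExp.vars]

theorem within_neg {b : BExp} : (BExp.neg b).Within P ↔ b.Within P := Iff.rfl

theorem within_and {b c : BExp} : (BExp.and b c).Within P ↔ b.Within P ∧ c.Within P := by
  simp [BExp.Within, BExp.vars, or_imp, forall_and]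

theorem within_bor {b c : BExp} : (bor b c).Within P ↔ b.Within P ∧ c.Within P := within_and

theorem within_bimp {b c : BExp} : (bimp b c).Within P ↔ b.Within P ∧ c.Within P := within_and

theorem within_tru : BExp.tru.Within P ↔ True := by simp [BExp.Within, BExp.vars]

theorem within_conj {l : List BExp} : (conj l).Within P ↔ ∀ b ∈ l, b.Within P := by
  induction l with
  | nil => simp [conj, within_tru]
  | cons b l ih =>
    rw [List.forall_mem_cons, ← ih]
    exact within_and

theorem within_disj {l : List BExp} : (disj l).Within P ↔ ∀ b ∈ l, b.Within P := by
  rw [disj, within_neg, within_conj]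
  simp [within_neg]

end

variable {M : DTM} {anySt : Bool}

/-- For closedness: variables below `17` are bound in the loop, and the listed ones by the reading
of the prelude. Validity of the machine keeps the variables for states within that list. -/
theorem errB_within (hM : M.Valid) : (errB anySt M).Within
    (fun y => y < 17 ∨ (33 ≤ y ∧ y < 38 + M.table.length)) := by
  have h1 := hM.1
  have h2 : (bif anySt then BExp.tru else eqv 2 (38 + M.final)).Within
      (fun y => y < 17 ∨ (33 ≤ y ∧ y < 38 + M.table.length)) := by
    cases anySt
    · simp only [cond_false, within_eqv]; omega
    · simp only [cond_true, within_tru]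
  simp only [errB, stopB, constB, distinctB, oneB, within_disj, within_conj, within_neg,
    within_eqv, within_eqs, within_and, within_bor, List.mem_cons, List.not_mem_nil,
    or_false, forall_eq_or_imp, forall_eq, List.mem_flatMap, List.mem_map, List.mem_range,
    DTM.numConst, h2, and_true]
  refine ⟨?_, by omega, by omega, by omega, by omega, ⟨by omega, by omega, ?_⟩, by omega,
    ⟨by omega, by omega, by omega, ?_⟩, by omega⟩
  · rintro b ⟨i, hi, j, hj, rfl⟩
    rw [within_neg, within_eqv]
    omega
  · refine ⟨?_, by omega, by omega⟩
    rintro b ⟨i, hi, rfl⟩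
    rw [within_eqv]
    omega
  · refine ⟨?_, by omega⟩
    rintro b ⟨i, hi, rfl⟩
    rw [within_eqv]
    omega

theorem transB_within (hM : M.Valid) :
    (transB anySt M).Within (fun y => y < 38 + M.table.length) := by
  have h1 := hM.1
  have h2 : (bif anySt then BExp.tru else eqv 2 (38 + M.final)).Within
      (fun y => y < 38 + M.table.length) := by
    cases anySt
    · simp only [cond_false, within_eqv]; omega
    · simp only [cond_true, within_tru]
  have h3 : ∀ p < M.table.length, ∀ c, (rowB p c (M.trans p c)).Within
      (fun y => y < 38 + M.table.length) := by
    intro p hp c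
    have := DTM.trans_lt hM hp c
    have hb : ∀ (b : Bool) (x y : ℕ), x < 38 → y < 38 → (bif b then x else y) < 38 := by
      intro b x y hx hy; cases b <;> assumption
    have := hb c 37 36 (by omega) (by omega)
    have := hb (M.trans p c).1 35 34 (by omega) (by omega)
    have := hb (M.trans p c).2.1 35 34 (by omega) (by omega)
    simp only [rowB, within_bimp, within_eqv, within_eqs, within_conj, List.mem_cons,
      List.not_mem_nil, or_false, forall_eq_or_imp, forall_eq]
    omega
  simp only [transB, stopB, transHashB, transCellB, tableB, within_conj, within_neg,
    within_eqv, within_eqs, within_and, within_bor, within_bimp, within_var_star, List.mem_cons,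
    List.not_mem_nil, or_false, forall_eq_or_imp, forall_eq, List.mem_flatMap, List.mem_range, h2,
    and_true]
  refine ⟨by omega, by omega, by omega, by omega, by omega, by omega, by omega, by omega,
    by omega, ?_, by omega⟩
  rintro b ⟨p, hp, rfl | rfl⟩
  · exact h3 p hp false
  · exact h3 p hp true

theorem loadGuard_within : loadGuard.Within (fun y => y < 33) := by
  have key : ∀ (l : List ℕ) (b : BExp), b.Within (fun y => y < 33) → (∀ i ∈ l, i < 16) →
      (l.foldr (fun i b => BExp.and (BExp.eq (DExp.var i) (DExp.var (17 + i))) b) b).Within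
        (fun y => y < 33) := by
    intro l b hb hl
    induction l with
    | nil => exact hb
    | cons i l ih =>
      rw [List.foldr_cons, within_and]
      refine ⟨?_, ih fun i hi => hl i (List.mem_cons_of_mem _ hi)⟩
      have := hl i List.mem_cons_self
      refine within_eqv.2 ?_
      omega
  refine key _ _ (within_star_var.2 (by omega)) fun i hi => ?_
  simpa using hi

/-! ### Free variables and binders -/

theorem mem_freeData_quants {d : Bool} {vs : List ℕ} {φ : Formula} {y : ℕ} :
    y ∈ (quants d vs φ).freeData ↔ y ∈ φ.freeData ∧ y ∉ vs := by
  induction vs with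
  | nil => simp [quants]
  | cons x vs ih =>
    have : (quants d (x :: vs) φ).freeData = (quants d vs φ).freeData.erase x := by
      cases d <;> rfl
    rw [this, Finset.mem_erase, ih, List.mem_cons, not_or]
    tauto

theorem freeData_modal (d : Bool) (b : BExp) (φ : Formula) :
    (modal d b φ).freeData = b.vars ∪ φ.freeData := by cases d <;> rfl

theorem freeData_junct (d : Bool) (φ ψ : Formula) :
    (junct d φ ψ).freeData = φ.freeData ∪ ψ.freeData := by cases d <;> rfl

theorem mem_freeData_reads {d : Bool} {vs : List ℕ} {φ : Formula} {y : ℕ} :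
    y ∈ (reads d vs φ).freeData ↔ y ∈ φ.freeData ∧ y ∉ vs := by
  induction vs with
  | nil => simp [reads]
  | cons x vs ih =>
    have : (reads d (x :: vs) φ).freeData =
        ((BExp.eq DExp.star (DExp.var x)).vars ∪ (reads d vs φ).freeData).erase x := by
      cases d <;> rfl
    rw [this, Finset.mem_erase, Finset.mem_union, ih, List.mem_cons, not_or]
    simp [BExp.vars, DExp.vars]
    tauto

theorem mem_restVars_iff {y : ℕ} : y ∈ 33 :: restVars M ↔ 33 ≤ y ∧ y < 38 + M.table.length := by
  simp only [restVars, List.mem_cons, List.mem_append, List.mem_map, List.mem_range,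
    List.not_mem_nil, or_false]
  constructor
  · rintro (rfl | ⟨i, hi, rfl⟩ | h) <;> omega
  · intro h
    by_cases h' : y < 38
    · omega
    · exact Or.inr (Or.inl ⟨y - 38, by omega, by omega⟩)

theorem freeData_loopBody (hM : M.Valid) {d : Bool} {X y : ℕ}
    (h : y ∈ (loopBody d X (errB anySt M) (transB anySt M)).freeData) :
    17 ≤ y ∧ y < 38 + M.table.length := by
  rw [loopBody, mem_freeData_quants, freeData_modal, freeData_junct, freeData_modal] at h
  simp only [Finset.mem_union, mem_freeData_quants, freeData_modal, List.mem_range] at h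
  obtain ⟨h | ⟨h | h⟩ | ⟨h | h, h'⟩, h17⟩ := h
  · have := loadGuard_within y h
    simp only at this
    omega
  · have := errB_within hM y h
    simp only at this
    omega
  · cases d <;> simp [falsum, Formula.freeData] at h
  · have := transB_within hM y h
    simp only at this
    omega
  · simp [Formula.freeData] at h

theorem freeData_autom (hM : M.Valid) (d g : Bool) (X : ℕ) :
    (autom d g X anySt M).freeData = ∅ := by
  refine Finset.eq_empty_of_forall_notMem fun y hy => ?_
  have hfix : ∀ φ, (fixp g X φ).freeData = φ.freeData := fun φ => by cases g <;> rfl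
  rw [autom, mem_freeData_quants, freeData_modal, Finset.mem_union, mem_freeData_reads, hfix] at hy
  obtain ⟨h | ⟨h, h'⟩, hy⟩ := hy
  · have hs : startGuard.Within (fun y => 17 ≤ y ∧ y < 34) := by
      simp only [startGuard, within_conj, within_eqv, within_eqs, List.mem_cons, List.not_mem_nil,
        or_false, forall_eq_or_imp, forall_eq]
      omega
    have := hs y h
    simp only [List.mem_cons, List.mem_range'_1] at this hy
    omega
  · have := freeData_loopBody hM h
    have h2 := mem_restVars_iff (M := M) (y := y)
    simp only [List.mem_cons, List.mem_range'_1] at hy h2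
    have h3 : ¬ (y = 33 ∨ y ∈ restVars M) := by
      rintro (h | h)
      · exact hy (Or.inl h)
      · exact h' h
    rw [h2] at h3
    omega

theorem freeRec_quants (d : Bool) (vs : List ℕ) (φ : Formula) :
    (quants d vs φ).freeRec = φ.freeRec := by
  induction vs with
  | nil => rfl
  | cons x vs ih => rw [← ih]; cases d <;> rfl

theorem freeRec_reads (d : Bool) (vs : List ℕ) (φ : Formula) :
    (reads d vs φ).freeRec = φ.freeRec := by
  induction vs with
  | nil => rfl
  | cons x vs ih => rw [← ih]; cases d <;> rfl

theorem freeRec_modal (d : Bool) (b : BExp) (φ : Formula) :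
    (modal d b φ).freeRec = φ.freeRec := by cases d <;> rfl

theorem freeRec_autom (d g : Bool) (X : ℕ) : (autom d g X anySt M).freeRec = ∅ := by
  have hfix : ∀ φ, (fixp g X φ).freeRec = φ.freeRec.erase X := fun φ => by cases g <;> rfl
  have hj : ∀ φ ψ, (junct d φ ψ).freeRec = φ.freeRec ∪ ψ.freeRec := fun φ ψ => by cases d <;> rfl
  have hf : (falsum d).freeRec = ∅ := by cases d <;> rfl
  simp only [autom, freeRec_quants, freeRec_modal, freeRec_reads, hfix, loopBody, hj, hf,
    Formula.freeRec, Finset.empty_union, Finset.erase_singleton]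

/-- Every fixed-point subformula satisfies `S`. -/
def AllBinders (S : Formula → ℕ → Formula → Prop) (φ : Formula) : Prop :=
  ∀ χ X ψ, χ.IsSubformula φ → χ.Binds X ψ → S χ X ψ

section
variable {S : Formula → ℕ → Formula → Prop}

theorem AllBinders.quants {d : Bool} {vs : List ℕ} {φ : Formula} (h : AllBinders S φ) :
    AllBinders S (quants d vs φ) := by
  induction vs with
  | nil => exact h
  | cons x vs ih =>
    cases d <;>
    · rintro χ X ψ (rfl | hs) hb
      · rcases hb with hb | hb <;> cases hb
      · exact ih χ X ψ hs hb

theorem AllBinders.modal {d : Bool} {b : BExp} {φ : Formula} (h : AllBinders S φ) :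
    AllBinders S (modal d b φ) := by
  cases d <;>
  · rintro χ X ψ (rfl | hs) hb
    · rcases hb with hb | hb <;> cases hb
    · exact h χ X ψ hs hb

theorem AllBinders.reads {d : Bool} {vs : List ℕ} {φ : Formula} (h : AllBinders S φ) :
    AllBinders S (reads d vs φ) := by
  induction vs with
  | nil => exact h
  | cons x vs ih =>
    exact AllBinders.quants (vs := [x]) (AllBinders.modal ih)

theorem AllBinders.junct {d : Bool} {φ ψ : Formula} (h : AllBinders S φ) (h' : AllBinders S ψ) :
    AllBinders S (junct d φ ψ) := by
  cases d <;>
  · rintro χ X ψ (rfl | hs | hs) hb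
    · rcases hb with hb | hb <;> cases hb
    · exact h χ X ψ hs hb
    · exact h' χ X ψ hs hb

theorem AllBinders.fixp {g : Bool} {X : ℕ} {φ : Formula} (h : AllBinders S φ)
    (h' : S (fixp g X φ) X φ) : AllBinders S (fixp g X φ) := by
  cases g
  all_goals
    rintro χ Y ψ (rfl | hs) hb
    · rcases hb with hb | hb <;> cases hb
      exact h'
    · exact h χ Y ψ hs hb

theorem AllBinders.of_atom {φ : Formula}
    (h : φ = Formula.tt ∨ φ = Formula.ff ∨ ∃ X, φ = Formula.var X) : AllBinders S φ := by
  rcases h with rfl | rfl | ⟨X, rfl⟩ <;>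
  · rintro χ X ψ hs hb
    cases hs
    rcases hb with hb | hb <;> cases hb

theorem AllBinders.loopBody {d : Bool} {X : ℕ} {E T : BExp} :
    AllBinders S (loopBody d X E T) := by
  refine AllBinders.quants (AllBinders.modal (AllBinders.junct (AllBinders.modal ?_)
    (AllBinders.quants (AllBinders.modal ?_))))
  · exact AllBinders.of_atom (by cases d <;> simp [falsum])
  · exact AllBinders.of_atom (Or.inr (Or.inr ⟨X, rfl⟩))

theorem AllBinders.autom {d g : Bool} {X : ℕ} (h : S (RecHML.fixp g X (RecHML.loopBody d X
    (errB anySt M) (transB anySt M))) X (RecHML.loopBody d X (errB anySt M) (transB anySt M))) :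
    AllBinders S (autom d g X anySt M) :=
  AllBinders.quants (AllBinders.modal (AllBinders.reads (AllBinders.fixp AllBinders.loopBody h)))

theorem AllBinders.chk {b : BExp} {φ : Formula} (h : AllBinders S φ) :
    AllBinders S (chk b φ) :=
  AllBinders.junct (d := false) (AllBinders.modal (d := false)
    (AllBinders.of_atom (Or.inr (Or.inl rfl)))) (AllBinders.modal (d := false) h)

theorem AllBinders.chkBits {r : List Bool} {φ : Formula} (h : AllBinders S φ) :
    AllBinders S (chkBits r φ) := by
  induction r with
  | nil => exact h
  | cons c r ih => exact AllBinders.chk (AllBinders.chk ih)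

theorem AllBinders.inputForm {w : List Bool} : AllBinders S (inputForm M w) :=
  AllBinders.reads (AllBinders.chk (AllBinders.chk (AllBinders.chk (AllBinders.chk
    (AllBinders.chkBits (AllBinders.chk (AllBinders.modal (d := false)
      (AllBinders.of_atom (Or.inr (Or.inl rfl))))))))))

end

theorem unguarded_loopBody (d : Bool) (X : ℕ) (E T : BExp) : (loopBody d X E T).unguarded = ∅ := by
  have key : ∀ (vs : List ℕ) (φ : Formula), φ.unguarded = ∅ → (quants d vs φ).unguarded = ∅ := by
    intro vs φ h
    induction vs with
    | nil => exact h
    | cons x vs ih => rw [← ih]; cases d <;> rfl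
  exact key _ _ (by cases d <;> rfl)

theorem freeData_inputForm (hM : M.Valid) (w : List Bool) : (inputForm M w).freeData = ∅ := by
  refine Finset.eq_empty_of_forall_notMem fun y hy => ?_
  rw [inputForm, mem_freeData_reads, mem_restVars_iff] at hy
  have hc : ∀ (b : BExp) (φ : Formula), b.Within (fun y => 33 ≤ y ∧ y < 38 + M.table.length) →
      (∀ y ∈ φ.freeData, 33 ≤ y ∧ y < 38 + M.table.length) →
      ∀ y ∈ (chk b φ).freeData, 33 ≤ y ∧ y < 38 + M.table.length := by
    intro b φ hb hφ y hy
    simp only [chk, Formula.freeData, BExp.vars, Finset.union_empty, Finset.empty_union,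
      Finset.mem_union] at hy
    exact hy.elim (hb y) (hφ y)
  have hbits : ∀ (r : List Bool) (φ : Formula),
      (∀ y ∈ φ.freeData, 33 ≤ y ∧ y < 38 + M.table.length) →
      ∀ y ∈ (chkBits r φ).freeData, 33 ≤ y ∧ y < 38 + M.table.length := by
    intro r φ hφ
    induction r with
    | nil => exact hφ
    | cons c r ih =>
      refine hc _ _ ?_ (hc _ _ ?_ ih)
      · simp only [within_neg, within_eqs]; omega
      · cases c <;> simp only [within_eqs, cond_true, cond_false] <;> omega
  have hpos := hM.1
  refine hy.2 (hc _ _ ?_ (hc _ _ ?_ (hc _ _ ?_ (hc _ _ ?_ (hbits _ _ (hc _ _ ?_ ?_))))) y hy.1)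
  · simp only [within_eqs]; omega
  · simp only [within_eqs]; omega
  · simp only [within_neg, within_eqs]; omega
  · cases w.headI <;> simp only [within_eqs, cond_true, cond_false] <;> omega
  · simp only [within_eqs]; omega
  · simp [Formula.freeData, BExp.vars]

theorem freeRec_inputForm (w : List Bool) : (inputForm M w).freeRec = ∅ := by
  have hc : ∀ (b : BExp) (φ : Formula), (chk b φ).freeRec = φ.freeRec := by
    intro b φ; simp [chk, Formula.freeRec]
  have hbits : ∀ (r : List Bool) (φ : Formula), (chkBits r φ).freeRec = φ.freeRec := by
    intro r φ
    induction r with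
    | nil => rfl
    | cons c r ih => rw [← ih]; exact (hc _ _).trans (hc _ _)
  simp only [inputForm, freeRec_reads, hc, hbits, Formula.freeRec]

/-- A name determines its binder as soon as some function `F` predicts the binder of each name. -/
theorem AllBinders.uniqueBinding {φ : Formula} (F : ℕ → Formula)
    (h : AllBinders (fun χ X _ => χ = F X) φ) : φ.UniqueBinding :=
  fun χ₁ χ₂ X ψ₁ ψ₂ h1 h2 h3 h4 => (h χ₁ X ψ₁ h1 h3).trans (h χ₂ X ψ₂ h2 h4).symm

theorem runForm_isRecHML (hM : M.Valid) (w : List Bool) : (runForm M w).IsRecHML where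
  freeData_eq := by
    rw [runForm, Formula.freeData, freeData_autom hM, freeData_inputForm hM]; rfl
  freeRec_eq := by
    rw [runForm, Formula.freeRec, freeRec_autom, freeRec_inputForm]; rfl
  guarded := AllBinders.junct (d := false)
    (AllBinders.autom (by rw [unguarded_loopBody]; exact Finset.notMem_empty _))
    AllBinders.inputForm
  uniqueBinding := AllBinders.uniqueBinding
    (fun X => fixp true X (loopBody false X (errB false M) (transB false M)))
    (AllBinders.junct (d := false) (AllBinders.autom rfl) AllBinders.inputForm)

theorem nonTermForm_isRecHML (hM : M.Valid) : (nonTermForm M).IsRecHML where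
  freeData_eq := by
    rw [nonTermForm, Formula.freeData, freeData_autom hM, freeData_autom hM]; rfl
  freeRec_eq := by
    rw [nonTermForm, Formula.freeRec, freeRec_autom, freeRec_autom]; rfl
  guarded := AllBinders.junct (d := false)
    (AllBinders.autom (by rw [unguarded_loopBody]; exact Finset.notMem_empty _))
    (AllBinders.autom (by rw [unguarded_loopBody]; exact Finset.notMem_empty _))
  uniqueBinding := AllBinders.uniqueBinding
    -- The two automata differ, which is why their loops carry the names `0` and `1`.
    (fun X => if X = 0 then fixp false X (loopBody false X (errB true M) (transB true M))
      else fixp true X (loopBody true X (errB false M) (transB false M)))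
    (AllBinders.junct (d := false) (AllBinders.autom rfl) (AllBinders.autom rfl))

theorem runForm_isSHML (hM : M.Valid) (w : List Bool) : (runForm M w).IsSHML := by
  refine ⟨runForm_isRecHML hM w, ?_⟩
  have hq : ∀ (vs : List ℕ) (φ : Formula), φ.InSGrammar → (quants false vs φ).InSGrammar := by
    intro vs φ h
    induction vs with
    | nil => exact h
    | cons x vs ih => exact ih
  have hr : ∀ (vs : List ℕ) (φ : Formula), φ.InSGrammar → (reads false vs φ).InSGrammar := by
    intro vs φ h
    induction vs with
    | nil => exact h
    | cons x vs ih => exact ih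
  have hbits : ∀ (r : List Bool) (φ : Formula), φ.InSGrammar → (chkBits r φ).InSGrammar := by
    intro r φ h
    induction r with
    | nil => exact h
    | cons c r ih => exact ⟨trivial, trivial, ih⟩
  refine ⟨hq _ _ (hr _ _ (hq _ _ ⟨trivial, hq _ _ trivial⟩)), hr _ _ ?_⟩
  exact ⟨trivial, trivial, trivial, trivial, hbits _ _ ⟨trivial, trivial⟩⟩


/-! ### Computability of the formulae -/

section
variable {α : Type*} [Primcodable α]

/-- The Gödel number of a compound expression is an arithmetic term in those of its parts, so it is
enough to compute that term. The same holds for all constructors below. -/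
theorem Primrec.bexp_eq {f g : α → DExp} (hf : Primrec f) (hg : Primrec g) :
    Primrec fun a => BExp.eq (f a) (g a) := by
  refine Primrec.encode_iff.1 (Primrec.nat_add.comp (Primrec.nat_mul.comp (Primrec.const 3)
    (Primrec₂.natPair.comp (Primrec.encode.comp hf) (Primrec.encode.comp hg))) (Primrec.const 1))

theorem Primrec.bexp_neg {f : α → BExp} (hf : Primrec f) : Primrec fun a => BExp.neg (f a) :=
  Primrec.encode_iff.1 (Primrec.nat_add.comp (Primrec.nat_mul.comp (Primrec.const 3)
    (Primrec.encode.comp hf)) (Primrec.const 2))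

theorem Primrec.bexp_and {f g : α → BExp} (hf : Primrec f) (hg : Primrec g) :
    Primrec fun a => BExp.and (f a) (g a) := by
  refine Primrec.encode_iff.1 (Primrec.nat_add.comp (Primrec.nat_mul.comp (Primrec.const 3)
    (Primrec₂.natPair.comp (Primrec.encode.comp hf) (Primrec.encode.comp hg))) (Primrec.const 3))

theorem Primrec.dexp_var {f : α → ℕ} (hf : Primrec f) : Primrec fun a => DExp.var (f a) :=
  Primrec.encode_iff.1 ((Primrec.encode.comp (Primrec.option_some.comp hf)).of_eq fun _ => rfl)

theorem Primrec.form_pos {f : α → BExp} {g : α → Formula} (hf : Primrec f) (hg : Primrec g) :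
    Primrec fun a => Formula.pos (f a) (g a) := by
  refine Primrec.encode_iff.1 (Primrec.nat_add.comp (Primrec.nat_mul.comp (Primrec.const 9)
    (Primrec₂.natPair.comp (Primrec.encode.comp hf) (Primrec.encode.comp hg))) (Primrec.const 2))

theorem Primrec.form_nec {f : α → BExp} {g : α → Formula} (hf : Primrec f) (hg : Primrec g) :
    Primrec fun a => Formula.nec (f a) (g a) := by
  refine Primrec.encode_iff.1 (Primrec.nat_add.comp (Primrec.nat_mul.comp (Primrec.const 9)
    (Primrec₂.natPair.comp (Primrec.encode.comp hf) (Primrec.encode.comp hg))) (Primrec.const 3))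

theorem Primrec.form_ex {f : α → ℕ} {g : α → Formula} (hf : Primrec f) (hg : Primrec g) :
    Primrec fun a => Formula.ex (f a) (g a) := by
  refine Primrec.encode_iff.1 (Primrec.nat_add.comp (Primrec.nat_mul.comp (Primrec.const 9)
    (Primrec₂.natPair.comp hf (Primrec.encode.comp hg))) (Primrec.const 4))

theorem Primrec.form_all {f : α → ℕ} {g : α → Formula} (hf : Primrec f) (hg : Primrec g) :
    Primrec fun a => Formula.all (f a) (g a) := by
  refine Primrec.encode_iff.1 (Primrec.nat_add.comp (Primrec.nat_mul.comp (Primrec.const 9)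
    (Primrec₂.natPair.comp hf (Primrec.encode.comp hg))) (Primrec.const 5))

theorem Primrec.form_or {f g : α → Formula} (hf : Primrec f) (hg : Primrec g) :
    Primrec fun a => Formula.or (f a) (g a) := by
  refine Primrec.encode_iff.1 (Primrec.nat_add.comp (Primrec.nat_mul.comp (Primrec.const 9)
    (Primrec₂.natPair.comp (Primrec.encode.comp hf) (Primrec.encode.comp hg))) (Primrec.const 6))

theorem Primrec.form_and {f g : α → Formula} (hf : Primrec f) (hg : Primrec g) :
    Primrec fun a => Formula.and (f a) (g a) := by
  refine Primrec.encode_iff.1 (Primrec.nat_add.comp (Primrec.nat_mul.comp (Primrec.const 9)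
    (Primrec₂.natPair.comp (Primrec.encode.comp hf) (Primrec.encode.comp hg))) (Primrec.const 7))

theorem Primrec.form_fixp {g : Bool} {X : ℕ} {f : α → Formula} (hf : Primrec f) :
    Primrec fun a => fixp g X (f a) := by
  cases g
  · refine Primrec.encode_iff.1 (Primrec.nat_add.comp (Primrec.nat_mul.comp (Primrec.const 9)
      (Primrec₂.natPair.comp (Primrec.const X) (Primrec.encode.comp hf))) (Primrec.const 8))
  · refine Primrec.encode_iff.1 (Primrec.nat_add.comp (Primrec.nat_mul.comp (Primrec.const 9)
      (Primrec₂.natPair.comp (Primrec.const X) (Primrec.encode.comp hf))) (Primrec.const 9))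

theorem Primrec.form_quant {d : Bool} {f : α → ℕ} {g : α → Formula} (hf : Primrec f)
    (hg : Primrec g) : Primrec fun a => quant d (f a) (g a) := by
  cases d
  · exact Primrec.form_all hf hg
  · exact Primrec.form_ex hf hg

theorem Primrec.form_modal {d : Bool} {f : α → BExp} {g : α → Formula} (hf : Primrec f)
    (hg : Primrec g) : Primrec fun a => modal d (f a) (g a) := by
  cases d
  · exact Primrec.form_nec hf hg
  · exact Primrec.form_pos hf hg

theorem Primrec.form_junct {d : Bool} {f g : α → Formula} (hf : Primrec f)
    (hg : Primrec g) : Primrec fun a => junct d (f a) (g a) := by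
  cases d
  · exact Primrec.form_and hf hg
  · exact Primrec.form_or hf hg

theorem Primrec.form_quants {d : Bool} {f : α → List ℕ} {g : α → Formula} (hf : Primrec f)
    (hg : Primrec g) : Primrec fun a => quants d (f a) (g a) :=
  Primrec.list_foldr hf hg (h := fun _ p => quant d p.1 p.2)
    (Primrec.form_quant (Primrec.fst.comp Primrec.snd) (Primrec.snd.comp Primrec.snd)).to₂

theorem Primrec.form_reads {d : Bool} {f : α → List ℕ} {g : α → Formula} (hf : Primrec f)
    (hg : Primrec g) : Primrec fun a => reads d (f a) (g a) :=
  Primrec.list_foldr hf hg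
    (h := fun _ p => quant d p.1 (modal d (BExp.eq DExp.star (DExp.var p.1)) p.2))
    (Primrec.form_quant (Primrec.fst.comp Primrec.snd) (Primrec.form_modal
      (Primrec.bexp_eq (Primrec.const _) (Primrec.dexp_var (Primrec.fst.comp Primrec.snd)))
      (Primrec.snd.comp Primrec.snd))).to₂

theorem Primrec.form_loopBody {d : Bool} {X : ℕ} {f g : α → BExp} (hf : Primrec f)
    (hg : Primrec g) : Primrec fun a => loopBody d X (f a) (g a) :=
  Primrec.form_quants (Primrec.const _) (Primrec.form_modal (Primrec.const _)
    (Primrec.form_junct (Primrec.form_modal hf (Primrec.const _))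
      (Primrec.form_quants (Primrec.const _) (Primrec.form_modal hg (Primrec.const _)))))

theorem Primrec.bexp_eqv {f g : α → ℕ} (hf : Primrec f) (hg : Primrec g) :
    Primrec fun a => eqv (f a) (g a) :=
  Primrec.bexp_eq (Primrec.dexp_var hf) (Primrec.dexp_var hg)

theorem Primrec.bexp_bor {f g : α → BExp} (hf : Primrec f) (hg : Primrec g) :
    Primrec fun a => bor (f a) (g a) :=
  Primrec.bexp_neg (Primrec.bexp_and (Primrec.bexp_neg hf) (Primrec.bexp_neg hg))

theorem Primrec.bexp_bimp {f g : α → BExp} (hf : Primrec f) (hg : Primrec g) :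
    Primrec fun a => bimp (f a) (g a) :=
  Primrec.bexp_neg (Primrec.bexp_and hf (Primrec.bexp_neg hg))

theorem Primrec.bexp_conj {f : α → List BExp} (hf : Primrec f) : Primrec fun a => conj (f a) :=
  Primrec.list_foldr hf (Primrec.const _) (h := fun _ p => BExp.and p.1 p.2)
    (Primrec.bexp_and (Primrec.fst.comp Primrec.snd) (Primrec.snd.comp Primrec.snd)).to₂

theorem Primrec.bexp_disj {f : α → List BExp} (hf : Primrec f) : Primrec fun a => disj (f a) :=
  Primrec.bexp_neg (Primrec.bexp_conj
    (Primrec.list_map hf (Primrec.bexp_neg Primrec.snd).to₂))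

theorem Primrec.cons {β : Type*} [Primcodable β] {f : α → β} {l : α → List β} (hf : Primrec f)
    (hl : Primrec l) : Primrec fun a => f a :: l a := Primrec.list_cons.comp hf hl

theorem Primrec.dtm_final : Primrec DTM.final :=
  Primrec.fst.comp (Primrec.of_equiv (e := DTM.equivProd))

theorem Primrec.dtm_table : Primrec DTM.table :=
  Primrec.snd.comp (Primrec.of_equiv (e := DTM.equivProd))

theorem Primrec.dtm_length : Primrec fun M : DTM => M.table.length :=
  Primrec.list_length.comp Primrec.dtm_table

theorem Primrec.dtm_numConst : Primrec DTM.numConst :=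
  Primrec.nat_add.comp Primrec.dtm_length (Primrec.const 5)

theorem Primrec.add_left (c : ℕ) {f : α → ℕ} (hf : Primrec f) : Primrec fun a => c + f a :=
  Primrec.nat_add.comp (Primrec.const c) hf

theorem Primrec.bif {β : Type*} [Primcodable β] (x y : β) {f : α → Bool} (hf : Primrec f) :
    Primrec fun a => bif f a then x else y :=
  Primrec.cond hf (Primrec.const x) (Primrec.const y)

theorem Primrec.stopB {anySt : Bool} : Primrec (RecHML.stopB anySt) := by
  refine Primrec.bexp_conj (Primrec.cons (Primrec.const _) (Primrec.cons (Primrec.const _)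
    (Primrec.cons ?_ (Primrec.const _))))
  cases anySt
  · exact Primrec.bexp_eqv (Primrec.const 2) (Primrec.add_left 38 Primrec.dtm_final)
  · exact Primrec.const _

theorem Primrec.constB : Primrec RecHML.constB :=
  Primrec.bexp_disj (Primrec.list_map (Primrec.list_range.comp Primrec.dtm_numConst)
    (Primrec.bexp_eqv (Primrec.const _) (Primrec.add_left 33 Primrec.snd)).to₂)

theorem Primrec.distinctB : Primrec RecHML.distinctB := by
  have h : Primrec₂ fun (a : DTM × ℕ) (j : ℕ) => BExp.neg (eqv (33 + a.2) (33 + j)) :=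
    Primrec.bexp_neg (Primrec.bexp_eqv (Primrec.add_left 33 (Primrec.snd.comp Primrec.fst))
      (Primrec.add_left 33 Primrec.snd))
  exact Primrec.bexp_conj (Primrec.list_flatMap (Primrec.list_range.comp Primrec.dtm_numConst)
    (Primrec.list_map (Primrec.list_range.comp Primrec.snd) h).to₂)

theorem Primrec.errB {anySt : Bool} : Primrec (RecHML.errB anySt) := by
  have hs := Primrec.stopB (anySt := anySt)
  refine Primrec.bexp_disj (Primrec.cons (Primrec.bexp_neg Primrec.distinctB)
    (Primrec.cons (Primrec.const _) (Primrec.cons (Primrec.bexp_conj (Primrec.cons (Primrec.const _)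
      (Primrec.cons (Primrec.const _) (Primrec.cons (Primrec.bexp_neg hs) (Primrec.const _)))))
    (Primrec.cons (Primrec.const _) (Primrec.cons (Primrec.const _)
    (Primrec.cons (Primrec.bexp_conj (Primrec.cons (Primrec.const _) (Primrec.cons (Primrec.const _)
      (Primrec.cons (Primrec.bexp_disj (Primrec.cons Primrec.constB (Primrec.const _)))
        (Primrec.const _)))))
    (Primrec.cons (Primrec.const _) (Primrec.cons (Primrec.bexp_conj
      (Primrec.cons (Primrec.const _) (Primrec.cons (Primrec.const _) (Primrec.cons (Primrec.const _)
        (Primrec.cons (Primrec.bexp_bor Primrec.constB (Primrec.const _)) (Primrec.const _))))))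
    (Primrec.const _)))))))))

theorem Primrec.rowB {c : Bool} {p : α → ℕ} {e : α → Bool × Bool × ℕ} (hp : Primrec p)
    (he : Primrec e) : Primrec fun a => RecHML.rowB (p a) c (e a) := by
  have h2 := Primrec.snd.comp (Primrec.snd.comp he)
  have h1 := Primrec.fst.comp (Primrec.snd.comp he)
  have h0 := Primrec.fst.comp he
  exact Primrec.bexp_bimp (Primrec.bexp_eqv (Primrec.const 2) (Primrec.add_left 38 hp))
    (Primrec.bexp_bimp (Primrec.const _) (Primrec.bexp_conj
      (Primrec.cons (Primrec.bexp_eqv (Primrec.const _) (Primrec.add_left 38 h2))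
      (Primrec.cons (Primrec.bexp_eqv (Primrec.const _) (Primrec.bif 35 34 h0))
      (Primrec.cons (Primrec.bexp_eqv (Primrec.const _) (Primrec.bif 35 34 h1))
        (Primrec.const _))))))

theorem Primrec.tableB : Primrec RecHML.tableB := by
  have he : Primrec fun x : DTM × ℕ => x.1.table.getD x.2 default :=
    (Primrec.list_getD default).comp (Primrec.dtm_table.comp Primrec.fst) Primrec.snd
  exact Primrec.bexp_conj (Primrec.list_flatMap (Primrec.list_range.comp Primrec.dtm_length)
    (Primrec.cons (Primrec.rowB Primrec.snd (Primrec.fst.comp he))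
      (Primrec.cons (Primrec.rowB Primrec.snd (Primrec.snd.comp he)) (Primrec.const []))).to₂)

theorem Primrec.transB {anySt : Bool} : Primrec (RecHML.transB anySt) := by
  have hc : Primrec RecHML.transCellB :=
    Primrec.bexp_conj (Primrec.cons (Primrec.const _) (Primrec.cons (Primrec.const _)
      (Primrec.cons (Primrec.const _) (Primrec.cons (Primrec.const _)
      (Primrec.cons (Primrec.const _) (Primrec.cons (Primrec.const _)
      (Primrec.cons Primrec.tableB (Primrec.const _))))))))
  exact Primrec.bexp_conj (Primrec.cons (Primrec.bexp_neg Primrec.stopB)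
    (Primrec.cons (Primrec.const _)
    (Primrec.cons (Primrec.bexp_bimp (Primrec.const _) hc) (Primrec.const _))))

theorem Primrec.restVars : Primrec RecHML.restVars :=
  Primrec.list_append.comp (Primrec.list_map (Primrec.list_range.comp Primrec.dtm_length)
    (Primrec.add_left 38 Primrec.snd).to₂) (Primrec.const _)

theorem Primrec.autom {d g : Bool} {X : ℕ} {anySt : Bool} :
    Primrec (RecHML.autom d g X anySt) :=
  Primrec.form_quants (Primrec.const _) (Primrec.form_modal (Primrec.const _)
    (Primrec.form_reads Primrec.restVars (Primrec.form_fixp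
      (Primrec.form_loopBody Primrec.errB Primrec.transB))))

theorem Primrec.chk {f : α → BExp} {g : α → Formula} (hf : Primrec f) (hg : Primrec g) :
    Primrec fun a => RecHML.chk (f a) (g a) :=
  Primrec.form_and (Primrec.form_nec (Primrec.bexp_neg hf) (Primrec.const _))
    (Primrec.form_nec (Primrec.const _) hg)

theorem Primrec.eqs_bif (x y : ℕ) {f : α → Bool} (hf : Primrec f) :
    Primrec fun a => eqs (bif f a then x else y) :=
  Primrec.bexp_eq (Primrec.const _) (Primrec.dexp_var (Primrec.bif x y hf))

theorem Primrec.chkBits {f : α → List Bool} {g : α → Formula} (hf : Primrec f)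
    (hg : Primrec g) : Primrec fun a => RecHML.chkBits (f a) (g a) :=
  Primrec.list_foldr hf hg (h := fun _ p => RecHML.chk (BExp.neg (eqs 33))
      (RecHML.chk (eqs (bif p.1 then 35 else 34)) p.2))
    (Primrec.chk (Primrec.const _) (Primrec.chk
      (Primrec.eqs_bif 35 34 (Primrec.fst.comp Primrec.snd)) (Primrec.snd.comp Primrec.snd))).to₂

theorem Primrec.runForm : Primrec₂ RecHML.runForm := by
  have hh : Primrec fun w : List Bool => w.headI :=
    (Primrec.option_getD.comp Primrec.list_head? (Primrec.const default)).of_eq fun w => by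
      cases w <;> rfl
  refine Primrec.form_and (Primrec.autom.comp Primrec.fst) (Primrec.form_reads
    (Primrec.cons (Primrec.const _) (Primrec.restVars.comp Primrec.fst))
    (Primrec.chk (Primrec.const _) (Primrec.chk (Primrec.const _) (Primrec.chk (Primrec.const _)
      (Primrec.chk (Primrec.eqs_bif 37 36 (hh.comp Primrec.snd)) (Primrec.chkBits
        (Primrec.list_tail.comp Primrec.snd) (Primrec.const _)))))))

theorem Primrec.nonTermForm : Primrec RecHML.nonTermForm :=
  Primrec.form_and Primrec.autom Primrec.autom

end


/-! ### Machines with a finite type of states -/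

/-- One step of a machine on a tape that is infinite to the right: the new bit, the move (`true` is
right) and the new state are functions of the state and of the bit under the head. -/
def oneWayStep {Q : Type*} (δ : Q → Bool → Bool × Bool × Q) (c : Q × (ℕ → Bool) × ℕ) :
    Q × (ℕ → Bool) × ℕ :=
  ((δ c.1 (c.2.1 c.2.2)).2.2, Function.update c.2.1 c.2.2 (δ c.1 (c.2.1 c.2.2)).1,
    if (δ c.1 (c.2.1 c.2.2)).2.1 then c.2.2 + 1 else c.2.2 - 1)

/-- The configurations continue formally past the final state; the first visit is the halting time.
-/
theorem DTM.exists_haltsAt_iff {M : DTM} {w : List Bool} :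
    (∃ n, M.HaltsAt w n) ↔ ∃ n, (M.cfg w n).state = M.final := by
  classical
  refine ⟨fun ⟨n, h⟩ => ⟨n, h.2⟩, fun h => ⟨Nat.find h, fun i hi => ?_, Nat.find_spec h⟩⟩
  exact Nat.find_min h hi

theorem exists_dtm_of_oneWay {Q : Type*} [Finite Q] (δ : Q → Bool → Bool × Bool × Q) (q₀ qf : Q) :
    ∃ M : DTM, M.Valid ∧ ∀ w : List Bool, w ≠ [] → ((∃ n, M.HaltsAt w n) ↔
      ∃ n, ((oneWayStep δ)^[n] (q₀, fun k => w.getD k false, 0)).1 = qf) := by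
  classical
  obtain ⟨N, ⟨e'⟩⟩ := Finite.exists_equiv_fin Q
  have hN : 0 < N := (Nat.zero_le _).trans_lt (e' q₀).2
  -- A transposition makes `0` the number of the initial state, as the format of machines demands.
  obtain ⟨e, he⟩ : ∃ e : Q ≃ Fin N, e q₀ = ⟨0, hN⟩ :=
    ⟨e'.trans (Equiv.swap (e' q₀) ⟨0, hN⟩), by simp⟩
  let row : Fin N → Bool → Bool × Bool × ℕ := fun p c =>
    ((δ (e.symm p) c).1, (δ (e.symm p) c).2.1, (e (δ (e.symm p) c).2.2 : ℕ))
  let M : DTM := ⟨e qf, List.ofFn fun p => (row p false, row p true)⟩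
  have hlen : M.table.length = N := List.length_ofFn
  have htrans : ∀ q c, M.trans (e q) c = ((δ q c).1, (δ q c).2.1, (e (δ q c).2.2 : ℕ)) := by
    intro q c
    have h : M.table.getD (e q) default = (row (e q) false, row (e q) true) := by
      rw [List.getD_eq_getElem _ _ (by rw [hlen]; exact (e q).2)]
      exact List.getElem_ofFn _
    rw [DTM.trans, h]
    cases c <;> simp [row]
  refine ⟨M, ⟨by rw [hlen]; exact (e qf).2, fun x hx => ?_⟩, fun w hw => ?_⟩
  · obtain ⟨p, rfl⟩ := (List.mem_ofFn' _ _).1 hx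
    rw [hlen]
    exact ⟨Fin.is_lt _, Fin.is_lt _⟩
  -- Tapes are compared through `getD`, which does not see how long the used part is.
  have key : ∀ n, (M.cfg w n).state = e ((oneWayStep δ)^[n] (q₀, fun k => w.getD k false, 0)).1 ∧
      (fun k => (M.cfg w n).tape.getD k false) =
        ((oneWayStep δ)^[n] (q₀, fun k => w.getD k false, 0)).2.1 ∧
      (M.cfg w n).head = ((oneWayStep δ)^[n] (q₀, fun k => w.getD k false, 0)).2.2 := by
    intro n
    induction n with
    | zero => exact ⟨by simp [DTM.cfg, he], rfl, rfl⟩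
    | succ n ih =>
      rw [Function.iterate_succ_apply']
      generalize (oneWayStep δ)^[n] (q₀, fun k => w.getD k false, 0) = c at ih
      obtain ⟨h1, h2, h3⟩ := ih
      have h2' : ∀ k, (M.cfg w n).tape.getD k false = c.2.1 k := fun k => congrFun h2 k
      have ha : M.act w n = ((δ c.1 (c.2.1 c.2.2)).1, (δ c.1 (c.2.1 c.2.2)).2.1,
          (e (δ c.1 (c.2.1 c.2.2)).2.2 : ℕ)) := by
        rw [DTM.act, h1, h2', h3, htrans]
      refine ⟨by rw [DTM.state_succ, ha]; rfl, ?_, by rw [DTM.head_succ, ha, h3]; rfl⟩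
      funext k
      rw [DTM.getD_succ hw, ha, h2', h3]
      exact (Function.update_apply _ _ _ _).symm
  rw [DTM.exists_haltsAt_iff]
  refine exists_congr fun n => ?_
  rw [(key n).1]
  exact ⟨fun h => e.injective (Fin.ext h), fun h => by rw [h]⟩

/-- Simulation of a partial step function by a machine that takes several steps for one. -/
theorem eval_dom_iff_of_simulation {σ τ : Type*} {f : σ → Option σ} {g : τ → τ} {fin : τ → Prop}
    {R : σ → τ → Prop}
    (H : ∀ a b, R a b → ∃ n, (∀ i < n, ¬ fin (g^[i] b)) ∧
      (f a).elim (fin (g^[n] b)) fun a' => 0 < n ∧ R a' (g^[n] b)) {a : σ} {b : τ} (h : R a b) :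
    (StateTransition.eval f a).Dom ↔ ∃ n, fin (g^[n] b) := by
  constructor
  · intro hd
    obtain ⟨c, hc⟩ := Part.dom_iff_mem.1 hd
    have key : ∀ b, R a b → ∃ n, fin (g^[n] b) := by
      refine StateTransition.evalInduction (C := fun a => ∀ b, R a b → ∃ n, fin (g^[n] b)) hc ?_
      intro a _ ih b hb
      obtain ⟨n, -, hn⟩ := H a b hb
      cases e : f a with
      | none => rw [e] at hn; exact ⟨n, hn⟩
      | some a' =>
        rw [e] at hn
        obtain ⟨m, hm⟩ := ih a' e _ hn.2
        exact ⟨m + n, by rwa [Function.iterate_add_apply]⟩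
    exact key b h
  · rintro ⟨n, hn⟩
    induction n using Nat.strong_induction_on generalizing a b with
    | _ n ih =>
      obtain ⟨m, hm, hf⟩ := H a b h
      cases e : f a with
      | none =>
        exact Part.dom_iff_mem.2 ⟨a, StateTransition.mem_eval.2 ⟨Relation.ReflTransGen.refl, e⟩⟩
      | some a' =>
        rw [e] at hf
        -- No final configuration is met during the simulation of one step. Since that takes at
        -- least one step, the induction decreases.
        have hle : m ≤ n := by
          by_contra hlt
          exact hm n (by omega) hn
        have := ih (n - m) (by have := hf.1; omega) hf.2 (by
          rw [← Function.iterate_add_apply, Nat.sub_add_cancel hle]; exact hn)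
        rwa [StateTransition.reaches_eval (Relation.ReflTransGen.single e)]

/-! ### Two-way tapes -/

/-- The states of the machine that simulates a machine with a two-way tape. The cells of its tape
form groups of three: a mark in the first group, a cell of the right half of the simulated tape,
and a cell of the left half (`side = false`). -/
inductive FoldState (Λ : Type*) : Type _
  | halt : FoldState Λ
  | main : Λ → Bool → FoldState Λ
  | go₁ : Bool → Λ → Bool → FoldState Λ
  | go₂ : Bool → Λ → Bool → FoldState Λ
  | toMark : Λ → FoldState Λ
  | mark : Λ → Bool → FoldState Λ

instance {Λ : Type*} [Finite Λ] : Finite (FoldState Λ) := by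
  let f : FoldState Λ → Option (Fin 5 × Λ × Bool × Bool) := fun s => match s with
    | FoldState.halt => none
    | FoldState.main q s => some (0, q, s, false)
    | FoldState.go₁ d q s => some (1, q, s, d)
    | FoldState.go₂ d q s => some (2, q, s, d)
    | FoldState.toMark q => some (3, q, false, false)
    | FoldState.mark q s => some (4, q, s, false)
  refine Finite.of_injective f fun a b h => ?_
  cases a <;> cases b <;> simp_all [f]

/-- The transition function of the simulating machine. -/
def foldTrans {Λ : Type*} (M : Λ → Bool → Option (Λ × Turing.TM0.Stmt Bool)) :
    FoldState Λ → Bool → Bool × Bool × FoldState Λ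
  | FoldState.halt, a => (a, true, FoldState.halt)
  | FoldState.main q side, a => match M q a with
    | none => (a, true, FoldState.halt)
    -- Every step moves the head, so writing in place takes a step to the right and one back.
    | some (q', Turing.TM0.Stmt.write b) => (b, true, FoldState.go₁ false q' side)
    | some (q', Turing.TM0.Stmt.move Turing.Dir.right) =>
      if side then (a, true, FoldState.go₂ true q' true) else (a, false, FoldState.toMark q')
    | some (q', Turing.TM0.Stmt.move Turing.Dir.left) =>
      if side then (a, false, FoldState.mark q' true) else (a, true, FoldState.go₂ true q' false)
  | FoldState.go₁ d q side, a => (a, d, FoldState.main q side)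
  | FoldState.go₂ d q side, a => (a, d, FoldState.go₁ d q side)
  | FoldState.toMark q, a => (a, false, FoldState.mark q false)
  | FoldState.mark q true, a =>
    if a then (a, true, FoldState.go₁ true q false) else (a, false, FoldState.go₁ false q true)
  -- The bit of the mark decides both the direction and the half: in the first group the head
  -- crosses from cell `-1` to cell `0`, elsewhere it goes on to the left cell of the group before.
  | FoldState.mark q false, a => (a, a, FoldState.main q (a : Bool))

/-- The tape of the simulating machine for the content `A` of a two-way tape. -/
structure FoldTape (A : ℤ → Bool) (f : ℕ → Bool) : Prop where
  mark : ∀ j : ℕ, f (3 * j) = decide (j = 0)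
  right : ∀ j : ℕ, f (3 * j + 1) = A j
  left : ∀ j : ℕ, f (3 * j + 2) = A (-1 - j)

/-- A configuration is simulated by another one. -/
def FoldRel {Λ : Type*} [Inhabited Λ] (c : Turing.TM0.Cfg Bool Λ)
    (c' : FoldState Λ × (ℕ → Bool) × ℕ) : Prop :=
  ∃ (A : ℤ → Bool) (i : ℕ) (side : Bool), c'.1 = FoldState.main c.q side ∧ FoldTape A c'.2.1 ∧
    c'.2.2 = 3 * i + (if side then 1 else 2) ∧
    ∀ k : ℤ, c.Tape.nth k = A ((if side then (i : ℤ) else -1 - i) + k)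

theorem oneWayStep_same {Q : Type*} {δ : Q → Bool → Bool × Bool × Q} {q q' : Q} {f : ℕ → Bool}
    {h h' : ℕ} {d : Bool} (e : δ q (f h) = (f h, d, q')) (e' : h' = if d then h + 1 else h - 1) :
    oneWayStep δ (q, f, h) = (q', f, h') := by
  simp [oneWayStep, e, e']

theorem iterate_three {τ : Type*} {g : τ → τ} {fin : τ → Prop} {b b₁ b₂ b₃ : τ}
    (h₁ : g b = b₁) (h₂ : g b₁ = b₂) (h₃ : g b₂ = b₃) (f : ¬ fin b) (f₁ : ¬ fin b₁)
    (f₂ : ¬ fin b₂) : (∀ i < 3, ¬ fin (g^[i] b)) ∧ g^[3] b = b₃ := by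
  subst h₁ h₂ h₃
  refine ⟨fun i hi => ?_, rfl⟩
  interval_cases i <;> assumption

/-- A simulated move takes three steps in either half and direction, also when it crosses between
the halves in group `0`; a write takes two and halting one. -/
theorem FoldRel.step {Λ : Type*} [Inhabited Λ] (M : Turing.TM0.Machine Bool Λ)
    (c : Turing.TM0.Cfg Bool Λ) (c' : FoldState Λ × (ℕ → Bool) × ℕ) (H : FoldRel c c') :
    ∃ n, (∀ i < n, ¬ ((oneWayStep (foldTrans M))^[i] c').1 = FoldState.halt) ∧
      (Turing.TM0.step M c).elim (((oneWayStep (foldTrans M))^[n] c').1 = FoldState.halt)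
        fun d => 0 < n ∧ FoldRel d ((oneWayStep (foldTrans M))^[n] c') := by
  obtain ⟨q, T⟩ := c
  obtain ⟨s, f, h⟩ := c'
  obtain ⟨A, i, side, hs, hf, hh, hT⟩ := H
  dsimp only at hs hf hh hT
  subst hs hh
  have hbit : f (3 * i + if side then 1 else 2) = T.1 := by
    have h0 := hT 0
    rw [Turing.Tape.nth_zero] at h0
    cases side <;> simp only [hf.left, hf.right, h0, add_zero, if_true, Bool.false_eq_true, if_false]
  have h1 : f (3 * i) = decide (i = 0) := hf.mark i
  rcases e : M q T.1 with - | ⟨q', b | b⟩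
  · refine ⟨1, fun j hj => ?_, ?_⟩
    · interval_cases j; simp
    · simp [Turing.TM0.step, e, oneWayStep, foldTrans, hbit]
  · have fin : ∀ (b₁ b₂ b₃ : FoldState Λ × (ℕ → Bool) × ℕ),
        oneWayStep (foldTrans M) (FoldState.main q side, f, 3 * i + if side then 1 else 2) = b₁ →
        oneWayStep (foldTrans M) b₁ = b₂ → oneWayStep (foldTrans M) b₂ = b₃ →
        b₁.1 ≠ FoldState.halt → b₂.1 ≠ FoldState.halt → FoldRel ⟨q', T.move b⟩ b₃ →
        ∃ n, (∀ j < n, ¬ ((oneWayStep (foldTrans M))^[j]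
          (FoldState.main q side, f, 3 * i + if side then 1 else 2)).1 = FoldState.halt) ∧
          0 < n ∧ FoldRel ⟨q', T.move b⟩ ((oneWayStep (foldTrans M))^[n]
            (FoldState.main q side, f, 3 * i + if side then 1 else 2)) := by
      intro b₁ b₂ b₃ e₁ e₂ e₃ f₁ f₂ hr
      obtain ⟨h3, h4⟩ := iterate_three (fin := fun b => b.1 = FoldState.halt) e₁ e₂ e₃
        (by simp) f₁ f₂
      exact ⟨3, h3, by omega, by rwa [h4]⟩
    have est : Turing.TM0.step M ⟨q, T⟩ = some ⟨q', T.move b⟩ := by simp [Turing.TM0.step, e]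
    rw [est]
    cases b
    · cases side
      · refine fin _ _ (FoldState.main q' false, f, 3 * i + 5)
          (oneWayStep_same (q' := FoldState.go₂ true q' false) (d := true)
            (by rw [hbit]; simp [foldTrans, e]) rfl)
          (oneWayStep_same (q' := FoldState.go₁ true q' false) (d := true) rfl rfl)
          (oneWayStep_same (d := true) rfl rfl) (by simp) (by simp)
          ⟨A, i + 1, false, rfl, hf, rfl, fun k => ?_⟩
        rw [Turing.Tape.move_left_nth, hT]
        congr 1
        push_cast
        ring
      · obtain rfl | ⟨j, rfl⟩ : i = 0 ∨ ∃ j, i = j + 1 := by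
          cases i
          · exact Or.inl rfl
          · exact Or.inr ⟨_, rfl⟩
        · have h1' : f 0 = true := h1
          refine fin _ _ (FoldState.main q' false, f, 2)
            (oneWayStep_same (q' := FoldState.mark q' true) (h' := 0) (d := false)
              (by rw [hbit]; simp [foldTrans, e]) rfl)
            (oneWayStep_same (q' := FoldState.go₁ true q' false) (h' := 1) (d := true)
              (by simp [foldTrans, h1']) rfl)
            (oneWayStep_same (d := true) rfl rfl) (by simp) (by simp)
            ⟨A, 0, false, rfl, hf, rfl, fun k => ?_⟩
          rw [Turing.Tape.move_left_nth, hT]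
          congr 1
          simp
          ring
        · have h1' : f (3 * j + 3) = false := by simpa [mul_add] using h1
          refine fin _ _ (FoldState.main q' true, f, 3 * j + 1)
            (oneWayStep_same (q' := FoldState.mark q' true) (h' := 3 * j + 3) (d := false)
              (by rw [hbit]; simp [foldTrans, e]) rfl)
            (oneWayStep_same (q' := FoldState.go₁ false q' true) (h' := 3 * j + 2) (d := false)
              (by simp [foldTrans, h1']) rfl)
            (oneWayStep_same (d := false) rfl rfl) (by simp) (by simp)
            ⟨A, j, true, rfl, hf, rfl, fun k => ?_⟩
          rw [Turing.Tape.move_left_nth, hT]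
          congr 1
          simp
    · cases side
      · obtain rfl | ⟨j, rfl⟩ : i = 0 ∨ ∃ j, i = j + 1 := by
          cases i
          · exact Or.inl rfl
          · exact Or.inr ⟨_, rfl⟩
        · have h1' : f 0 = true := h1
          refine fin _ _ (FoldState.main q' true, f, 1)
            (oneWayStep_same (q' := FoldState.toMark q') (h' := 1) (d := false)
              (by rw [hbit]; simp [foldTrans, e]) rfl)
            (oneWayStep_same (q' := FoldState.mark q' false) (h' := 0) (d := false) rfl rfl)
            (oneWayStep_same (d := true) (by simp [foldTrans, h1']) rfl) (by simp) (by simp)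
            ⟨A, 0, true, rfl, hf, rfl, fun k => ?_⟩
          rw [Turing.Tape.move_right_nth, hT]
          congr 1
          simp
        · have h1' : f (3 * j + 3) = false := by simpa [mul_add] using h1
          refine fin _ _ (FoldState.main q' false, f, 3 * j + 2)
            (oneWayStep_same (q' := FoldState.toMark q') (h' := 3 * j + 4) (d := false)
              (by rw [hbit]; simp [foldTrans, e]) rfl)
            (oneWayStep_same (q' := FoldState.mark q' false) (h' := 3 * j + 3) (d := false) rfl rfl)
            (oneWayStep_same (d := false) (by simp [foldTrans, h1']) rfl) (by simp) (by simp)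
            ⟨A, j, false, rfl, hf, rfl, fun k => ?_⟩
          rw [Turing.Tape.move_right_nth, hT]
          congr 1
          simp
          ring
      · refine fin _ _ (FoldState.main q' true, f, 3 * i + 4)
          (oneWayStep_same (q' := FoldState.go₂ true q' true) (d := true)
            (by rw [hbit]; simp [foldTrans, e]) rfl)
          (oneWayStep_same (q' := FoldState.go₁ true q' true) (d := true) rfl rfl)
          (oneWayStep_same (d := true) rfl rfl) (by simp) (by simp)
          ⟨A, i + 1, true, rfl, hf, rfl, fun k => ?_⟩
        rw [Turing.Tape.move_right_nth, hT]
        congr 1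
        push_cast
        simp only [if_true]
        ring
  · have est : Turing.TM0.step M ⟨q, T⟩ = some ⟨q', T.write b⟩ := by simp [Turing.TM0.step, e]
    rw [est]
    obtain ⟨p, hp⟩ : ∃ p, p = 3 * i + if side then 1 else 2 := ⟨_, rfl⟩
    rw [← hp] at hbit ⊢
    have e₁ : oneWayStep (foldTrans M) (FoldState.main q side, f, p) =
        (FoldState.go₁ false q' side, Function.update f p b, p + 1) := by
      simp [oneWayStep, foldTrans, hbit, e]
    have e₂ : oneWayStep (foldTrans M) (FoldState.go₁ false q' side, Function.update f p b, p + 1) =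
        (FoldState.main q' side, Function.update f p b, p) := oneWayStep_same (d := false) rfl rfl
    refine ⟨2, fun j hj => ?_, by omega, ?_⟩
    · interval_cases j
      · simp
      · rw [Function.iterate_one, e₁]; simp
    · rw [Function.iterate_succ_apply, Function.iterate_one, e₁, e₂]
      refine ⟨Function.update A (if side then (i : ℤ) else -1 - i) b, i, side, rfl, ⟨?_, ?_, ?_⟩,
        hp, fun k => ?_⟩
      · intro j
        have hne : 3 * j ≠ p := by cases side <;> simp at hp <;> omega
        exact (Function.update_of_ne hne _ _).trans (hf.mark j)
      · intro j
        simp only [Function.update_apply, hf.right]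
        refine if_congr ?_ rfl rfl
        cases side <;> simp at hp ⊢ <;> omega
      · intro j
        simp only [Function.update_apply, hf.left]
        refine if_congr ?_ rfl rfl
        cases side <;> simp at hp ⊢ <;> omega
      · rw [Turing.Tape.write_nth]
        simp only [Function.update_apply, hT]
        refine if_congr ?_ rfl rfl
        constructor <;> intro h <;> omega

/-- The initial tape of the simulating machine. -/
def foldCells (l : List Bool) : List Bool := l.flatMap fun a => [false, a, false]

theorem foldCells_getD (l : List Bool) (j : ℕ) :
    (foldCells l).getD (3 * j) false = false ∧
    (foldCells l).getD (3 * j + 1) false = l.getD j false ∧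
    (foldCells l).getD (3 * j + 2) false = false := by
  induction l generalizing j with
  | nil => simp [foldCells]
  | cons a l ih =>
    have e : foldCells (a :: l) = false :: a :: false :: foldCells l := rfl
    rw [e]
    cases j with
    | zero => simp
    | succ j => exact ih j

theorem foldTape_init (a : Bool) (l : List Bool) :
    FoldTape (fun z => (Turing.Tape.mk₁ (a :: l)).nth z)
      (fun k => (true :: a :: false :: foldCells l).getD k false) where
  mark j := by
    cases j with
    | zero => rfl
    | succ j => exact (foldCells_getD l j).1
  right j := by
    have h : (true :: a :: false :: foldCells l).getD (3 * j + 1) false = (a :: l).getD j false := by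
      cases j with
      | zero => rfl
      | succ j => exact (foldCells_getD l j).2.1
    refine h.trans ?_
    rw [Turing.Tape.mk₁, Turing.Tape.mk₂, Turing.Tape.mk'_nth_nat, Turing.ListBlank.nth_mk]
    exact List.getD_default_eq_getI _
  left j := by
    have : (true :: a :: false :: foldCells l).getD (3 * j + 2) false = false := by
      cases j with
      | zero => rfl
      | succ j => exact (foldCells_getD l j).2.2
    refine this.trans ?_
    rw [show (-1 - (j : ℤ)) = Int.negSucc j by omega]
    change false = (Turing.ListBlank.mk []).nth j
    rw [Turing.ListBlank.nth_mk, List.getI_nil]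
    rfl

/-- Restriction to a finite supporting set makes the states a finite type. The head starts on the
mark, so one extra step takes it to cell `0`. -/
theorem exists_dtm_of_TM0 {Λ : Type*} [Inhabited Λ] (M : Turing.TM0.Machine Bool Λ) (S : Set Λ)
    (hfin : S.Finite) (hS : Turing.TM0.Supports M S) :
    ∃ U : DTM, U.Valid ∧ ∀ (a : Bool) (l : List Bool),
      ((∃ n, U.HaltsAt (true :: a :: false :: foldCells l) n) ↔
        (Turing.TM0.eval M (a :: l)).Dom) := by
  classical
  have : Finite S := hfin
  let _ : Inhabited S := ⟨⟨default, hS.1⟩⟩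
  let g₁ : Turing.PointedMap Λ S :=
    ⟨fun q => if h : q ∈ S then ⟨q, h⟩ else default, by
      split_ifs <;> rfl⟩
  let ι : Turing.PointedMap Bool Bool := ⟨id, rfl⟩
  let M' : Turing.TM0.Machine Bool S := M.map ι ι g₁ Subtype.val
  have hresp := Turing.TM0.Machine.map_respects M ι ι g₁ Subtype.val hS (fun _ => rfl)
    (fun q hq => by simp [g₁, hq])
  obtain ⟨U, hU, h⟩ := exists_dtm_of_oneWay (foldTrans M') (FoldState.go₁ true default true)
    FoldState.halt
  refine ⟨U, hU, fun a l => ?_⟩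
  have hinit : Turing.TM0.Cfg.map ι g₁ (Turing.TM0.init (a :: l)) =
      (Turing.TM0.init (a :: l) : Turing.TM0.Cfg Bool S) := by
    rw [Turing.TM0.map_init]
    simp [ι]
  have e1 : (Turing.TM0.eval M (a :: l)).Dom ↔
      (StateTransition.eval (Turing.TM0.step M') (Turing.TM0.init (a :: l))).Dom :=
    (StateTransition.tr_eval_dom hresp ⟨hS.1, hinit⟩).symm
  have hrel : FoldRel (Turing.TM0.init (a :: l) : Turing.TM0.Cfg Bool S)
      (FoldState.main default true,
        fun k => (true :: a :: false :: foldCells l).getD k false, 1) :=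
    ⟨_, 0, true, rfl, foldTape_init a l, rfl, fun k => by simp [Turing.TM0.init]⟩
  rw [h _ (by simp), e1, eval_dom_iff_of_simulation
    (g := oneWayStep (foldTrans M')) (fin := fun b : FoldState S × (ℕ → Bool) × ℕ => b.1 = FoldState.halt)
    (FoldRel.step M') hrel]
  have e2 : oneWayStep (foldTrans M') (FoldState.go₁ true default true,
      fun k => (true :: a :: false :: foldCells l).getD k false, 0) = (FoldState.main default true,
      fun k => (true :: a :: false :: foldCells l).getD k false, 1) :=
    oneWayStep_same (d := true) rfl rfl
  constructor
  · rintro ⟨n, hn⟩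
    cases n with
    | zero => cases hn
    | succ n => exact ⟨n, by rwa [Function.iterate_succ_apply, e2] at hn⟩
  · rintro ⟨n, hn⟩
    exact ⟨n + 1, by rwa [Function.iterate_succ_apply, e2]⟩


/-! ### A family of runs with an undecidable halting problem -/

section

open Turing

theorem flatMap_flatten_replicate {α β : Type*} (f : α → List β) (l : List α) (m : ℕ) :
    (List.replicate m l).flatten.flatMap f = (List.replicate m (l.flatMap f)).flatten := by
  induction m with
  | zero => rfl
  | succ m ih => simp [List.replicate_succ, List.flatMap_append, ih]

theorem trTape_mk₁ {Γ : Type*} [Inhabited Γ] {n : ℕ} {enc : Γ → List.Vector Bool n}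
    (enc0 : enc default = List.Vector.replicate n false) (l : List Γ) :
    TM1to1.trTape enc0 (Tape.mk₁ l) = Tape.mk₁ (l.flatMap fun a => (enc a).toList) := by
  rw [Tape.mk₁, Tape.mk₂, TM1to1.trTape_mk', TM1to1.trTape', ListBlank.flatMap_mk,
    ListBlank.flatMap_mk]
  rfl

/-- Letters become words of bits of a fixed length, so a power of a letter becomes a power of a
word, and `u`, `v` do not depend on `m`. As `x ≠ y`, this length is positive, which gives the
simulated tape a first bit. -/
theorem exists_dtm_of_TM1 {Γ Λ σ : Type} [Inhabited Γ] [Fintype Γ] [Inhabited Λ] [Inhabited σ]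
    [Fintype σ] (M : Λ → TM1.Stmt Γ Λ σ) (S : Finset Λ) (hS : TM1.Supports M S) (x y : Γ)
    (hxy : x ≠ y) : ∃ (U : DTM) (u v : List Bool), U.Valid ∧ u ≠ [] ∧ ∀ m,
      ((∃ n, U.HaltsAt (u ++ (List.replicate m v).flatten) n) ↔
        (TM1.eval M (x :: List.replicate m y)).Dom) := by
  obtain ⟨n, enc, dec, enc0, encdec⟩ := TM1to1.exists_enc_dec (Γ := Γ)
  let M₁ := TM1to1.tr enc dec M
  have hS₁ := TM1to1.tr_supports (enc := enc) (dec := dec) M hS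
  obtain ⟨U, hU, h⟩ := exists_dtm_of_TM0 (TM1to0.tr M₁) _ (Finset.finite_toSet _)
    (TM1to0.tr_supports M₁ hS₁)
  obtain ⟨a, l, hx⟩ : ∃ a l, (enc x).toList = a :: l := by
    cases e : (enc x).toList with
    | cons a l => exact ⟨a, l, rfl⟩
    | nil =>
      have h0 : n = 0 := by rw [← (enc x).toList_length, e]; rfl
      subst h0
      exact absurd ((encdec x).symm.trans ((congrArg dec (Subsingleton.elim _ _)).trans
        (encdec y))) hxy
  refine ⟨U, true :: a :: false :: foldCells l, foldCells (enc y).toList, hU, by simp, fun m => ?_⟩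
  have e1 : true :: a :: false :: foldCells l ++ (List.replicate m (foldCells (enc y).toList)).flatten
      = true :: a :: false :: foldCells (l ++ (List.replicate m (enc y).toList).flatten) := by
    simp only [foldCells, List.flatMap_append, flatMap_flatten_replicate, List.cons_append]
  have e2 : a :: (l ++ (List.replicate m (enc y).toList).flatten) =
      (x :: List.replicate m y).flatMap fun a => (enc a).toList := by
    rw [List.flatMap_cons, hx, List.flatMap_def, List.map_replicate]; rfl
  rw [e1, h, e2, TM1to0.tr_eval]
  have e3 : TM1to1.trCfg enc enc0 (TM1.init (x :: List.replicate m y) : TM1.Cfg Γ Λ σ) =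
      TM1.init ((x :: List.replicate m y).flatMap fun a => (enc a).toList) := by
    rw [TM1.init, TM1to1.trCfg, trTape_mk₁]
    rfl
  exact StateTransition.tr_eval_dom (TM1to1.tr_respects (dec := dec) M encdec) e3

/-- The tape holds the stack with its bottom to the left, hence the reversal: the bottom letter `y`
is the one letter that carries the bottom mark. -/
theorem exists_dtm_of_TM2 {K Λ σ Γ : Type} [DecidableEq K] [Fintype K] [Fintype Γ]
    [Inhabited Λ] [Inhabited σ] [Fintype σ] (M : Λ → TM2.Stmt (fun _ : K => Γ) Λ σ)
    (S : Finset Λ) (hS : TM2.Supports M S) (k : K) (x y : Γ) :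
    ∃ (U : DTM) (u v : List Bool), U.Valid ∧ u ≠ [] ∧ ∀ m,
      ((∃ n, U.HaltsAt (u ++ (List.replicate m v).flatten) n) ↔
        (TM2.eval M k (List.replicate m x ++ [y])).Dom) := by
  obtain ⟨U, u, v, hU, hu, h⟩ := exists_dtm_of_TM1 (TM2to1.tr M) _ (TM2to1.tr_supports M hS)
    (true, Function.update (fun _ => none) k (some y))
    (false, Function.update (fun _ => none) k (some x))
    (fun h => Bool.noConfusion (congrArg Prod.fst h))
  refine ⟨U, u, v, hU, hu, fun m => ?_⟩
  rw [h, ← TM2to1.tr_eval_dom]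
  have : TM2to1.trInit k (List.replicate m x ++ [y]) =
      ((true, Function.update (fun _ => none) k (some y)) :: List.replicate m
        (false, Function.update (fun _ => none) k (some x)) : List (TM2to1.Γ' K fun _ => Γ)) := by
    rw [TM2to1.trInit, List.reverse_append, List.reverse_replicate]
    exact congrArg (List.cons _) List.map_replicate
  rw [this]

/-- The positive number `2 ^ (k + 1) - 1`. -/
def onesNum : ℕ → PosNum
  | 0 => PosNum.one
  | k + 1 => PosNum.bit1 (onesNum k)

theorem onesNum_cast (k : ℕ) : ((onesNum k : PosNum) : ℕ) = 2 ^ (k + 1) - 1 := by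
  induction k with
  | zero => rfl
  | succ k ih =>
    rw [onesNum, PosNum.cast_bit1, ih]
    have : 0 < 2 ^ (k + 1) := by positivity
    rw [pow_succ 2 (k + 1)]
    omega

/-- These numbers have only ones in binary, so as inputs they are powers of a single letter. The
inputs of the final machine can thus be computed without any knowledge of how letters are encoded.
-/
theorem trNat_two_pow_sub_one (k : ℕ) :
    PartrecToTM2.trNat (2 ^ k - 1) = List.replicate k PartrecToTM2.Γ'.bit1 := by
  cases k with
  | zero => rfl
  | succ k =>
    have e : ((2 ^ (k + 1) - 1 : ℕ) : Num) = Num.pos (onesNum k) := by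
      rw [← onesNum_cast]; exact PosNum.cast_to_num _ ▸ (by simp)
    rw [PartrecToTM2.trNat, e, PartrecToTM2.trNum]
    clear e
    induction k with
    | zero => rfl
    | succ k ih => rw [onesNum, PartrecToTM2.trPosNum, ih]; rfl

instance : Fintype PartrecToTM2.K' :=
  ⟨{PartrecToTM2.K'.main, PartrecToTM2.K'.rev, PartrecToTM2.K'.aux, PartrecToTM2.K'.stack},
    fun k => by cases k <;> simp⟩

theorem exists_dtm_of_code (c : ToPartrec.Code) :
    ∃ (U : DTM) (u v : List Bool), U.Valid ∧ u ≠ [] ∧ ∀ m,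
      ((∃ n, U.HaltsAt (u ++ (List.replicate m v).flatten) n) ↔ (c.eval [2 ^ m - 1]).Dom) := by
  obtain ⟨U, u, v, hU, hu, h⟩ := @exists_dtm_of_TM2 PartrecToTM2.K' PartrecToTM2.Λ'
    (Option PartrecToTM2.Γ') PartrecToTM2.Γ' _ _ _
    ⟨PartrecToTM2.trNormal c PartrecToTM2.Cont'.halt⟩ _ _ PartrecToTM2.tr _
    (PartrecToTM2.tr_supports c PartrecToTM2.Cont'.halt) PartrecToTM2.K'.main
    PartrecToTM2.Γ'.bit1 PartrecToTM2.Γ'.cons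
  refine ⟨U, u, v, hU, hu, fun m => ?_⟩
  rw [h]
  have e : @TM2.init PartrecToTM2.K' (fun _ => PartrecToTM2.Γ') PartrecToTM2.Λ' (Option PartrecToTM2.Γ')
      ⟨PartrecToTM2.trNormal c PartrecToTM2.Cont'.halt⟩ _ _ PartrecToTM2.K'.main
      (List.replicate m PartrecToTM2.Γ'.bit1 ++ [PartrecToTM2.Γ'.cons]) =
      PartrecToTM2.init c [2 ^ m - 1] := by
    rw [PartrecToTM2.init, PartrecToTM2.trList, PartrecToTM2.trList, trNat_two_pow_sub_one]
    refine congrArg (TM2.Cfg.mk (some (PartrecToTM2.trNormal c PartrecToTM2.Cont'.halt)) none)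
      (funext fun k => ?_)
    cases k <;> rfl
  have h2 := PartrecToTM2.tr_eval c [2 ^ m - 1]
  rw [← e] at h2
  have h3 := congrArg Part.Dom h2
  exact iff_of_eq h3

/-- `g` is a logarithm that inverts `k ↦ 2 ^ k - 1`. The machine for `f` therefore runs, on its
input for `m`, the code with number `m` at `0`, and deciding its termination would decide the
halting problem for codes. -/
theorem exists_undecidable_halting : ∃ (U : DTM) (u v : List Bool), U.Valid ∧ u ≠ [] ∧
    ¬ ComputablePred fun m => ∃ n, U.HaltsAt (u ++ (List.replicate m v).flatten) n := by
  let g : ℕ → ℕ := fun m => Nat.findGreatest (fun k => 2 ^ k ≤ m + 1) (m + 1)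
  have hpow : Primrec fun k : ℕ => 2 ^ k :=
    (Primrec.nat_rec₁ 1 (Primrec.nat_mul.comp Primrec.snd (Primrec.const 2)).to₂).of_eq fun k => by
      induction k with
      | zero => rfl
      | succ k ih => rw [pow_succ, ← ih]
  have hg : Primrec g := Primrec.nat_findGreatest Primrec.succ
    (Primrec.nat_le.comp (hpow.comp Primrec.snd) (Primrec.succ.comp Primrec.fst))
  have hg' : ∀ k, g (2 ^ k - 1) = k := by
    intro k
    have h0 : 0 < 2 ^ k := by positivity
    have h1 : 2 ^ k - 1 + 1 = 2 ^ k := by omega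
    simp only [g, h1]
    rw [Nat.findGreatest_eq_iff]
    refine ⟨Nat.lt_two_pow_self.le, fun _ => le_rfl, fun n hn _ => ?_⟩
    exact not_le.2 (Nat.pow_lt_pow_right (by norm_num) hn)
  let f : ℕ →. ℕ := fun m => (Denumerable.ofNat Nat.Partrec.Code (g m)).eval 0
  have hf : Partrec f :=
    Nat.Partrec.Code.eval_part.comp ((Computable.ofNat _).comp hg.to_comp) (Computable.const 0)
  obtain ⟨c, hc⟩ := ToPartrec.Code.exists_code (Nat.Partrec'.part_iff₁.2 hf)
  obtain ⟨U, u, v, hU, hu, h⟩ := exists_dtm_of_code c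
  refine ⟨U, u, v, hU, hu, fun hcomp => ComputablePred.halting_problem 0 ?_⟩
  refine ComputablePred.computable_of_manyOneReducible ⟨Encodable.encode, Computable.encode,
    fun d => ?_⟩ hcomp
  have e := congrArg Part.Dom (hc ⟨[2 ^ Encodable.encode d - 1], rfl⟩)
  rw [h]
  change (c.eval [2 ^ Encodable.encode d - 1]).Dom = (f (2 ^ Encodable.encode d - 1)).Dom at e
  rw [e]
  simp only [f, hg', Denumerable.ofNat_encode]

end


/-! ### Monitorability of the formula for a run -/

section
variable {D : Type*} {M : DTM} {w : List Bool}

/-- Closing the acceptance predicate under extension makes it irrevocable and accepts no further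
traces; nothing is ever rejected. -/
theorem EffMonitorableSat.monitorableSat [Primcodable D] {T : Set (Trace D)}
    (h : EffMonitorableSat T) : MonitorableSat T := by
  obtain ⟨A, -, hA⟩ := h
  have htake : ∀ (t : Trace D) (n : ℕ) (y : List D), y <+: t.take n → ∃ k, y = t.take k := by
    intro t n y hy
    refine ⟨min y.length n, (List.prefix_iff_eq_take.1 hy).trans ?_⟩
    rw [Trace.take, ← List.map_take, List.take_range, Trace.take]
  refine ⟨⟨fun w => ∃ y, y <+: w ∧ A y, fun _ => False, fun _ h => h.2,
    fun w w' hw h => ?_, fun _ _ _ h => h⟩, fun t h => ?_, fun t h => ?_⟩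
  · obtain ⟨y, h1, h2⟩ := h
    exact ⟨y, h1.trans hw, h2⟩
  · obtain ⟨n, y, h1, h2⟩ := h
    obtain ⟨k, rfl⟩ := htake t n y h1
    exact (hA t).2 ⟨k, h2⟩
  · obtain ⟨n, h⟩ := (hA t).1 h
    exact ⟨n, _, List.prefix_rfl, h⟩

theorem primrecPred_forall_mem {α β : Type*} [Primcodable α] {p : β → α → Prop} (l : List β)
    (h : ∀ b ∈ l, PrimrecPred (p b)) : PrimrecPred fun a => ∀ b ∈ l, p b a := by
  induction l with
  | nil => exact ⟨fun _ => isTrue (by simp), (Primrec.const true).of_eq fun a => by simp⟩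
  | cons b l ih =>
    exact ((h b List.mem_cons_self).and (ih fun c hc => h c (List.mem_cons_of_mem _ hc))).of_eq
      fun a => by simp

/-- The words that arise from a given word of symbols by an injective valuation. -/
theorem primrecPred_pattern [Primcodable D] [Infinite D] (W : List Symb) :
    PrimrecPred fun l : List D => ∃ v : Symb → D, Function.Injective v ∧ l = W.map v := by
  have h1 : PrimrecPred fun l : List D => l.length = W.length :=
    Primrec.eq.comp Primrec.list_length (Primrec.const _)
  -- A word is an injective renaming of `W` iff it has the same length and the same equalities
  -- between positions; as `D` is infinite, the renaming extends to all symbols.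
  have h2 : PrimrecPred fun l : List D => ∀ i ∈ List.range W.length, ∀ j ∈ List.range W.length,
      (l[i]? = l[j]? ↔ W[i]? = W[j]?) := by
    refine primrecPred_forall_mem _ fun i _ => primrecPred_forall_mem _ fun j _ => ?_
    have h : PrimrecPred fun l : List D => l[i]? = l[j]? :=
      Primrec.eq.comp (Primrec.list_getElem?.comp Primrec.id (Primrec.const i))
        (Primrec.list_getElem?.comp Primrec.id (Primrec.const j))
    by_cases hW : W[i]? = W[j]?
    · exact h.of_eq fun l => by simp [hW]
    · exact h.not.of_eq fun l => by simp [hW]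
  refine (h1.and h2).of_eq fun l => ?_
  simp only [List.mem_range]
  constructor
  · rintro ⟨hl, h⟩
    have hD : Nonempty D := inferInstance
    have hex : ∀ s ∈ W, ∃ i, ∃ h : i < W.length, W[i] = s := fun s hs => List.getElem_of_mem hs
    choose! ix hix hix' using hex
    have hK : Set.InjOn (fun s => l.getD (ix s) hD.some) {s | s ∈ W} := by
      intro s hs s' hs' e
      have a1 := hix s hs
      have a2 := hix s' hs'
      dsimp only at e
      rw [List.getD_eq_getElem _ _ (by omega), List.getD_eq_getElem _ _ (by omega)] at e
      have := (h _ a1 _ a2).1 (by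
        rw [List.getElem?_eq_getElem (by omega), List.getElem?_eq_getElem (by omega), e])
      rw [List.getElem?_eq_getElem a1, List.getElem?_eq_getElem a2, Option.some.injEq,
        hix' s hs, hix' s' hs'] at this
      exact this
    obtain ⟨v, hv, hv'⟩ := exists_injective_extension W.finite_toSet hK
    refine ⟨v, hv, List.ext_getElem (by simp [hl]) fun i h1 h2 => ?_⟩
    have hi : i < W.length := by omega
    have hm : W[i] ∈ W := List.getElem_mem hi
    rw [List.getElem_map, ← hv' _ hm, List.getD_eq_getElem _ _ (by have := hix _ hm; omega)]
    have := (h _ hi _ (hix _ hm)).2 (by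
      rw [List.getElem?_eq_getElem hi, List.getElem?_eq_getElem (hix _ hm), hix' _ hm])
    rw [List.getElem?_eq_getElem (by omega),
      List.getElem?_eq_getElem (by have := hix _ hm; omega)] at this
    exact Option.some.inj this
  · rintro ⟨v, hv, rfl⟩
    refine ⟨by simp, fun i _ j _ => ?_⟩
    rw [List.getElem?_map, List.getElem?_map]
    exact (Option.map_injective hv).eq_iff

/-- Beyond the halting configuration the trace is arbitrary, so membership depends only on whether a
prefix of fixed length is a renaming of one word. -/
theorem effMonitorableSat_of_haltsAt [Primcodable D] [Infinite D] (hM : M.Valid) {n : ℕ}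
    (hn : M.HaltsAt w n) : EffMonitorableSat {t : Trace D | M.EncodesRunOn w t} := by
  refine ⟨_, (primrecPred_pattern (M.runWord w n)).computablePred.to_re, fun t => ?_⟩
  rw [Set.mem_ofPred_eq]
  constructor
  · rintro ⟨v, hv, h⟩
    have hsub : ∀ s ∈ M.runWord w n, s ∈ M.symbols := by
      intro s hs
      rcases (mem_runWord hM).1 hs with h | ⟨k, -, rfl⟩
      · exact isConst_mem h
      · intro p hp; cases hp
    obtain ⟨u, hu, hu'⟩ := exists_injective_extension (M.runWord w n).finite_toSet
      (hv.mono fun s hs => hsub s hs)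
    exact ⟨_, u, hu, (h n hn.1).trans (List.map_congr_left fun s hs => hu' s hs)⟩
  · rintro ⟨k, v, hv, h⟩
    have hk : k = (M.runWord w n).length := by
      have := congrArg List.length h
      simpa [Trace.take] using this
    subst hk
    refine ⟨v, hv.injOn, fun m hm => DTM.EncodesUpTo.mono (n' := n) h ?_⟩
    by_contra hlt
    exact hm n (not_le.1 hlt) hn.2

/-- Suppose the infinite encoding is accepted after `N` actions. Continued with a constant instead,
the trace is still accepted, but block `N` starts no earlier than that, and in an encoding its
separator and its state would be different values. -/
theorem not_monitorableSat_of_not_halts [Infinite D] (hM : M.Valid) (hn : ∀ n, ¬ M.HaltsAt w n) :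
    ¬ MonitorableSat {t : Trace D | M.EncodesRunOn w t} := by
  have hst : ∀ n, (M.cfg w n).state ≠ M.final := fun n h =>
    (not_exists.2 hn) (DTM.exists_haltsAt_iff.2 ⟨n, h⟩)
  have hal : ∀ n, M.Alive w n := fun n i _ => hst i
  rintro ⟨m, hs, hc⟩
  obtain ⟨v, hv, -⟩ := exists_injective_extension (D := D) Set.finite_empty
    (K := fun _ => Classical.arbitrary D) (Set.injOn_empty _)
  -- the encoding of the run
  let W : ℕ → List Symb := fun n => M.prelude ++ pairWord (M.item w) n
  have hWlen : ∀ n, (W n).length = M.prelude.length + 2 * n := fun n => by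
    simp [W, pairWord_length]
  have hWpre : ∀ a b, a ≤ b → W a <+: W b := by
    intro a b hab
    obtain ⟨c, rfl⟩ := Nat.exists_eq_add_of_le hab
    refine ⟨pairWord (fun j => M.item w (a + j)) c, ?_⟩
    simp [W, pairWord_add]
  let t : Trace D := fun i => v ((W (i + 1)).getD i Symb.hash)
  have htake : ∀ n, t.take (W n).length = (W n).map v := by
    intro n
    refine List.ext_getElem (by simp [Trace.take]) fun i h1 h2 => ?_
    have hi : i < (W n).length := by simpa using h2
    have hi' : i < (W (i + 1)).length := by rw [hWlen]; omega
    simp only [Trace.take, List.getElem_map, List.getElem_range, t]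
    congr 1
    rw [List.getD_eq_getElem _ _ hi']
    rcases le_total n (i + 1) with h | h
    · exact ((hWpre _ _ h).getElem hi).symm
    · exact (hWpre _ _ h).getElem hi'
  have hrun : ∀ n, M.runWord w n <+: W (M.start w (n + 1) + 1) := by
    intro n
    have h0 := M.pos_start_add w (n + 1) 0 (Nat.zero_le _)
    rw [Nat.add_zero] at h0
    rw [DTM.runWord, DTM.flatMap_enc]
    refine ⟨[(M.item w (M.start w (n + 1))).2], ?_⟩
    change _ = M.prelude ++ pairWord (M.item w) (M.start w (n + 1) + 1)
    rw [pairWord_add]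
    simp [DTM.item, h0, ident, pairWord]
  have ht : M.EncodesRunOn w t := by
    refine ⟨v, hv.injOn, fun n _ => ?_⟩
    obtain ⟨r, hr⟩ := hrun n
    have := htake (M.start w (n + 1) + 1)
    rw [← hr, Trace.take_append_iff] at this
    exact this.1
  obtain ⟨N, hN⟩ := hc t ht
  have ht' : M.EncodesRunOn w fun i => if i < N then t i else t 0 := by
    refine hs _ ⟨N, ?_⟩
    have : Trace.take (fun i => if i < N then t i else t 0) N = t.take N := by
      refine List.map_congr_left fun i hi => if_pos (List.mem_range.1 hi)
    rwa [this]
  obtain ⟨u, hu, h⟩ := ht'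
  have h1 := ((DTM.encodesUpTo_iff _ _ _ _ _).1 (h N (hal N))).2.1 (M.start w N)
    (M.start_strictMono w (Nat.lt_succ_self N))
  have hge : N ≤ M.start w N := (M.start_strictMono w).le_apply
  have h0 := M.pos_start_add w N 0 (Nat.zero_le _)
  rw [Nat.add_zero] at h0
  simp only [pairsOf, Trace.drop, DTM.item, h0, ident, Cfg.content, Prod.mk.injEq] at h1
  rw [if_neg (by omega), if_neg (by omega)] at h1
  have := hu (by intro p hp; cases hp) (by
    intro p hp
    cases hp
    exact DTM.state_lt hM N) (h1.1.symm.trans h1.2)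
  cases this

/-! ### Monitorability of a run amounts to its termination -/

theorem monitorableSat_runForm_iff [Primcodable D] [Infinite D] (hM : M.Valid) (hw : w ≠ []) :
    MonitorableSat ((runForm M w).lang D) ↔ ∃ n, M.HaltsAt w n := by
  rw [runForm_lang hM hw]
  constructor
  · intro h
    by_contra hn
    exact not_monitorableSat_of_not_halts hM (not_exists.1 hn) h
  · rintro ⟨n, hn⟩
    exact (effMonitorableSat_of_haltsAt hM hn).monitorableSat

theorem effMonitorableSat_runForm_iff [Primcodable D] [Infinite D] (hM : M.Valid) (hw : w ≠ []) :
    EffMonitorableSat ((runForm M w).lang D) ↔ ∃ n, M.HaltsAt w n := by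
  constructor
  · intro h
    exact (monitorableSat_runForm_iff hM hw).1 h.monitorableSat
  · rintro ⟨n, hn⟩
    rw [runForm_lang hM hw]
    exact effMonitorableSat_of_haltsAt hM hn

end

/-- A property of formulae is undecidable if on formulae for runs it amounts to termination. -/
theorem not_decidableProblem {S P : Formula → Prop}
    (hS : ∀ (M : DTM) (w : List Bool), M.Valid → S (runForm M w))
    (hP : ∀ (M : DTM) (w : List Bool), M.Valid → w ≠ [] →
      (P (runForm M w) ↔ ∃ n, M.HaltsAt w n)) : ¬ DecidableProblem S P := by
  rintro ⟨f, hf, h⟩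
  obtain ⟨U, u, v, hU, hu, hun⟩ := exists_undecidable_halting
  refine hun ?_
  have hw : Primrec fun m : ℕ => u ++ (List.replicate m v).flatten := by
    refine Primrec.list_append.comp (Primrec.const u) ((Primrec.nat_rec₁ []
      (Primrec.list_append.comp (Primrec.const v) Primrec.snd).to₂).of_eq fun m => ?_)
    induction m with
    | zero => rfl
    | succ m ih => rw [List.replicate_succ, List.flatten_cons, ← ih]
  have hc : Computable fun m : ℕ => f (runForm U (u ++ (List.replicate m v).flatten)) :=
    hf.comp (Primrec.runForm.comp (Primrec.const U) hw).to_comp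
  refine ComputablePred.computable_iff.2 ⟨_, hc, funext fun m => propext ?_⟩
  rw [h _ (hS U _ hU), hP U _ hU (by simp [hu])]

end RecHML

theorem mainTheorem7 {D : Type*} [Primcodable D] [Infinite D] :
    -- formulae that define encodings of runs, computable from the machine
    (∃ ψe ψn : RecHML.DTM → RecHML.Formula, Computable ψe ∧ Computable ψn ∧
      ∀ M : RecHML.DTM, M.Valid →
        ((ψe M).IsSHML ∧
          (ψe M).lang D = {t : RecHML.Trace D | M.EncodesRunOn [false] t}) ∧
        ((ψn M).IsRecHML ∧
          (ψn M).lang D =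
            {t : RecHML.Trace D | M.EncodesRunPrefix t ∧ ¬ M.EncodesTerminatingRun t})) ∧
    -- undecidability for sHMLd
    ¬ RecHML.DecidableProblem RecHML.Formula.IsSHML
        (fun φ => RecHML.MonitorableSat (φ.lang D)) ∧
    ¬ RecHML.DecidableProblem RecHML.Formula.IsSHML
        (fun φ => RecHML.EffMonitorableSat (φ.lang D)) ∧
    -- undecidability for recHMLd
    ¬ RecHML.DecidableProblem RecHML.Formula.IsRecHML
        (fun φ => RecHML.MonitorableSat (φ.lang D)) ∧
    ¬ RecHML.DecidableProblem RecHML.Formula.IsRecHML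
        (fun φ => RecHML.EffMonitorableSat (φ.lang D)) := by
  refine ⟨⟨fun M => RecHML.runForm M [false], RecHML.nonTermForm,
    (RecHML.Primrec.runForm.comp Primrec.id (Primrec.const [false])).to_comp,
    RecHML.Primrec.nonTermForm.to_comp, fun M hM =>
      ⟨⟨RecHML.runForm_isSHML hM _, RecHML.runForm_lang hM (List.cons_ne_nil _ _)⟩,
        RecHML.nonTermForm_isRecHML hM, RecHML.nonTermForm_lang hM⟩⟩, ?_, ?_, ?_, ?_⟩
  · exact RecHML.not_decidableProblem (fun M w hM => RecHML.runForm_isSHML hM w)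
      fun M w hM hw => RecHML.monitorableSat_runForm_iff hM hw
  · exact RecHML.not_decidableProblem (fun M w hM => RecHML.runForm_isSHML hM w)
      fun M w hM hw => RecHML.effMonitorableSat_runForm_iff hM hw
  · exact RecHML.not_decidableProblem (fun M w hM => RecHML.runForm_isRecHML hM w)
      fun M w hM hw => RecHML.monitorableSat_runForm_iff hM hw
  · exact RecHML.not_decidableProblem (fun M w hM => RecHML.runForm_isRecHML hM w)
      fun M w hM hw => RecHML.effMonitorableSat_runForm_iff hM hw
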